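/- Let $s\in(0,1)$, $p\in(1,\infty)$ and let $N$ be an integer with $N>p$. Put $p^*=\frac{Np}{N-p}$, $$[u]_{s,p}=\Big(\iint_{\mathbb{R}^{2N}}\frac{|u(x)-u(y)|^p}{|x-y|^{N+sp}}\,dx\,dy\Big)^{1/p},$$ and let $\mathcal{W}_p$ be the completion of $C_c^\infty(\mathbb{R}^N)$ with respect to the norm $\rho_p(u)=\|\nabla u\|_{L^p(\mathbb{R}^N)}+[u]_{s,p}$, regarded through the Sobolev inequality as a space of functions in $L^{p^*}(\mathbb{R}^N)$ (namely the $L^{p^*}$-limits of $\rho_p$-Cauchy sequences in $C_c^\infty(\mathbb{R}^N)$). A function $u\in\mathcal{W}_p$ is a weak solution of $$-\Delta_p u+(-\Delta_p)^s u=|u|^{p^*-2}u\quad\text{in }\mathbb{R}^N$$ if for every $v\in\mathcal{W}_p$ $$\int_{\mathbb{R}^N}|\nabla u|^{p-2}\nabla u\cdot\nabla v\,dx+\iint_{\mathbb{R}^{2N}}\frac{|u(x)-u(y)|^{p-2}(u(x)-u(y))(v(x)-v(y))}{|x-y|^{N+sp}}\,dx\,dy=\int_{\mathbb{R}^N}|u|^{p^*-2}uv\,dx,$$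 where $\nabla$ denotes the weak gradient. Then there is a constant $C=C(N,s,p)$, depending only on $N$, $s$ and $p$, such that every weak solution $u\in\mathcal{W}_p$ of this equation is essentially bounded on $\mathbb{R}^N$, with $\|u\|_{L^\infty(\mathbb{R}^N)}\le C$. -/

import Mathlib

open MeasureTheory Filter Topology
open scoped ENNReal NNReal ContDiff

namespace MixedPLaplace

noncomputable section

/-- The space `ℝ^N` with its Euclidean norm and Lebesgue measure. -/
abbrev Space (N : ℕ) : Type := EuclideanSpace ℝ (Fin N)

/-- The critical Sobolev exponent `p^* = N p / (N - p)`. -/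
def critExp (N : ℕ) (p : ℝ) : ℝ := (N : ℝ) * p / ((N : ℝ) - p)

/-- `φ ∈ C_c^∞(ℝ^N)`. -/
def IsTestFunction {N : ℕ} (φ : Space N → ℝ) : Prop :=
  ContDiff ℝ ∞ φ ∧ HasCompactSupport φ

/-- The locally integrable vector field `G` is a weak (distributional) gradient of the
locally integrable function `u`. -/
def HasWeakGradient {N : ℕ} (u : Space N → ℝ) (G : Space N → Space N) : Prop :=
  LocallyIntegrable u volume ∧ LocallyIntegrable G volume ∧
    ∀ φ : Space N → ℝ, IsTestFunction φ →
      ∫ x, u x • gradient φ x = - ∫ x, φ x • G x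

open Classical in
/-- The weak gradient of `u`, which is unique up to a null set when it exists
(and the zero field, by convention, when it does not). -/
def weakGrad {N : ℕ} (u : Space N → ℝ) : Space N → Space N :=
  if h : ∃ G, HasWeakGradient u G then h.choose else 0

/-- The Gagliardo seminorm `[u]_{s,p}`, with values in `[0, ∞]`. -/
def gagliardo {N : ℕ} (s p : ℝ) (u : Space N → ℝ) : ℝ≥0∞ :=
  (∫⁻ z : Space N × Space N,
    ENNReal.ofReal (|u z.1 - u z.2| ^ p / ‖z.1 - z.2‖ ^ ((N : ℝ) + s * p))) ^ (1 / p)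

/-- The norm `ρ_p(φ) = ‖∇φ‖_p + [φ]_{s,p}` of a smooth function `φ`. -/
def rhoSmooth {N : ℕ} (s p : ℝ) (φ : Space N → ℝ) : ℝ≥0∞ :=
  eLpNorm (gradient φ) (ENNReal.ofReal p) volume + gagliardo s p φ

/-- Membership in `W_p`, the completion of `C_c^∞(ℝ^N)` for the norm `ρ_p`. By the Sobolev
inequality a `ρ_p`-Cauchy sequence of test functions converges in `L^{p^*}`, and the completion
is the space of these `L^{p^*}`-limits. -/
def MemW {N : ℕ} (s p : ℝ) (u : Space N → ℝ) : Prop :=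
  MemLp u (ENNReal.ofReal (critExp N p)) volume ∧
    ∃ φ : ℕ → Space N → ℝ,
      (∀ n, IsTestFunction (φ n)) ∧
      Tendsto (fun n => eLpNorm (φ n - u) (ENNReal.ofReal (critExp N p)) volume) atTop (𝓝 0) ∧
      Tendsto (fun k : ℕ × ℕ => rhoSmooth s p (φ k.1 - φ k.2)) atTop (𝓝 0)

/-- `∫ |∇u|^{p-2} ∇u · ∇v dx`. -/
def localForm {N : ℕ} (p : ℝ) (u v : Space N → ℝ) : ℝ :=
  ∫ x, ‖weakGrad u x‖ ^ (p - 2) * inner ℝ (weakGrad u x) (weakGrad v x)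

/-- `∬ |u(x)-u(y)|^{p-2} (u(x)-u(y)) (v(x)-v(y)) / |x-y|^{N+sp} dx dy`. -/
def nonlocalForm {N : ℕ} (s p : ℝ) (u v : Space N → ℝ) : ℝ :=
  ∫ z : Space N × Space N,
    |u z.1 - u z.2| ^ (p - 2) * (u z.1 - u z.2) * (v z.1 - v z.2) /
      ‖z.1 - z.2‖ ^ ((N : ℝ) + s * p)

/-- `u ∈ W_p` is a weak solution of `-Δ_p u + (-Δ_p)^s u = |u|^{p^*-2} u` on `ℝ^N`. -/
def IsWeakSolution {N : ℕ} (s p : ℝ) (u : Space N → ℝ) : Prop :=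
  MemW s p u ∧
    ∀ v : Space N → ℝ, MemW s p v →
      localForm p u v + nonlocalForm s p u v =
        ∫ x, |u x| ^ (critExp N p - 2) * u x * v x

end

end MixedPLaplace

namespace MixedPLaplace

/-! ### Convergence and completeness in `L^q`, expressed through `eLpNorm`. -/

section Generic

variable {α : Type*} [MeasurableSpace α] {μ : Measure α}
  {E F : Type*} [NormedAddCommGroup E] [NormedAddCommGroup F]

/-! Write `q = p^*`, `A = ∫|∇u|^p`, `B = [u]_{s,p}^p` and `Q = ∫|u|^q`. Under `x ↦ (1 + t) x` these
quantities scale with exponents `p - N`, `sp - N` and `-N`. Stationarity of `A/p + B/p - Q/q` along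
dilations therefore suggests the Pohozaev identity `(p - N) A/p + (sp - N) B/p = -N Q/q`. Testing
the equation with `u` gives `A + B = Q`, and `N/q = (N - p)/p` by criticality. Together they leave
`p (1 - s) B = 0`, so `u` is constant, hence zero because it lies in `L^q`. The uniform bound then
holds with constant `0`.

Only the inequality `p (1 - s) B ≤ 0` is needed, and it is obtained without regularity of `u`. The
equation is tested with `u ∘ T - u`, where `T` is close to the identity. Convexity of `‖·‖^p` bounds
the left side above by differences of energies (`IsWeakSolution.energy_inequality`). On the right,
convexity at `u ∘ T` gives a lower bound up to the error `∫ (f(u ∘ T) - f(u)) (u ∘ T - u)` with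
`f(t) = |t|^{q-2} t`. This error must be `o(t)`. By Hölder it is at most the product of an `L^{p'}`
norm that tends to zero and an `L^p` norm that is `O(t)` (`tendsto_eLpNorm_comp_sub`,
`WApprox.eLpNorm_comp_sub_le`).

The first factor requires `f(u) ∈ L^{p'}`, which comes from a Brezis–Kato and Moser type argument
with smooth truncated powers (`IsWeakSolution.memLp_of_critExp_le`). The second requires bounded
displacement, so true dilations are replaced by maps that are dilations on a ball of radius `R` and
are controlled elsewhere by a constant `L` independent of `R` (`exists_isLocalDilation`). Dividing
by `t` and letting `t → 0+` gives `IsWeakSolution.local_pohozaev`, whose errors are tails outside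
the ball; they vanish as `R → ∞` in `IsWeakSolution.lintegral_increment_eq_zero`. -/

theorem eLpNorm_ofReal_eq {q : ℝ} (hq : 0 < q) (f : α → E) :
    eLpNorm f (ENNReal.ofReal q) μ = (∫⁻ x, ‖f x‖ₑ ^ q ∂μ) ^ (1 / q) := by
  rw [eLpNorm_eq_lintegral_rpow_enorm_toReal (by simpa using hq) (by simp),
    ENNReal.toReal_ofReal hq.le]

theorem eLpNorm_ofReal_rpow {q : ℝ} (hq : 0 < q) (f : α → E) :
    eLpNorm f (ENNReal.ofReal q) μ ^ q = ∫⁻ x, ‖f x‖ₑ ^ q ∂μ := by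
  rw [eLpNorm_ofReal_eq hq, ← ENNReal.rpow_mul, one_div_mul_cancel hq.ne', ENNReal.rpow_one]

theorem lintegral_rpow_lt_top {q : ℝ} (hq : 0 < q) {f : α → E}
    (hf : MemLp f (ENNReal.ofReal q) μ) : ∫⁻ x, ‖f x‖ₑ ^ q ∂μ < ⊤ := by
  rw [← eLpNorm_ofReal_rpow hq]
  exact ENNReal.rpow_lt_top_of_nonneg hq.le hf.eLpNorm_lt_top.ne

theorem integrable_norm_rpow_of_memLp {q : ℝ} (hq : 0 < q) {f : α → E}
    (hf : MemLp f (ENNReal.ofReal q) μ) : Integrable (fun x => ‖f x‖ ^ q) μ := by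
  have := hf.integrable_norm_rpow (by simpa using hq) (by simp)
  rwa [ENNReal.toReal_ofReal hq.le] at this

theorem toReal_lintegral_enorm_rpow {q : ℝ} (hq : 0 < q) {f : α → E}
    (hf : AEStronglyMeasurable f μ) :
    (∫⁻ x, ‖f x‖ₑ ^ q ∂μ).toReal = ∫ x, ‖f x‖ ^ q ∂μ := by
  rw [integral_eq_lintegral_of_nonneg_ae (Eventually.of_forall fun x => by positivity)
    (hf.norm.aemeasurable.pow_const q).aestronglyMeasurable]
  congr 2 with x
  rw [← ENNReal.ofReal_rpow_of_nonneg (norm_nonneg _) hq.le, ofReal_norm]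

/-- Generalised dominated convergence in `L^q`. -/
theorem tendsto_eLpNorm_of_dominated {q : ℝ} (hq : 1 ≤ q) {f : ℕ → α → E} {g : α → E}
    {h : ℕ → α → F} {k : α → F} {L : ℝ} (hL : 0 ≤ L)
    (hfm : ∀ n, AEStronglyMeasurable (f n) μ) (hg : MemLp g (ENNReal.ofReal q) μ)
    (hhm : ∀ n, AEStronglyMeasurable (h n) μ) (hkm : AEStronglyMeasurable k μ)
    (hfg : Tendsto (fun n => eLpNorm (f n - g) (ENNReal.ofReal q) μ) atTop (𝓝 0))
    (hhf : ∀ n, ∀ᵐ x ∂μ, ‖h n x‖ ≤ L * ‖f n x‖) (hkg : ∀ᵐ x ∂μ, ‖k x‖ ≤ L * ‖g x‖)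
    (hlim : ∀ᵐ x ∂μ, Tendsto (fun n => h n x) atTop (𝓝 (k x))) :
    Tendsto (fun n => eLpNorm (h n - k) (ENNReal.ofReal q) μ) atTop (𝓝 0) := by
  have hq0 : 0 < q := by linarith
  -- The cap `2L‖g‖` is an `L^q` majorant independent of `n`, so `ψ n → 0` by ordinary dominated
  -- convergence. What the cap cuts off is at most `L‖f n - g‖`, which tends to zero by hypothesis.
  set ψ : ℕ → α → ℝ := fun n x => min ‖h n x - k x‖ (2 * L * ‖g x‖) with hψ
  have hψ0 : ∀ n x, 0 ≤ ψ n x := fun n x => le_min (norm_nonneg _) (by positivity)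
  have hψm : ∀ n, AEStronglyMeasurable (ψ n) μ := fun n =>
    ((hhm n).sub hkm).norm.inf (hg.1.norm.const_mul _)
  have h1 : Tendsto (fun n => eLpNorm (ψ n) (ENNReal.ofReal q) μ) atTop (𝓝 0) := by
    have : Tendsto (fun n => ∫⁻ x, ‖ψ n x‖ₑ ^ q ∂μ) atTop (𝓝 (∫⁻ _, 0 ∂μ)) := by
      refine tendsto_lintegral_of_dominated_convergence' (fun x => ‖(2 * L) * ‖g x‖‖ₑ ^ q)
        (fun n => (hψm n).enorm.pow_const q) ?_ ?_ ?_
      · intro n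
        refine Eventually.of_forall fun x => ?_
        refine ENNReal.rpow_le_rpow ?_ hq0.le
        rw [Real.enorm_of_nonneg (hψ0 n x), Real.enorm_of_nonneg (by positivity)]
        exact ENNReal.ofReal_le_ofReal (min_le_right _ _)
      · exact (lintegral_rpow_lt_top hq0 (hg.norm.const_mul (2 * L))).ne
      · filter_upwards [hlim] with x hx
        have h2 : Tendsto (fun n => ψ n x) atTop (𝓝 0) := by
          refine squeeze_zero (fun n => hψ0 n x) (fun n => min_le_left _ _) ?_
          exact tendsto_iff_norm_sub_tendsto_zero.1 hx
        have h3 : Tendsto (fun n => ‖ψ n x‖ₑ) atTop (𝓝 0) := by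
          simpa using h2.enorm
        have h4 := h3.ennrpow_const q
        rwa [ENNReal.zero_rpow_of_pos hq0] at h4
    rw [lintegral_zero] at this
    have h4 := this.ennrpow_const (1 / q)
    rw [ENNReal.zero_rpow_of_pos (by positivity)] at h4
    refine h4.congr fun n => ?_
    rw [eLpNorm_ofReal_eq hq0]
  have h2 : ∀ n, eLpNorm (h n - k) (ENNReal.ofReal q) μ ≤
      eLpNorm (ψ n) (ENNReal.ofReal q) μ +
        ENNReal.ofReal L * eLpNorm (f n - g) (ENNReal.ofReal q) μ := by
    intro n
    have hm2 : AEStronglyMeasurable (fun x => L * ‖(f n - g) x‖) μ :=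
      ((hfm n).sub hg.1).norm.const_mul L
    calc eLpNorm (h n - k) (ENNReal.ofReal q) μ
        ≤ eLpNorm (ψ n + fun x => L * ‖(f n - g) x‖) (ENNReal.ofReal q) μ := by
          refine eLpNorm_mono_ae ?_
          filter_upwards [hhf n, hkg] with x hx1 hx2
          have e1 : ‖h n x - k x‖ ≤ ‖h n x‖ + ‖k x‖ := norm_sub_le _ _
          have e2 : ‖f n x‖ ≤ ‖f n x - g x‖ + ‖g x‖ := by
            simpa using norm_add_le (f n x - g x) (g x)
          have e3 := mul_le_mul_of_nonneg_left e2 hL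
          have e4 : 0 ≤ L * ‖f n x - g x‖ := by positivity
          simp only [Pi.add_apply, Pi.sub_apply]
          rw [Real.norm_of_nonneg (add_nonneg (hψ0 n x) e4)]
          rcases le_total ‖h n x - k x‖ (2 * L * ‖g x‖) with e | e
          · simp only [hψ, min_eq_left e]; linarith
          · simp only [hψ, min_eq_right e]; linarith
      _ ≤ _ := by
          refine (eLpNorm_add_le (hψm n) hm2 (by simpa using hq)).trans ?_
          gcongr
          refine (eLpNorm_const_smul_le (c := L) (f := fun x => ‖(f n - g) x‖)).trans ?_
          rw [eLpNorm_norm, Real.enorm_of_nonneg hL]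
  have h3 : Tendsto (fun n => eLpNorm (ψ n) (ENNReal.ofReal q) μ +
        ENNReal.ofReal L * eLpNorm (f n - g) (ENNReal.ofReal q) μ) atTop (𝓝 0) := by
    have := h1.add (ENNReal.Tendsto.const_mul hfg (Or.inr (ENNReal.ofReal_ne_top (r := L))))
    simpa using this
  exact tendsto_of_tendsto_of_tendsto_of_le_of_le tendsto_const_nhds h3 (fun _ => zero_le) h2

/-- A sequence converging in `L^q` has an almost everywhere convergent subsequence. -/
theorem exists_subseq_ae_tendsto {q : ℝ} (hq : 1 ≤ q) {f : ℕ → α → E} {g : α → E}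
    (hfm : ∀ n, AEStronglyMeasurable (f n) μ) (hg : AEStronglyMeasurable g μ)
    (hfg : Tendsto (fun n => eLpNorm (f n - g) (ENNReal.ofReal q) μ) atTop (𝓝 0)) :
    ∃ ns : ℕ → ℕ, StrictMono ns ∧ ∀ᵐ x ∂μ, Tendsto (fun n => f (ns n) x) atTop (𝓝 (g x)) :=
  (tendstoInMeasure_of_tendsto_eLpNorm
    (by simpa using (by linarith : 0 < q)) hfm hg hfg).exists_seq_tendsto_ae

/-- Completeness of `L^q` for sequences whose double differences tend to zero. -/
theorem exists_limit_of_cauchy [CompleteSpace E] {q : ℝ} (hq : 1 ≤ q) {f : ℕ → α → E}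
    (hf : ∀ n, MemLp (f n) (ENNReal.ofReal q) μ)
    (hc : Tendsto (fun k : ℕ × ℕ => eLpNorm (f k.1 - f k.2) (ENNReal.ofReal q) μ)
      atTop (𝓝 0)) :
    ∃ g, MemLp g (ENNReal.ofReal q) μ ∧
      Tendsto (fun n => eLpNorm (f n - g) (ENNReal.ofReal q) μ) atTop (𝓝 0) := by
  have : Fact (1 ≤ ENNReal.ofReal q) := ⟨by simpa using hq⟩
  have hcs : CauchySeq fun n => (hf n).toLp (f n) := by
    rw [EMetric.cauchySeq_iff]
    intro ε hε
    have := (ENNReal.tendsto_nhds_zero.1 hc (ε / 2) (by simpa using hε.ne'))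
    -- The bound obtained is non-strict, hence the halving. For `ε = ⊤` halving gains nothing, but
    -- distances in `L^q` are finite.
    have hlt : ε / 2 < ε ∨ ε = ⊤ := by
      by_cases h : ε = ⊤
      · exact Or.inr h
      · exact Or.inl (ENNReal.half_lt_self hε.ne' h)
    rw [eventually_atTop] at this
    obtain ⟨⟨a, b⟩, hab⟩ := this
    refine ⟨max a b, fun m hm n hn => ?_⟩
    rw [Lp.edist_toLp_toLp]
    rcases hlt with h | h
    · exact (hab (m, n) ⟨le_trans (le_max_left _ _) hm, le_trans (le_max_right _ _) hn⟩).trans_lt h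
    · rw [h]; exact ((hf m).sub (hf n)).eLpNorm_lt_top
  obtain ⟨g, hg⟩ := cauchySeq_tendsto_of_complete hcs
  refine ⟨g, Lp.memLp g, ?_⟩
  rw [Lp.tendsto_Lp_iff_tendsto_eLpNorm'] at hg
  refine hg.congr fun n => ?_
  refine eLpNorm_congr_ae ?_
  filter_upwards [(hf n).coeFn_toLp] with x hx
  simp [hx]

end Generic

/-! ### Convexity of `‖·‖^p` in an inner product space. -/

section Convexity

variable {E : Type*} [NormedAddCommGroup E] [InnerProductSpace ℝ E]

/-- Cauchy–Schwarz followed by Young's inequality with exponents `p/(p-1)` and `p`. The constants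
are sharp (equality at `b = a`), which is why the tangent inequality follows by subtraction. -/
theorem rpow_sub_two_mul_inner_le {p : ℝ} (hp : 1 < p) (a b : E) :
    ‖a‖ ^ (p - 2) * inner ℝ a b ≤ (1 - 1 / p) * ‖a‖ ^ p + ‖b‖ ^ p / p := by
  have hp0 : 0 < p := by linarith
  rcases eq_or_ne a 0 with rfl | ha
  · simp [hp0.ne']; positivity
  have ha' : 0 < ‖a‖ := norm_pos_iff.2 ha
  have h1 : ‖a‖ ^ (p - 2) * inner ℝ a b ≤ ‖a‖ ^ (p - 1) * ‖b‖ := by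
    calc ‖a‖ ^ (p - 2) * inner ℝ a b ≤ ‖a‖ ^ (p - 2) * (‖a‖ * ‖b‖) := by
          gcongr; exact real_inner_le_norm a b
      _ = ‖a‖ ^ (p - 2) * ‖a‖ ^ (1 : ℝ) * ‖b‖ := by rw [Real.rpow_one]; ring
      _ = _ := by rw [← Real.rpow_add ha']; congr 2; ring
  have hc : (p / (p - 1)).HolderConjugate p := (Real.HolderConjugate.conjExponent hp).symm
  have h2 := Real.young_inequality_of_nonneg (a := ‖a‖ ^ (p - 1)) (b := ‖b‖)
    (by positivity) (norm_nonneg b) hc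
  have h3 : (‖a‖ ^ (p - 1)) ^ (p / (p - 1)) = ‖a‖ ^ p := by
    rw [← Real.rpow_mul ha'.le]; congr 1; field_simp [(by linarith : p - 1 ≠ 0)]
  rw [h3] at h2
  have h4 : ‖a‖ ^ p / (p / (p - 1)) = (1 - 1 / p) * ‖a‖ ^ p := by
    field_simp
  linarith

theorem rpow_sub_two_mul_inner_self {p : ℝ} (hp : 0 < p) (a : E) :
    ‖a‖ ^ (p - 2) * inner ℝ a a = ‖a‖ ^ p := by
  rcases eq_or_ne a 0 with rfl | ha
  · simp [hp.ne']
  have ha' : 0 < ‖a‖ := norm_pos_iff.2 ha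
  rw [real_inner_self_eq_norm_sq, ← Real.rpow_natCast, ← Real.rpow_add ha']
  congr 1; push_cast; ring

/-- The tangent inequality for the convex function `‖·‖^p / p`. -/
theorem rpow_sub_two_mul_inner_sub_le {p : ℝ} (hp : 1 < p) (a b : E) :
    ‖a‖ ^ (p - 2) * inner ℝ a (b - a) ≤ (‖b‖ ^ p - ‖a‖ ^ p) / p := by
  have h := rpow_sub_two_mul_inner_le hp a b
  have h2 := rpow_sub_two_mul_inner_self (by linarith : 0 < p) a
  rw [inner_sub_right, mul_sub, h2]
  have : (‖b‖ ^ p - ‖a‖ ^ p) / p = ‖b‖ ^ p / p - 1 / p * ‖a‖ ^ p := by ring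
  linarith

variable {α : Type*} [MeasurableSpace α] {μ : Measure α}

theorem integrable_rpow_sub_two_mul_inner {p : ℝ} (hp : 1 < p) {f g : α → E}
    (hf : MemLp f (ENNReal.ofReal p) μ) (hg : MemLp g (ENNReal.ofReal p) μ) :
    Integrable (fun x => ‖f x‖ ^ (p - 2) * inner ℝ (f x) (g x)) μ := by
  have hp0 : 0 < p := by linarith
  refine Integrable.mono'
    (((integrable_norm_rpow_of_memLp hp0 hf).const_mul (1 - 1 / p)).add
      ((integrable_norm_rpow_of_memLp hp0 hg).div_const p)) ?_ ?_
  · exact (hf.1.norm.aemeasurable.pow_const _).aestronglyMeasurable.mul (hf.1.inner hg.1)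
  · refine Eventually.of_forall fun x => ?_
    rw [Real.norm_eq_abs, abs_le]
    have h1 := rpow_sub_two_mul_inner_le hp (f x) (g x)
    -- Changing the sign of the second argument turns the one-sided Young bound into a bound on the
    -- absolute value.
    have h2 := rpow_sub_two_mul_inner_le hp (f x) (-g x)
    rw [inner_neg_right, norm_neg] at h2
    simp only [Pi.add_apply]
    constructor <;> linarith

/-- Stated for a general measure so that it serves both energies: gradients under Lebesgue measure
and increments under the kernel measure. -/
theorem integral_rpow_sub_two_mul_inner_sub_le {p : ℝ} (hp : 1 < p) {f g : α → E}
    (hf : MemLp f (ENNReal.ofReal p) μ) (hg : MemLp g (ENNReal.ofReal p) μ) :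
    ∫ x, ‖f x‖ ^ (p - 2) * inner ℝ (f x) (g x - f x) ∂μ ≤
      ((∫ x, ‖g x‖ ^ p ∂μ) - ∫ x, ‖f x‖ ^ p ∂μ) / p := by
  have hp0 : 0 < p := by linarith
  have i1 := integrable_norm_rpow_of_memLp hp0 hf
  have i2 := integrable_norm_rpow_of_memLp hp0 hg
  rw [← integral_sub i2 i1, ← integral_div]
  exact integral_mono (integrable_rpow_sub_two_mul_inner hp hf (hg.sub hf))
    ((i2.sub i1).div_const p) fun x => rpow_sub_two_mul_inner_sub_le hp _ _

end Convexity

/-! ### The Gagliardo seminorm as an `L^p` norm of increments, and test functions. -/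

section Kernel

variable {N : ℕ}

/-- The measure `|x - y|^{-(N+sp)} dx dy`. -/
noncomputable def kernelMeasure (N : ℕ) (s p : ℝ) : Measure (Space N × Space N) :=
  volume.withDensity fun z => ENNReal.ofReal ((‖z.1 - z.2‖ ^ ((N : ℝ) + s * p))⁻¹)

/-- The increment `(x, y) ↦ u x - u y`. -/
def increment (u : Space N → ℝ) (z : Space N × Space N) : ℝ := u z.1 - u z.2

theorem measurable_kernel (N : ℕ) (a : ℝ) :
    Measurable fun z : Space N × Space N => ENNReal.ofReal ((‖z.1 - z.2‖ ^ a)⁻¹) := by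
  fun_prop

theorem kernelMeasure_absolutelyContinuous (s p : ℝ) :
    kernelMeasure N s p ≪ volume := withDensity_absolutelyContinuous _ _

theorem aestronglyMeasurable_increment_volume {u : Space N → ℝ}
    (hu : AEStronglyMeasurable u volume) : AEStronglyMeasurable (increment u) volume :=
  (hu.comp_fst (ν := (volume : Measure (Space N)))).sub
    (hu.comp_snd (μ := (volume : Measure (Space N))))

theorem aestronglyMeasurable_increment {u : Space N → ℝ} (s p : ℝ)
    (hu : AEStronglyMeasurable u volume) :
    AEStronglyMeasurable (increment u) (kernelMeasure N s p) :=
  (aestronglyMeasurable_increment_volume hu).mono_ac (kernelMeasure_absolutelyContinuous s p)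

theorem increment_sub (u v : Space N → ℝ) : increment (u - v) = increment u - increment v := by
  ext z; simp [increment]; ring

theorem lintegral_kernelMeasure {s p : ℝ} {g : Space N × Space N → ℝ≥0∞}
    (hg : AEMeasurable g volume) :
    ∫⁻ z, g z ∂kernelMeasure N s p =
      ∫⁻ z, ENNReal.ofReal ((‖z.1 - z.2‖ ^ ((N : ℝ) + s * p))⁻¹) * g z := by
  rw [kernelMeasure, lintegral_withDensity_eq_lintegral_mul₀
    (measurable_kernel N _).aemeasurable hg]
  rfl

theorem lintegral_increment_eq {s p : ℝ} (hp : 0 < p) {u : Space N → ℝ}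
    (hu : AEStronglyMeasurable u volume) :
    ∫⁻ z, ‖increment u z‖ₑ ^ p ∂kernelMeasure N s p = ∫⁻ z : Space N × Space N,
      ENNReal.ofReal (|u z.1 - u z.2| ^ p / ‖z.1 - z.2‖ ^ ((N : ℝ) + s * p)) := by
  rw [lintegral_kernelMeasure ((aestronglyMeasurable_increment_volume hu).enorm.pow_const p)]
  congr 1 with z
  rw [div_eq_inv_mul, ENNReal.ofReal_mul (by positivity),
    ← ENNReal.ofReal_rpow_of_nonneg (abs_nonneg _) hp.le, ← Real.norm_eq_abs, ofReal_norm]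
  rfl

theorem gagliardo_eq {s p : ℝ} (hp : 0 < p) {u : Space N → ℝ}
    (hu : AEStronglyMeasurable u volume) :
    gagliardo s p u = eLpNorm (increment u) (ENNReal.ofReal p) (kernelMeasure N s p) := by
  rw [eLpNorm_ofReal_eq hp, lintegral_increment_eq hp hu, gagliardo]

/-- Absorbing the singular kernel into the measure gives the nonlocal form the same shape as the
local one, so the same convexity lemmas apply to it. -/
theorem nonlocalForm_eq (s p : ℝ) (u v : Space N → ℝ) :
    nonlocalForm s p u v = ∫ z, ‖increment u z‖ ^ (p - 2) *
      inner ℝ (increment u z) (increment v z) ∂kernelMeasure N s p := by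
  rw [kernelMeasure, integral_withDensity_eq_integral_toReal_smul (measurable_kernel N _)
    (by simp), nonlocalForm]
  congr 1 with z
  rw [ENNReal.toReal_ofReal (by positivity)]
  simp only [increment, Real.norm_eq_abs, smul_eq_mul, RCLike.inner_apply, conj_trivial,
    div_eq_mul_inv]
  ring

/-- Near the origin the integrand is at most `‖z‖^{p - N - sp}`, integrable because `s < 1`. Outside
the unit ball it is `‖z‖^{-N - sp}`, integrable because `sp > 0`. -/
theorem lintegral_min_kernel_lt_top {s p : ℝ} (hs : s ∈ Set.Ioo (0 : ℝ) 1) (hp : 1 < p)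
    (hN : p < (N : ℝ)) :
    ∫⁻ z : Space N, ENNReal.ofReal ((min 1 ‖z‖) ^ p * (‖z‖ ^ ((N : ℝ) + s * p))⁻¹) < ⊤ := by
  have hd : Module.finrank ℝ (Space N) = N := by simp
  have hsp : 0 < s * p := mul_pos hs.1 (by linarith)
  have hsp' : s * p < p := by nlinarith [hs.2]
  set k : Space N → ℝ := fun z => (min 1 ‖z‖) ^ p * (‖z‖ ^ ((N : ℝ) + s * p))⁻¹ with hk
  have hk0 : ∀ z, 0 ≤ k z := fun z => by positivity
  have hkm : AEStronglyMeasurable k volume := by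
    have : Measurable k := by fun_prop
    exact this.aestronglyMeasurable
  have h1 : IntegrableOn k (Metric.ball 0 1) volume := by
    refine integrableOn_ball_of_norm_le_rpow (C := 1) (α := (N : ℝ) + s * p - p) ?_ ?_ ?_ hkm
    · rw [hd]; exact_mod_cast (by linarith : (1 : ℝ) ≤ N)
    · rw [hd]; linarith
    · refine ae_restrict_of_forall_mem Metric.isOpen_ball.measurableSet fun z hz => ?_
      rw [Real.norm_of_nonneg (hk0 z), one_mul]
      have hz1 : ‖z‖ ≤ 1 := by simpa using (mem_ball_zero_iff.1 hz).le
      simp only [hk, min_eq_right hz1]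
      rcases eq_or_ne z 0 with rfl | h0
      · rw [norm_zero, Real.zero_rpow (by linarith), zero_mul]; positivity
      · have h0' : 0 < ‖z‖ := norm_pos_iff.2 h0
        rw [← Real.rpow_neg h0'.le, ← Real.rpow_add h0']
        exact le_of_eq (by congr 1; ring)
  have h2 : IntegrableOn k (Metric.ball 0 1)ᶜ volume := by
    have hi := (integrable_one_add_norm (E := Space N) (μ := volume)
      (r := (N : ℝ) + s * p) (by rw [hd]; linarith)).const_mul (2 ^ ((N : ℝ) + s * p))
    refine Integrable.mono' hi.integrableOn hkm.restrict ?_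
    refine ae_restrict_of_forall_mem Metric.isOpen_ball.measurableSet.compl fun z hz => ?_
    have hz1 : 1 ≤ ‖z‖ := by simpa using hz
    rw [Real.norm_of_nonneg (hk0 z)]
    simp only [hk, min_eq_left hz1, Real.one_rpow, one_mul]
    rw [Real.rpow_neg (by positivity), ← inv_inv ((2 : ℝ) ^ _), ← mul_inv]
    refine inv_anti₀ (by positivity) ?_
    rw [inv_mul_le_iff₀ (by positivity), ← Real.mul_rpow (by norm_num) (by positivity)]
    exact Real.rpow_le_rpow (by positivity) (by linarith) (by positivity)
  have h3 : Integrable k volume := by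
    have := h1.union h2
    rwa [Set.union_compl_self, integrableOn_univ] at this
  rw [← ofReal_integral_eq_lintegral_ofReal h3 (Eventually.of_forall hk0)]
  exact ENNReal.ofReal_lt_top

theorem IsTestFunction.continuous {φ : Space N → ℝ} (h : IsTestFunction φ) : Continuous φ :=
  h.1.continuous

theorem norm_gradient (φ : Space N → ℝ) (x : Space N) : ‖gradient φ x‖ = ‖fderiv ℝ φ x‖ := by
  simp [gradient]

theorem IsTestFunction.continuous_gradient {φ : Space N → ℝ} (h : IsTestFunction φ) :
    Continuous (gradient φ) :=
  (InnerProductSpace.toDual ℝ (Space N)).symm.continuous.comp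
    (h.1.continuous_fderiv (by simp))

theorem IsTestFunction.hasCompactSupport_gradient {φ : Space N → ℝ} (h : IsTestFunction φ) :
    HasCompactSupport (gradient φ) :=
  (h.2.fderiv (𝕜 := ℝ)).comp_left (g := (InnerProductSpace.toDual ℝ (Space N)).symm) (by simp)

theorem IsTestFunction.sub {φ ψ : Space N → ℝ} (h : IsTestFunction φ) (h' : IsTestFunction ψ) :
    IsTestFunction (φ - ψ) :=
  ⟨h.1.sub h'.1, by simpa [sub_eq_add_neg] using h.2.add h'.2.neg⟩

theorem gradient_sub {φ ψ : Space N → ℝ} (h : IsTestFunction φ) (h' : IsTestFunction ψ) :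
    gradient (φ - ψ) = gradient φ - gradient ψ := by
  ext1 x
  simp only [gradient, Pi.sub_apply]
  rw [fderiv_sub (h.1.differentiable (by simp) x) (h'.1.differentiable (by simp) x), map_sub]

theorem IsTestFunction.memLp {φ : Space N → ℝ} (h : IsTestFunction φ) (q : ℝ≥0∞) :
    MemLp φ q volume := h.continuous.memLp_of_hasCompactSupport h.2

theorem IsTestFunction.memLp_gradient {φ : Space N → ℝ} (h : IsTestFunction φ) (q : ℝ≥0∞) :
    MemLp (gradient φ) q volume :=
  h.continuous_gradient.memLp_of_hasCompactSupport h.hasCompactSupport_gradient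

/-- Test functions have finite Gagliardo seminorm. -/
theorem IsTestFunction.memLp_increment {s p : ℝ} (hs : s ∈ Set.Ioo (0 : ℝ) 1) (hp : 1 < p)
    (hN : p < (N : ℝ)) {φ : Space N → ℝ} (h : IsTestFunction φ) :
    MemLp (increment φ) (ENNReal.ofReal p) (kernelMeasure N s p) := by
  have hp0 : 0 < p := by linarith
  have hm := h.continuous.aestronglyMeasurable (μ := volume)
  refine ⟨aestronglyMeasurable_increment s p hm, ?_⟩
  rw [eLpNorm_ofReal_eq hp0, lintegral_increment_eq hp0 hm]
  refine ENNReal.rpow_lt_top_of_nonneg (by positivity) (ne_of_lt ?_)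
  obtain ⟨K, hK⟩ := ContDiff.lipschitzWith_of_hasCompactSupport h.2 h.1 (by simp)
  obtain ⟨M, hM⟩ := h.2.exists_bound_of_continuous h.continuous
  have hM0 : 0 ≤ M := (norm_nonneg _).trans (hM 0)
  obtain ⟨r, hr⟩ := h.2.isBounded.subset_ball (0 : Space N)
  set B : Set (Space N) := Metric.ball 0 r with hB
  have hBm : MeasurableSet B := Metric.isOpen_ball.measurableSet
  have hzero : ∀ x, x ∉ B → φ x = 0 := fun x hx =>
    image_eq_zero_of_notMem_tsupport fun hx' => hx (hr hx')
  set C : ℝ := (max (K : ℝ) (2 * M)) ^ p with hC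
  have hC0 : 0 ≤ C := by positivity
  set k : Space N → ℝ≥0∞ :=
    fun z => ENNReal.ofReal ((min 1 ‖z‖) ^ p * (‖z‖ ^ ((N : ℝ) + s * p))⁻¹) with hk
  have hkm : Measurable k := by fun_prop
  have hkint : ∫⁻ z, k z < ⊤ := lintegral_min_kernel_lt_top hs hp hN
  have hpt : ∀ x y, |φ x - φ y| ^ p ≤ C * (min 1 ‖x - y‖) ^ p := by
    intro x y
    rw [hC, ← Real.mul_rpow (by positivity) (by positivity)]
    refine Real.rpow_le_rpow (abs_nonneg _) ?_ hp0.le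
    have e1 : |φ x - φ y| ≤ K * ‖x - y‖ := by
      simpa [Real.dist_eq, dist_eq_norm] using hK.dist_le_mul x y
    have e2 : |φ x - φ y| ≤ 2 * M := by
      have := norm_sub_le (φ x) (φ y)
      rw [Real.norm_eq_abs] at this
      linarith [hM x, hM y]
    rcases le_total 1 ‖x - y‖ with e | e
    · rw [min_eq_left e, mul_one]; exact e2.trans (le_max_right _ _)
    · rw [min_eq_right e]; exact e1.trans (by gcongr; exact le_max_left _ _)
  -- The increment vanishes unless one of the two points lies in `B`. Charging the integrand to that
  -- point leaves, after a translation in the other variable, `volume B` times the integral of `k`.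
  have hle : ∀ z : Space N × Space N,
      ENNReal.ofReal (|φ z.1 - φ z.2| ^ p / ‖z.1 - z.2‖ ^ ((N : ℝ) + s * p)) ≤
        ENNReal.ofReal C * (B.indicator 1 z.1 * k (z.2 - z.1)) +
        ENNReal.ofReal C * (B.indicator 1 z.2 * k (z.1 - z.2)) := by
    rintro ⟨x, y⟩
    have hkey : ENNReal.ofReal (|φ x - φ y| ^ p / ‖x - y‖ ^ ((N : ℝ) + s * p)) ≤
        ENNReal.ofReal C * k (x - y) := by
      rw [hk, ← ENNReal.ofReal_mul hC0, ← mul_assoc, div_eq_mul_inv]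
      exact ENNReal.ofReal_le_ofReal (mul_le_mul_of_nonneg_right (hpt x y) (by positivity))
    have hsymm : k (y - x) = k (x - y) := by simp only [hk, norm_sub_rev]
    by_cases hx : x ∈ B
    · refine hkey.trans (le_trans (le_of_eq ?_) le_self_add)
      simp [hx, hsymm]
    · by_cases hy : y ∈ B
      · refine hkey.trans (le_trans (le_of_eq ?_) le_add_self)
        simp [hy]
      · simp [hzero x hx, hzero y hy, hp0.ne']
  refine lt_of_le_of_lt (lintegral_mono hle) ?_
  have hi1 : ∫⁻ z : Space N × Space N, B.indicator 1 z.1 * k (z.2 - z.1) =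
      volume B * ∫⁻ z, k z := by
    rw [Measure.volume_eq_prod, lintegral_prod _ (by fun_prop (disch := exact hBm))]
    have : ∀ x : Space N, ∫⁻ y, B.indicator 1 x * k (y - x) = B.indicator 1 x * ∫⁻ z, k z := by
      intro x
      rw [lintegral_const_mul _ (by fun_prop), lintegral_sub_right_eq_self]
    simp_rw [this]
    rw [lintegral_mul_const _ (by fun_prop (disch := exact hBm)), lintegral_indicator_one hBm]
  have hi2 : ∫⁻ z : Space N × Space N, B.indicator 1 z.2 * k (z.1 - z.2) =
      volume B * ∫⁻ z, k z := by
    rw [Measure.volume_eq_prod, lintegral_prod_symm _ (by fun_prop (disch := exact hBm))]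
    have : ∀ y : Space N, ∫⁻ x, B.indicator 1 y * k (x - y) = B.indicator 1 y * ∫⁻ z, k z := by
      intro x
      rw [lintegral_const_mul _ (by fun_prop), lintegral_sub_right_eq_self]
    simp_rw [this]
    rw [lintegral_mul_const _ (by fun_prop (disch := exact hBm)), lintegral_indicator_one hBm]
  have hBf : volume B < ⊤ := measure_ball_lt_top
  rw [lintegral_add_left (by fun_prop (disch := exact hBm)),
    lintegral_const_mul _ (by fun_prop (disch := exact hBm)),
    lintegral_const_mul _ (by fun_prop (disch := exact hBm)), hi1, hi2]
  exact ENNReal.add_lt_top.2 ⟨ENNReal.mul_lt_top ENNReal.ofReal_lt_top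
    (ENNReal.mul_lt_top hBf hkint), ENNReal.mul_lt_top ENNReal.ofReal_lt_top
    (ENNReal.mul_lt_top hBf hkint)⟩

end Kernel

/-! ### The space `W_p`: approximating sequences, weak gradients and the Sobolev inequality. -/

section SobolevSpace

variable {N : ℕ}

theorem lt_critExp {p : ℝ} (hp : 1 < p) (hN : p < (N : ℝ)) : p < critExp N p := by
  rw [critExp, lt_div_iff₀ (by linarith)]
  nlinarith

theorem one_lt_critExp {p : ℝ} (hp : 1 < p) (hN : p < (N : ℝ)) : 1 < critExp N p :=
  hp.trans (lt_critExp hp hN)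

/-- `φ` is a sequence of test functions approximating `u`, with gradients converging to `G`. -/
structure WApprox (s p : ℝ) (u : Space N → ℝ) (G : Space N → Space N)
    (φ : ℕ → Space N → ℝ) : Prop where
  memLp : MemLp u (ENNReal.ofReal (critExp N p)) volume
  memLp_grad : MemLp G (ENNReal.ofReal p) volume
  memLp_increment : MemLp (increment u) (ENNReal.ofReal p) (kernelMeasure N s p)
  test : ∀ n, IsTestFunction (φ n)
  tendsto : Tendsto (fun n => eLpNorm (φ n - u) (ENNReal.ofReal (critExp N p)) volume)
    atTop (𝓝 0)
  tendsto_grad : Tendsto (fun n => eLpNorm (gradient (φ n) - G) (ENNReal.ofReal p) volume)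
    atTop (𝓝 0)
  tendsto_increment : Tendsto (fun n => eLpNorm (increment (φ n) - increment u)
    (ENNReal.ofReal p) (kernelMeasure N s p)) atTop (𝓝 0)

theorem ae_tendsto_increment {ns : ℕ → Space N → ℝ} {u : Space N → ℝ}
    (h : ∀ᵐ x, Tendsto (fun n => ns n x) atTop (𝓝 (u x))) (s p : ℝ) :
    ∀ᵐ z ∂kernelMeasure N s p,
      Tendsto (fun n => increment (ns n) z) atTop (𝓝 (increment u z)) := by
  refine (kernelMeasure_absolutelyContinuous s p).ae_le ?_
  have h1 : ∀ᵐ z : Space N × Space N, Tendsto (fun n => ns n z.1) atTop (𝓝 (u z.1)) :=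
    Measure.quasiMeasurePreserving_fst.ae h
  have h2 : ∀ᵐ z : Space N × Space N, Tendsto (fun n => ns n z.2) atTop (𝓝 (u z.2)) :=
    Measure.quasiMeasurePreserving_snd.ae h
  filter_upwards [h1, h2] with z e1 e2
  exact e1.sub e2

theorem WApprox.subseq {s p : ℝ} {u : Space N → ℝ} {G : Space N → Space N}
    {φ : ℕ → Space N → ℝ} (h : WApprox s p u G φ) {ns : ℕ → ℕ} (hns : StrictMono ns) :
    WApprox s p u G (φ ∘ ns) where
  memLp := h.memLp
  memLp_grad := h.memLp_grad
  memLp_increment := h.memLp_increment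
  test _ := h.test _
  tendsto := h.tendsto.comp hns.tendsto_atTop
  tendsto_grad := h.tendsto_grad.comp hns.tendsto_atTop
  tendsto_increment := h.tendsto_increment.comp hns.tendsto_atTop

/-- Completeness of the two `L^p` spaces gives limits of the gradients and of the increments. The
limit of the increments is `increment u`, since along a subsequence the approximations converge
almost everywhere to `u`. -/
theorem MemW.exists_wApprox {s p : ℝ} (hs : s ∈ Set.Ioo (0 : ℝ) 1) (hp : 1 < p)
    (hN : p < (N : ℝ)) {u : Space N → ℝ} (h : MemW s p u) :
    ∃ G φ, WApprox s p u G φ := by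
  have hp0 : 0 < p := by linarith
  obtain ⟨hu, φ, hφ, hconv, hc⟩ := h
  have hc1 : Tendsto (fun k : ℕ × ℕ => eLpNorm (gradient (φ k.1) - gradient (φ k.2))
      (ENNReal.ofReal p) volume) atTop (𝓝 0) := by
    refine tendsto_of_tendsto_of_tendsto_of_le_of_le tendsto_const_nhds hc
      (fun _ => zero_le) fun k => ?_
    change _ ≤ rhoSmooth s p (φ k.1 - φ k.2)
    rw [rhoSmooth, gradient_sub (hφ _) (hφ _)]
    exact le_self_add
  have hc2 : Tendsto (fun k : ℕ × ℕ => eLpNorm (increment (φ k.1) - increment (φ k.2))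
      (ENNReal.ofReal p) (kernelMeasure N s p)) atTop (𝓝 0) := by
    refine tendsto_of_tendsto_of_tendsto_of_le_of_le tendsto_const_nhds hc
      (fun _ => zero_le) fun k => ?_
    change _ ≤ rhoSmooth s p (φ k.1 - φ k.2)
    rw [rhoSmooth, gagliardo_eq hp0 ((hφ _).sub (hφ _)).continuous.aestronglyMeasurable,
      increment_sub]
    exact le_add_self
  obtain ⟨G, hG, hGt⟩ := exists_limit_of_cauchy hp.le (fun n => (hφ n).memLp_gradient _) hc1
  obtain ⟨H, hH, hHt⟩ := exists_limit_of_cauchy hp.le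
    (fun n => (hφ n).memLp_increment hs hp hN) hc2
  obtain ⟨ns, hns, hae⟩ := exists_subseq_ae_tendsto (one_lt_critExp hp hN).le
    (fun n => (hφ n).continuous.aestronglyMeasurable) hu.1 hconv
  obtain ⟨ms, hms, hae2⟩ := exists_subseq_ae_tendsto hp.le
    (fun n => ((hφ (ns n)).memLp_increment hs hp hN).1) hH.1 (hHt.comp hns.tendsto_atTop)
  have hHu : H =ᵐ[kernelMeasure N s p] increment u := by
    filter_upwards [ae_tendsto_increment hae s p, hae2] with z h1 h2
    exact tendsto_nhds_unique h2 (h1.comp hms.tendsto_atTop)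
  refine ⟨G, φ, hu, hG, hH.ae_eq hHu, hφ, hconv, hGt, hHt.congr fun n => ?_⟩
  exact eLpNorm_congr_ae (hHu.mono fun x hx => by simp [hx])

theorem tendsto_eLpNorm_sub_of_tendsto {α E : Type*} [MeasurableSpace α] {μ : Measure α}
    [NormedAddCommGroup E] {q : ℝ≥0∞} (hq : 1 ≤ q) {f : ℕ → α → E} {g : α → E}
    (hf : ∀ n, AEStronglyMeasurable (f n) μ) (hg : AEStronglyMeasurable g μ)
    (h : Tendsto (fun n => eLpNorm (f n - g) q μ) atTop (𝓝 0)) :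
    Tendsto (fun k : ℕ × ℕ => eLpNorm (f k.1 - f k.2) q μ) atTop (𝓝 0) := by
  have h1 : Tendsto (fun k : ℕ × ℕ => eLpNorm (f k.1 - g) q μ + eLpNorm (f k.2 - g) q μ)
      atTop (𝓝 0) := by
    rw [← prod_atTop_atTop_eq]
    simpa using (h.comp tendsto_fst).add (h.comp tendsto_snd)
  refine tendsto_of_tendsto_of_tendsto_of_le_of_le tendsto_const_nhds h1
    (fun _ => zero_le) fun k => ?_
  have : f k.1 - f k.2 = (f k.1 - g) - (f k.2 - g) := by abel
  change eLpNorm (f k.1 - f k.2) q μ ≤ _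
  rw [this]
  exact eLpNorm_sub_le ((hf _).sub hg) ((hf _).sub hg) hq

/-- This makes functions built through approximating sequences, such as truncated powers and
compositions with dilations, admissible in the weak formulation. -/
theorem WApprox.memW {s p : ℝ} (hp : 1 < p) {u : Space N → ℝ} {G : Space N → Space N}
    {φ : ℕ → Space N → ℝ} (h : WApprox s p u G φ) : MemW s p u := by
  have hp0 : 0 < p := by linarith
  have hp1 : 1 ≤ ENNReal.ofReal p := by simpa using hp.le
  refine ⟨h.memLp, φ, h.test, h.tendsto, ?_⟩
  have h1 := tendsto_eLpNorm_sub_of_tendsto hp1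
    (fun n => (h.test n).continuous_gradient.aestronglyMeasurable) h.memLp_grad.1 h.tendsto_grad
  have h2 := tendsto_eLpNorm_sub_of_tendsto hp1
    (fun n => aestronglyMeasurable_increment s p (h.test n).continuous.aestronglyMeasurable)
    h.memLp_increment.1 h.tendsto_increment
  have h3 := h1.add h2
  rw [add_zero] at h3
  refine h3.congr fun k => ?_
  rw [rhoSmooth, gagliardo_eq hp0 ((h.test _).sub (h.test _)).continuous.aestronglyMeasurable,
    increment_sub, gradient_sub (h.test _) (h.test _)]

theorem WApprox.sub {s p : ℝ} (hp : 1 < p) (hN : p < (N : ℝ)) {u v : Space N → ℝ}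
    {G H : Space N → Space N}
    {φ ψ : ℕ → Space N → ℝ} (h : WApprox s p u G φ) (h' : WApprox s p v H ψ) :
    WApprox s p (u - v) (G - H) (φ - ψ) := by
  have hp1 : 1 ≤ ENNReal.ofReal p := by simpa using hp.le
  have key : ∀ {α E : Type} [MeasurableSpace α] [NormedAddCommGroup E] (μ : Measure α)
      (q : ℝ≥0∞), 1 ≤ q → ∀ (f f' : ℕ → α → E) (g g' : α → E),
      (∀ n, AEStronglyMeasurable (f n) μ) → (∀ n, AEStronglyMeasurable (f' n) μ) →
      AEStronglyMeasurable g μ → AEStronglyMeasurable g' μ →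
      Tendsto (fun n => eLpNorm (f n - g) q μ) atTop (𝓝 0) →
      Tendsto (fun n => eLpNorm (f' n - g') q μ) atTop (𝓝 0) →
      Tendsto (fun n => eLpNorm ((f n - f' n) - (g - g')) q μ) atTop (𝓝 0) := by
    intro α E _ _ μ q hq f f' g g' m1 m2 m3 m4 t1 t2
    have t3 := t1.add t2
    rw [add_zero] at t3
    refine tendsto_of_tendsto_of_tendsto_of_le_of_le tendsto_const_nhds t3
      (fun _ => zero_le) fun n => ?_
    have : (f n - f' n) - (g - g') = (f n - g) - (f' n - g') := by abel
    rw [this]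
    exact eLpNorm_sub_le ((m1 n).sub m3) ((m2 n).sub m4) hq
  refine ⟨h.memLp.sub h'.memLp, h.memLp_grad.sub h'.memLp_grad, ?_,
    fun n => (h.test n).sub (h'.test n), ?_, ?_, ?_⟩
  · rw [increment_sub]; exact h.memLp_increment.sub h'.memLp_increment
  · exact key _ _ (by simpa using (one_lt_critExp hp hN).le) _ _ _ _
      (fun n => (h.test n).continuous.aestronglyMeasurable)
      (fun n => (h'.test n).continuous.aestronglyMeasurable) h.memLp.1 h'.memLp.1
      h.tendsto h'.tendsto
  · refine (key _ _ hp1 _ _ _ _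
      (fun n => (h.test n).continuous_gradient.aestronglyMeasurable)
      (fun n => (h'.test n).continuous_gradient.aestronglyMeasurable)
      h.memLp_grad.1 h'.memLp_grad.1 h.tendsto_grad h'.tendsto_grad).congr fun n => ?_
    rw [Pi.sub_apply, gradient_sub (h.test n) (h'.test n)]
  · refine (key _ _ hp1 _ _ _ _
      (fun n => aestronglyMeasurable_increment s p (h.test n).continuous.aestronglyMeasurable)
      (fun n => aestronglyMeasurable_increment s p (h'.test n).continuous.aestronglyMeasurable)
      h.memLp_increment.1 h'.memLp_increment.1 h.tendsto_increment
      h'.tendsto_increment).congr fun n => ?_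
    rw [Pi.sub_apply, increment_sub, increment_sub]

/-- Integration by parts in each fixed direction `v`, obtained by pairing both vectors with `v`. -/
theorem integral_smul_gradient {φ ψ : Space N → ℝ} (hφ : IsTestFunction φ)
    (hψ : IsTestFunction ψ) : ∫ x, φ x • gradient ψ x = - ∫ x, ψ x • gradient φ x := by
  have hi : ∀ {φ ψ : Space N → ℝ}, IsTestFunction φ → IsTestFunction ψ →
      Integrable fun x => φ x • gradient ψ x := fun h1 h2 =>
    (h1.continuous.smul h2.continuous_gradient).integrable_of_hasCompactSupport h1.2.smul_right
  have hinner : ∀ (φ : Space N → ℝ) (x v : Space N), inner ℝ v (gradient φ x) = fderiv ℝ φ x v :=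
    fun φ x v => by rw [real_inner_comm]; simp [gradient]
  refine ext_inner_left ℝ fun v => ?_
  rw [inner_neg_right, ← integral_inner (hi hφ hψ), ← integral_inner (hi hψ hφ)]
  simp_rw [inner_smul_right, hinner]
  have hd : ∀ {φ ψ : Space N → ℝ}, IsTestFunction φ → IsTestFunction ψ →
      Integrable fun x => φ x * fderiv ℝ ψ x v := by
    intro φ ψ h1 h2
    have := (hi h1 h2).const_inner (𝕜 := ℝ) v
    simpa only [inner_smul_right, hinner] using this
  rw [integral_mul_fderiv_eq_neg_fderiv_mul_of_integrable (v := v)]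
  · simp_rw [mul_comm]
  · simpa only [mul_comm] using hd hψ hφ
  · exact hd hφ hψ
  · exact (hφ.continuous.mul hψ.continuous).integrable_of_hasCompactSupport hφ.2.mul_right
  · exact fun x _ => hφ.1.differentiable (by simp) x
  · exact fun x _ => hψ.1.differentiable (by simp) x

theorem tendsto_integral_smul {E : Type*} [NormedAddCommGroup E] [NormedSpace ℝ E] {q r : ℝ}
    (hqr : q.HolderConjugate r)
    {f : ℕ → Space N → ℝ} {g : Space N → ℝ} {H : Space N → E}
    (hf : ∀ n, MemLp (f n) (ENNReal.ofReal q) volume)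
    (hg : MemLp g (ENNReal.ofReal q) volume) (hH : MemLp H (ENNReal.ofReal r) volume)
    (h : Tendsto (fun n => eLpNorm (f n - g) (ENNReal.ofReal q) volume) atTop (𝓝 0)) :
    Tendsto (fun n => ∫ x, f n x • H x) atTop (𝓝 (∫ x, g x • H x)) := by
  have := hqr.ennrealOfReal
  refine tendsto_integral_of_L1' _ (hg.1.smul hH.1)
    (Eventually.of_forall fun n => memLp_one_iff_integrable.1 (hH.smul (hf n))) ?_
  have h1 := ENNReal.Tendsto.mul_const (b := eLpNorm H (ENNReal.ofReal r) volume) h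
    (Or.inr hH.eLpNorm_ne_top)
  rw [zero_mul] at h1
  refine tendsto_of_tendsto_of_tendsto_of_le_of_le tendsto_const_nhds h1
    (fun _ => zero_le) fun n => ?_
  have e : (fun x => f n x • H x) - (fun x => g x • H x) = (f n - g) • H := by
    ext x; simp [sub_smul]
  change eLpNorm ((fun x => f n x • H x) - (fun x => g x • H x)) 1 volume ≤ _
  rw [e]
  exact eLpNorm_smul_le_mul_eLpNorm hH.1 ((hf n).1.sub hg.1)

theorem tendsto_integral_smul' {E : Type*} [NormedAddCommGroup E] [NormedSpace ℝ E] {q r : ℝ}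
    (hqr : q.HolderConjugate r)
    {f : ℕ → Space N → E} {g : Space N → E} {H : Space N → ℝ}
    (hf : ∀ n, MemLp (f n) (ENNReal.ofReal q) volume)
    (hg : MemLp g (ENNReal.ofReal q) volume) (hH : MemLp H (ENNReal.ofReal r) volume)
    (h : Tendsto (fun n => eLpNorm (f n - g) (ENNReal.ofReal q) volume) atTop (𝓝 0)) :
    Tendsto (fun n => ∫ x, H x • f n x) atTop (𝓝 (∫ x, H x • g x)) := by
  have := hqr.symm.ennrealOfReal
  refine tendsto_integral_of_L1' _ (hH.1.smul hg.1)
    (Eventually.of_forall fun n => memLp_one_iff_integrable.1 ((hf n).smul hH)) ?_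
  have h1 := ENNReal.Tendsto.const_mul (a := eLpNorm H (ENNReal.ofReal r) volume) h
    (Or.inr hH.eLpNorm_ne_top)
  rw [mul_zero] at h1
  refine tendsto_of_tendsto_of_tendsto_of_le_of_le tendsto_const_nhds h1
    (fun _ => zero_le) fun n => ?_
  have e : (fun x => H x • f n x) - (fun x => H x • g x) = H • (f n - g) := by
    ext x; simp [smul_sub]
  change eLpNorm ((fun x => H x • f n x) - (fun x => H x • g x)) 1 volume ≤ _
  rw [e]
  exact eLpNorm_smul_le_mul_eLpNorm ((hf n).1.sub hg.1) hH.1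

/-- Both sides of the integration by parts pass to the limit by Hölder's inequality, against a test
function and its gradient in the conjugate spaces. -/
theorem WApprox.hasWeakGradient {s p : ℝ} (hp : 1 < p) (hN : p < (N : ℝ)) {u : Space N → ℝ}
    {G : Space N → Space N} {φ : ℕ → Space N → ℝ} (h : WApprox s p u G φ) :
    HasWeakGradient u G := by
  have hq := one_lt_critExp hp hN
  refine ⟨h.memLp.locallyIntegrable (by simpa using hq.le),
    h.memLp_grad.locallyIntegrable (by simpa using hp.le), fun ψ hψ => ?_⟩
  have h1 := tendsto_integral_smul (Real.HolderConjugate.conjExponent hq)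
    (fun n => (h.test n).memLp _) h.memLp (hψ.memLp_gradient _) h.tendsto
  have h2 := tendsto_integral_smul' (Real.HolderConjugate.conjExponent hp)
    (fun n => (h.test n).memLp_gradient _) h.memLp_grad (hψ.memLp _) h.tendsto_grad
  refine tendsto_nhds_unique h1 (h2.neg.congr fun n => ?_)
  rw [integral_smul_gradient (h.test n) hψ]

/-- By the fundamental lemma of the calculus of variations, the arbitrary choice made in `weakGrad`
is harmless. -/
theorem HasWeakGradient.weakGrad_ae_eq {u : Space N → ℝ} {G : Space N → Space N}
    (h : HasWeakGradient u G) : weakGrad u =ᵐ[volume] G := by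
  have hex : ∃ G, HasWeakGradient u G := ⟨G, h⟩
  have h' : HasWeakGradient u (weakGrad u) := by
    rw [weakGrad, dif_pos hex]; exact hex.choose_spec
  refine ae_eq_of_integral_contDiff_smul_eq h'.2.1 h.2.1 fun g hg hg' => ?_
  have e1 := h.2.2 g ⟨hg, hg'⟩
  rw [h'.2.2 g ⟨hg, hg'⟩] at e1
  exact neg_injective e1

theorem WApprox.weakGrad_ae_eq {s p : ℝ} (hp : 1 < p) (hN : p < (N : ℝ)) {u : Space N → ℝ}
    {G : Space N → Space N} {φ : ℕ → Space N → ℝ} (h : WApprox s p u G φ) :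
    weakGrad u =ᵐ[volume] G := (h.hasWeakGradient hp hN).weakGrad_ae_eq

/-- The Sobolev inequality in `W_p`. -/
theorem exists_sobolev_const {p : ℝ} (hp : 1 < p) (hN : p < (N : ℝ)) :
    ∃ S : ℝ≥0, ∀ (s : ℝ) (u : Space N → ℝ) (G : Space N → Space N) (φ : ℕ → Space N → ℝ),
      WApprox s p u G φ → eLpNorm u (ENNReal.ofReal (critExp N p)) volume ≤
        S * eLpNorm G (ENNReal.ofReal p) volume := by
  have hp0 : 0 < p := by linarith
  have hq := one_lt_critExp hp hN
  refine ⟨eLpNormLESNormFDerivOfEqInnerConst (volume : Measure (Space N)) (p.toNNReal),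
    fun s u G φ h => ?_⟩
  set S := eLpNormLESNormFDerivOfEqInnerConst (volume : Measure (Space N)) (p.toNNReal)
  have hS : ∀ n, eLpNorm (φ n) (ENNReal.ofReal (critExp N p)) volume ≤
      S * eLpNorm (gradient (φ n)) (ENNReal.ofReal p) volume := by
    intro n
    have := eLpNorm_le_eLpNorm_fderiv_of_eq_inner (volume : Measure (Space N)) (u := φ n)
      (p := p.toNNReal) (p' := (critExp N p).toNNReal)
      ((h.test n).1.of_le (by simp)) (h.test n).2 (by simpa using hp.le)
      (by simp; exact_mod_cast hp0.trans hN) (by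
        rw [NNReal.coe_inv, Real.coe_toNNReal _ (by linarith), Real.coe_toNNReal _ hp0.le, critExp]
        simp
        have : (0:ℝ) < N - p := by linarith
        have : (0:ℝ) < N := by linarith
        field_simp)
    refine this.trans (le_of_eq ?_)
    congr 1
    exact eLpNorm_congr_norm_ae (Eventually.of_forall fun x => (norm_gradient _ _).symm)
  have h1 : ∀ n, eLpNorm u (ENNReal.ofReal (critExp N p)) volume ≤
      eLpNorm (φ n - u) (ENNReal.ofReal (critExp N p)) volume +
      S * (eLpNorm (gradient (φ n) - G) (ENNReal.ofReal p) volume +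
        eLpNorm G (ENNReal.ofReal p) volume) := by
    intro n
    have hm := (h.test n).continuous.aestronglyMeasurable (μ := volume)
    have hm' := (h.test n).continuous_gradient.aestronglyMeasurable (μ := volume)
    calc eLpNorm u (ENNReal.ofReal (critExp N p)) volume
        = eLpNorm (φ n - (φ n - u)) (ENNReal.ofReal (critExp N p)) volume := by
          rw [sub_sub_cancel]
      _ ≤ _ := eLpNorm_sub_le hm (hm.sub h.memLp.1) (by simpa using hq.le)
      _ ≤ eLpNorm (φ n - u) (ENNReal.ofReal (critExp N p)) volume +
        S * eLpNorm (gradient (φ n)) (ENNReal.ofReal p) volume := by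
          rw [add_comm]; gcongr; exact hS n
      _ ≤ _ := by
          gcongr
          calc eLpNorm (gradient (φ n)) (ENNReal.ofReal p) volume
              = eLpNorm ((gradient (φ n) - G) + G) (ENNReal.ofReal p) volume := by
                rw [sub_add_cancel]
            _ ≤ _ := eLpNorm_add_le (hm'.sub h.memLp_grad.1) h.memLp_grad.1
              (by simpa using hp.le)
  have h2 := h.tendsto.add (ENNReal.Tendsto.const_mul (a := (S : ℝ≥0∞))
    (h.tendsto_grad.add_const (eLpNorm G (ENNReal.ofReal p) volume)) (Or.inr (by simp)))
  rw [zero_add, zero_add] at h2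
  exact ge_of_tendsto' h2 h1

end SobolevSpace

/-! ### Chain rule for smooth Lipschitz functions, and the weak formulation in terms of `WApprox`.
-/

section ChainRule

variable {N : ℕ}

theorem abs_sub_le_of_deriv_bound {g : ℝ → ℝ} (hg : Differentiable ℝ g) {L : ℝ}
    (hL : ∀ t, |deriv g t| ≤ L) (a b : ℝ) : |g a - g b| ≤ L * |a - b| := by
  have := convex_univ.norm_image_sub_le_of_norm_deriv_le (f := g) (C := L) (x := b) (y := a)
    (fun x _ => hg x) (fun x _ => hL x) (Set.mem_univ _) (Set.mem_univ _)
  simpa using this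

theorem gradient_comp {g : ℝ → ℝ} (hg : Differentiable ℝ g) {φ : Space N → ℝ}
    (hφ : IsTestFunction φ) (x : Space N) :
    gradient (g ∘ φ) x = deriv g (φ x) • gradient φ x := by
  have h := (hg (φ x)).hasDerivAt.comp_hasFDerivAt x
    (hφ.1.differentiable (by simp) x).hasFDerivAt
  rw [gradient, h.fderiv, map_smulₛₗ]
  simp [gradient]

/-- Chain rule in `W_p`. -/
theorem WApprox.comp {s p : ℝ} (hp : 1 < p) (hN : p < (N : ℝ)) {u : Space N → ℝ}
    {G : Space N → Space N} {φ : ℕ → Space N → ℝ} (h : WApprox s p u G φ) {g : ℝ → ℝ}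
    (hg : ContDiff ℝ ∞ g) (hg0 : g 0 = 0) {L : ℝ} (hL : ∀ t, |deriv g t| ≤ L) :
    ∃ ψ, WApprox s p (g ∘ u) (fun x => deriv g (u x) • G x) ψ := by
  have hq := one_lt_critExp hp hN
  have hL0 : 0 ≤ L := (abs_nonneg _).trans (hL 0)
  have hgd : Differentiable ℝ g := hg.differentiable (by simp)
  have hg'c : Continuous (deriv g) := hg.continuous_deriv (by simp)
  have hlip := abs_sub_le_of_deriv_bound hgd hL
  have hbd : ∀ t, |g t| ≤ L * |t| := fun t => by simpa [hg0] using hlip t 0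
  obtain ⟨ns, hns, hae⟩ := exists_subseq_ae_tendsto hq.le
    (fun n => (h.test n).continuous.aestronglyMeasurable) h.memLp.1 h.tendsto
  have h' := h.subseq hns
  have hum : AEStronglyMeasurable (g ∘ u) volume :=
    hg.continuous.comp_aestronglyMeasurable h.memLp.1
  have htest : ∀ n, IsTestFunction (g ∘ φ (ns n)) := fun n =>
    ⟨hg.comp (h.test _).1, (h.test _).2.comp_left hg0⟩
  have hGm : AEStronglyMeasurable (fun x => deriv g (u x) • G x) volume :=
    (hg'c.comp_aestronglyMeasurable h.memLp.1).smul h.memLp_grad.1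
  have hincb : ∀ (v : Space N → ℝ) z, ‖increment (g ∘ v) z‖ ≤ L * ‖increment v z‖ :=
    fun v z => hlip _ _
  refine ⟨fun n => g ∘ φ (ns n), h.memLp.of_le_mul hum (Eventually.of_forall fun x => hbd _),
    h.memLp_grad.of_le_mul (c := L) hGm (Eventually.of_forall fun x => ?_),
    h.memLp_increment.of_le_mul (aestronglyMeasurable_increment s p hum)
      (Eventually.of_forall (hincb u)), htest, ?_, ?_, ?_⟩
  · rw [norm_smul]; gcongr; exact hL _
  · refine tendsto_eLpNorm_of_dominated hq.le hL0
      (fun n => (h'.test n).continuous.aestronglyMeasurable) h.memLp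
      (fun n => (htest n).continuous.aestronglyMeasurable) hum h'.tendsto
      (fun n => Eventually.of_forall fun x => hbd _) (Eventually.of_forall fun x => hbd _) ?_
    filter_upwards [hae] with x hx
    exact (hg.continuous.tendsto _).comp hx
  -- Almost everywhere convergence of the gradients is available only after extraction, so
  -- convergence is proved along a further subsequence of every subsequence.
  · refine tendsto_of_subseq_tendsto fun ks hks => ?_
    have h'' : Tendsto (fun n => eLpNorm (gradient (φ (ns (ks n))) - G) (ENNReal.ofReal p) volume)
      atTop (𝓝 0) := h'.tendsto_grad.comp hks
    obtain ⟨js, hjs, hae3⟩ := exists_subseq_ae_tendsto hp.le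
      (fun n => (h'.test (ks n)).continuous_gradient.aestronglyMeasurable) h.memLp_grad.1 h''
    refine ⟨js, tendsto_eLpNorm_of_dominated hp.le hL0
      (fun n => (h'.test (ks (js n))).continuous_gradient.aestronglyMeasurable) h.memLp_grad
      (fun n => (htest (ks (js n))).continuous_gradient.aestronglyMeasurable) hGm
      (h''.comp hjs.tendsto_atTop) (fun n => Eventually.of_forall fun x => ?_)
      (Eventually.of_forall fun x => ?_) ?_⟩
    · rw [gradient_comp hgd (h.test _), norm_smul]
      exact mul_le_mul_of_nonneg_right (hL _) (norm_nonneg _)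
    · rw [norm_smul]
      exact mul_le_mul_of_nonneg_right (hL _) (norm_nonneg _)
    · filter_upwards [hae, hae3] with x hx hx3
      simp_rw [gradient_comp hgd (h.test _)]
      exact ((hg'c.tendsto _).comp (hx.comp (hks.comp hjs.tendsto_atTop))).smul hx3
  · refine tendsto_eLpNorm_of_dominated hp.le hL0
      (fun n => aestronglyMeasurable_increment s p (h'.test n).continuous.aestronglyMeasurable)
      h.memLp_increment
      (fun n => aestronglyMeasurable_increment s p (htest n).continuous.aestronglyMeasurable)
      (aestronglyMeasurable_increment s p hum) h'.tendsto_increment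
      (fun n => Eventually.of_forall (hincb _)) (Eventually.of_forall (hincb u)) ?_
    refine ae_tendsto_increment ?_ s p
    filter_upwards [hae] with x hx
    exact (hg.continuous.tendsto _).comp hx

/-- The weak formulation in terms of the pairing of gradients and of increments. -/
theorem IsWeakSolution.test {s p : ℝ} (hp : 1 < p) (hN : p < (N : ℝ)) {u v : Space N → ℝ}
    {G H : Space N → Space N} {φ ψ : ℕ → Space N → ℝ} (hu : IsWeakSolution s p u)
    (h : WApprox s p u G φ) (h' : WApprox s p v H ψ) :
    (∫ x, ‖G x‖ ^ (p - 2) * inner ℝ (G x) (H x)) +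
      ∫ z, ‖increment u z‖ ^ (p - 2) * inner ℝ (increment u z) (increment v z)
        ∂kernelMeasure N s p =
      ∫ x, ‖u x‖ ^ (critExp N p - 2) * inner ℝ (u x) (v x) := by
  have h1 := hu.2 v (h'.memW hp)
  rw [nonlocalForm_eq] at h1
  have h2 : localForm p u v = ∫ x, ‖G x‖ ^ (p - 2) * inner ℝ (G x) (H x) := by
    refine integral_congr_ae ?_
    filter_upwards [h.weakGrad_ae_eq hp hN, h'.weakGrad_ae_eq hp hN] with x e1 e2
    simp only [e1, e2]
  rw [h2] at h1
  rw [h1]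
  congr 1 with x
  simp only [Real.norm_eq_abs, RCLike.inner_apply, conj_trivial]
  ring

end ChainRule

/-! ### Smooth truncations of the powers `t (1 + t^2)^a`. -/

section TruncatedPower

/-- A bounded smooth regularisation of `1 + t^2`. -/
noncomputable def truncSq (e t : ℝ) : ℝ := (1 + t ^ 2) / (1 + e * t ^ 2)

/-- The primitive of a power of `truncSq`. -/
noncomputable def truncPow (e b t : ℝ) : ℝ := ∫ τ in (0 : ℝ)..t, truncSq e τ ^ b

variable {e : ℝ}

theorem truncSq_pos (he : 0 < e) (t : ℝ) : 0 < truncSq e t := by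
  unfold truncSq; positivity

theorem truncSq_le_inv (he : 0 < e) (he1 : e ≤ 1) (t : ℝ) : truncSq e t ≤ e⁻¹ := by
  unfold truncSq
  rw [div_le_iff₀ (by positivity), inv_mul_eq_div, le_div_iff₀ he]
  nlinarith [sq_nonneg t]

theorem truncSq_le (he : 0 < e) (t : ℝ) : truncSq e t ≤ 1 + t ^ 2 := by
  unfold truncSq
  exact div_le_self (by positivity) (by nlinarith [sq_nonneg t])

theorem truncSq_mono (he : 0 < e) (he1 : e ≤ 1) {a b : ℝ} (ha : 0 ≤ a) (hab : a ≤ b) :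
    truncSq e a ≤ truncSq e b := by
  unfold truncSq
  rw [div_le_div_iff₀ (by positivity) (by positivity)]
  have : a ^ 2 ≤ b ^ 2 := by gcongr
  nlinarith

/-- A doubling bound uniform in `e`. It makes the upper and lower bounds of the primitive
`truncPow`, which are evaluated at `t` and at `t/2`, comparable. -/
theorem truncSq_le_four_mul (he : 0 < e) (t : ℝ) : truncSq e t ≤ 4 * truncSq e (t / 2) := by
  unfold truncSq
  rw [← mul_div_assoc, div_le_div_iff₀ (by positivity) (by positivity)]
  nlinarith [sq_nonneg t, mul_pos he (by norm_num : (0:ℝ) < 4),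
    mul_nonneg he.le (sq_nonneg t), mul_nonneg he.le (sq_nonneg (t ^ 2))]

theorem truncSq_neg (t : ℝ) : truncSq e (-t) = truncSq e t := by simp [truncSq]

theorem contDiff_truncSq_rpow (he : 0 < e) (b : ℝ) :
    ContDiff ℝ ∞ fun t => truncSq e t ^ b := by
  refine ContDiff.rpow_const_of_ne ?_ fun t => (truncSq_pos he t).ne'
  unfold truncSq
  exact ContDiff.div (by fun_prop) (by fun_prop) fun t => by positivity

theorem hasDerivAt_truncPow (he : 0 < e) (b t : ℝ) :
    HasDerivAt (truncPow e b) (truncSq e t ^ b) t := by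
  have hc := (contDiff_truncSq_rpow he b).continuous
  exact intervalIntegral.integral_hasDerivAt_right (hc.intervalIntegrable _ _)
    (hc.stronglyMeasurableAtFilter _ _) hc.continuousAt

theorem deriv_truncPow (he : 0 < e) (b : ℝ) :
    deriv (truncPow e b) = fun t => truncSq e t ^ b :=
  funext fun t => (hasDerivAt_truncPow he b t).deriv

theorem contDiff_truncPow (he : 0 < e) (b : ℝ) : ContDiff ℝ ∞ (truncPow e b) := by
  rw [contDiff_infty_iff_deriv]
  refine ⟨fun t => (hasDerivAt_truncPow he b t).differentiableAt, ?_⟩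
  rw [deriv_truncPow he]
  exact contDiff_truncSq_rpow he b

theorem truncPow_zero (b : ℝ) : truncPow e b 0 = 0 := by simp [truncPow]

theorem truncPow_neg (b t : ℝ) : truncPow e b (-t) = - truncPow e b t := by
  have h := intervalIntegral.integral_comp_neg (fun τ => truncSq e τ ^ b) (a := 0) (b := t)
  simp only [truncSq_neg, neg_zero] at h
  rw [truncPow, truncPow, h, intervalIntegral.integral_symm]

theorem monotone_truncPow (he : 0 < e) (b : ℝ) : Monotone (truncPow e b) :=
  monotone_of_deriv_nonneg (fun t => (hasDerivAt_truncPow he b t).differentiableAt) fun t => by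
    rw [deriv_truncPow he]; exact (Real.rpow_pos_of_pos (truncSq_pos he t) _).le

theorem truncPow_le (he : 0 < e) (he1 : e ≤ 1) {b t : ℝ} (hb : 0 ≤ b) (ht : 0 ≤ t) :
    truncPow e b t ≤ t * truncSq e t ^ b := by
  have hc := (contDiff_truncSq_rpow he b).continuous
  have : truncPow e b t ≤ ∫ _ in (0 : ℝ)..t, truncSq e t ^ b := by
    refine intervalIntegral.integral_mono_on ht (hc.intervalIntegrable _ _) (by simp) ?_
    intro x hx
    exact Real.rpow_le_rpow (truncSq_pos he _).le (truncSq_mono he he1 hx.1 hx.2) hb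
  simpa using this

/-- Only the half `[t/2, t]` of the interval is kept; there the nondecreasing integrand is at least
its value at `t/2`. -/
theorem le_truncPow (he : 0 < e) (he1 : e ≤ 1) {b t : ℝ} (hb : 0 ≤ b) (ht : 0 ≤ t) :
    t / 2 * truncSq e (t / 2) ^ b ≤ truncPow e b t := by
  have hc := (contDiff_truncSq_rpow he b).continuous
  have h1 : ∫ _ in (t / 2)..t, truncSq e (t / 2) ^ b ≤ ∫ τ in (t / 2)..t, truncSq e τ ^ b := by
    refine intervalIntegral.integral_mono_on (by linarith) (by simp)
      (hc.intervalIntegrable _ _) ?_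
    intro x hx
    exact Real.rpow_le_rpow (truncSq_pos he _).le
      (truncSq_mono he he1 (by linarith) hx.1) hb
  have h2 : 0 ≤ truncPow e b (t / 2) := by
    rw [← truncPow_zero (e := e) b]; exact monotone_truncPow he b (by linarith)
  have h3 : truncPow e b (t / 2) + ∫ τ in (t / 2)..t, truncSq e τ ^ b = truncPow e b t :=
    intervalIntegral.integral_add_adjacent_intervals (hc.intervalIntegrable _ _)
      (hc.intervalIntegrable _ _)
  rw [intervalIntegral.integral_const, smul_eq_mul] at h1
  have : t - t / 2 = t / 2 := by ring
  rw [this] at h1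
  linarith

theorem abs_truncPow (he : 0 < e) (b t : ℝ) : |truncPow e b t| = truncPow e b |t| := by
  have h0 : ∀ t, 0 ≤ t → 0 ≤ truncPow e b t := fun t ht => by
    rw [← truncPow_zero (e := e) b]; exact monotone_truncPow he b ht
  rcases le_total 0 t with h | h
  · rw [abs_of_nonneg h, abs_of_nonneg (h0 t h)]
  · rw [abs_of_nonpos h, ← abs_neg, ← truncPow_neg, abs_of_nonneg (h0 _ (by linarith))]

theorem mul_truncPow (he : 0 < e) (b t : ℝ) : t * truncPow e b t = |t| * |truncPow e b t| := by
  rw [abs_truncPow he]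
  rcases le_total 0 t with h | h
  · rw [abs_of_nonneg h]
  · rw [abs_of_nonpos h, truncPow_neg]; ring

/-- The test function uses exponent `a * p`, while the Sobolev inequality is applied with exponent
`a`. The upper bound for the former and the lower bound for the latter, joined by doubling, compare
the two with a constant that does not involve `e`. -/
theorem rpow_mul_truncPow_le (he : 0 < e) (he1 : e ≤ 1) {a p q : ℝ} (ha : 0 ≤ a) (hp : 1 < p)
    (t : ℝ) :
    ‖t‖ ^ (q - 2) * inner ℝ t (truncPow e (a * p) t) ≤
      (2 * 4 ^ a) ^ p * (|t| ^ (q - p) * |truncPow e a t| ^ p) := by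
  rcases eq_or_ne t 0 with rfl | ht
  · simp [truncPow_zero, (by linarith : p ≠ 0)]
  have ht' : 0 < |t| := abs_pos.2 ht
  have hi : inner ℝ t (truncPow e (a * p) t) = |t| * |truncPow e (a * p) t| := by
    rw [← mul_truncPow he]; simp [mul_comm]
  rw [hi, abs_truncPow he, abs_truncPow he, Real.norm_eq_abs]
  have hm := truncSq_pos he |t|
  have hm2 := truncSq_pos he (|t| / 2)
  have h1 := truncPow_le he he1 (b := a * p) (by positivity) ht'.le
  have h2 := le_truncPow he he1 ha ht'.le
  have h3 : truncSq e |t| ^ a ≤ 4 ^ a * truncSq e (|t| / 2) ^ a := by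
    rw [← Real.mul_rpow (by norm_num) hm2.le]
    exact Real.rpow_le_rpow hm.le (truncSq_le_four_mul he _) ha
  have h4 : |t| * truncSq e |t| ^ a ≤ 2 * 4 ^ a * truncPow e a |t| := by
    calc |t| * truncSq e |t| ^ a ≤ |t| * (4 ^ a * truncSq e (|t| / 2) ^ a) := by gcongr
      _ = 2 * 4 ^ a * (|t| / 2 * truncSq e (|t| / 2) ^ a) := by ring
      _ ≤ _ := by gcongr
  have h0 : 0 ≤ truncPow e a |t| := le_trans (by positivity) h2
  calc |t| ^ (q - 2) * (|t| * truncPow e (a * p) |t|)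
      ≤ |t| ^ (q - 2) * (|t| * (|t| * truncSq e |t| ^ (a * p))) := by gcongr
    _ = |t| ^ (q - p) * (|t| * truncSq e |t| ^ a) ^ p := by
        rw [Real.mul_rpow ht'.le (by positivity), ← Real.rpow_mul hm.le]
        have : |t| ^ (q - 2) * (|t| * |t|) = |t| ^ (q - p) * |t| ^ p := by
          rw [← pow_two, ← Real.rpow_natCast, ← Real.rpow_add ht', ← Real.rpow_add ht']
          congr 1; push_cast; ring
        linear_combination truncSq e |t| ^ (a * p) * this
    _ ≤ |t| ^ (q - p) * (2 * 4 ^ a * truncPow e a |t|) ^ p := by gcongr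
    _ = _ := by rw [Real.mul_rpow (by positivity) h0]; ring

end TruncatedPower

/-! ### Higher integrability of weak solutions. -/

section Integrability

variable {N : ℕ}

theorem tendsto_lintegral_truncation {α : Type*} [MeasurableSpace α] {μ : Measure α} {q : ℝ}
    (hq : 0 < q) {u : α → ℝ} (hu : MemLp u (ENNReal.ofReal q) μ) :
    Tendsto (fun n : ℕ => ∫⁻ x, ({t : ℝ | (n : ℝ) < |t|}.indicator (fun t => ‖t‖ₑ) (u x)) ^ q ∂μ)
      atTop (𝓝 0) := by
  have hm : ∀ n : ℕ, Measurable ({t : ℝ | (n : ℝ) < |t|}.indicator fun t => ‖t‖ₑ) := fun n =>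
    measurable_enorm.indicator (measurableSet_lt measurable_const (by fun_prop))
  have := tendsto_lintegral_of_dominated_convergence' (μ := μ) (f := fun _ => 0)
    (F := fun (n : ℕ) x => ({t : ℝ | (n : ℝ) < |t|}.indicator (fun t => ‖t‖ₑ) (u x)) ^ q)
    (fun x => ‖u x‖ₑ ^ q)
    (fun n => ((hm n).comp_aemeasurable hu.1.aemeasurable).pow_const q)
    (fun n => Eventually.of_forall fun x =>
      ENNReal.rpow_le_rpow (Set.indicator_le_self _ _ _) hq.le)
    (lintegral_rpow_lt_top hq hu).ne (Eventually.of_forall fun x => ?_)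
  · simpa using this
  · obtain ⟨n, hn⟩ := exists_nat_gt |u x|
    refine tendsto_const_nhds.congr' ?_
    filter_upwards [eventually_ge_atTop n] with k hk
    have : ¬ ((k : ℝ) < |u x|) := by
      have : (n : ℝ) ≤ k := by exact_mod_cast hk
      linarith
    simp [this, hq]

/-- The energy of a truncated power of a weak solution is controlled by the right-hand side. -/
theorem IsWeakSolution.truncPow_energy_le {s p : ℝ} (hp : 1 < p) (hN : p < (N : ℝ))
    {u : Space N → ℝ} {G : Space N → Space N} {φ : ℕ → Space N → ℝ}
    (hu : IsWeakSolution s p u) (h : WApprox s p u G φ) {a e : ℝ} (ha : 0 ≤ a) (he : 0 < e)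
    (he1 : e ≤ 1) :
    ∫⁻ x, ‖truncSq e (u x) ^ a • G x‖ₑ ^ p ≤ ENNReal.ofReal ((2 * 4 ^ a) ^ p) *
      ∫⁻ x, ‖u x‖ₑ ^ (critExp N p - p) * ‖truncPow e a (u x)‖ₑ ^ p := by
  have hp0 : 0 < p := by linarith
  have hqp := lt_critExp hp hN
  have hq := one_lt_critExp hp hN
  set q := critExp N p with hq_def
  have hder : ∀ b : ℝ, 0 ≤ b → ∀ t, |deriv (truncPow e b) t| ≤ e⁻¹ ^ b := by
    intro b hb t
    rw [deriv_truncPow he, abs_of_pos (Real.rpow_pos_of_pos (truncSq_pos he t) _)]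
    exact Real.rpow_le_rpow (truncSq_pos he t).le (truncSq_le_inv he he1 t) hb
  -- With `truncPow e (a * p) ∘ u` as test function, the local term becomes exactly `∫ ‖truncSq e (u
  -- x) ^ a • G x‖ ^ p`, the gradient energy of `truncPow e a ∘ u`.
  obtain ⟨ψ, hψ⟩ := h.comp hp hN (contDiff_truncPow he (a * p)) (truncPow_zero _)
    (hder (a * p) (by positivity))
  obtain ⟨χ, hχ⟩ := h.comp hp hN (contDiff_truncPow he a) (truncPow_zero _) (hder a ha)
  rw [deriv_truncPow he] at hψ hχ
  have htest := hu.test hp hN h hψ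
  -- The truncated power is monotone, so its increments have the sign of those of `u`; the nonlocal
  -- term can be dropped.
  have hnl : 0 ≤ ∫ z, ‖increment u z‖ ^ (p - 2) * inner ℝ (increment u z)
      (increment (truncPow e (a * p) ∘ u) z) ∂kernelMeasure N s p := by
    refine integral_nonneg fun z => mul_nonneg (by positivity) ?_
    simp only [increment, Function.comp, RCLike.inner_apply, conj_trivial]
    rcases le_total (u z.1) (u z.2) with e1 | e1
    · exact mul_nonneg_of_nonpos_of_nonpos
        (sub_nonpos.2 (monotone_truncPow he _ e1)) (sub_nonpos.2 e1)
    · exact mul_nonneg (sub_nonneg.2 (monotone_truncPow he _ e1)) (sub_nonneg.2 e1)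
  have hle : (∫ x, ‖G x‖ ^ (p - 2) * inner ℝ (G x) (truncSq e (u x) ^ (a * p) • G x)) ≤
      ∫ x, ‖u x‖ ^ (q - 2) * inner ℝ (u x) ((truncPow e (a * p) ∘ u) x) := by
    linarith
  have hpt : ∀ x, ‖G x‖ ^ (p - 2) * inner ℝ (G x) (truncSq e (u x) ^ (a * p) • G x) =
      ‖truncSq e (u x) ^ a • G x‖ ^ p := by
    intro x
    have hm := truncSq_pos he (u x)
    rw [inner_smul_right, mul_left_comm, rpow_sub_two_mul_inner_self hp0, norm_smul,
      Real.mul_rpow (norm_nonneg _) (norm_nonneg _),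
      Real.norm_of_nonneg (by positivity), ← Real.rpow_mul hm.le]
  simp_rw [hpt] at hle
  have hfin := lintegral_rpow_lt_top hp0 hχ.memLp_grad
  have hint := integrable_rpow_sub_two_mul_inner hq h.memLp hψ.memLp
  rw [← ENNReal.ofReal_toReal hfin.ne, toReal_lintegral_enorm_rpow hp0 hχ.memLp_grad.1,
    ← lintegral_const_mul' _ _ ENNReal.ofReal_ne_top]
  refine (ENNReal.ofReal_le_ofReal hle).trans ?_
  rw [ofReal_integral_eq_lintegral_ofReal hint]
  · refine lintegral_mono fun x => ?_
    refine (ENNReal.ofReal_le_ofReal (rpow_mul_truncPow_le he he1 ha hp (u x))).trans ?_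
    rw [ENNReal.ofReal_mul (by positivity), ENNReal.ofReal_mul (by positivity),
      ← ENNReal.ofReal_rpow_of_nonneg (abs_nonneg _) (by linarith),
      ← ENNReal.ofReal_rpow_of_nonneg (abs_nonneg _) hp0.le, ← Real.norm_eq_abs,
      ← Real.norm_eq_abs, ofReal_norm, ofReal_norm]
  · refine Eventually.of_forall fun x => mul_nonneg (by positivity) ?_
    simp only [Function.comp, RCLike.inner_apply, conj_trivial]
    rw [mul_comm, mul_truncPow he]
    positivity

/-- Where `|t| ≤ n` the truncated power is at most `(1 + n^2)^a |t|`, uniformly in `e`. Where `|t| >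
n` nothing is estimated: that part carries a factor `|t|^{q-p}` whose integral over the solution
will be small. -/
theorem truncPow_split_le {a p q e : ℝ} (ha : 0 ≤ a) (hp : 0 < p) (hqp : p < q) (he : 0 < e)
    (he1 : e ≤ 1) (n : ℕ) (t : ℝ) :
    ‖t‖ₑ ^ (q - p) * ‖truncPow e a t‖ₑ ^ p ≤
      ENNReal.ofReal ((1 + (n : ℝ) ^ 2) ^ (a * p)) * ‖t‖ₑ ^ q +
      ({t : ℝ | (n : ℝ) < |t|}.indicator (fun t => ‖t‖ₑ) t) ^ (q - p) *
        ‖truncPow e a t‖ₑ ^ p := by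
  by_cases htn : (n : ℝ) < |t|
  · rw [Set.indicator_of_mem (show t ∈ {t : ℝ | (n : ℝ) < |t|} from htn)]
    exact le_add_self
  · refine le_add_right ?_
    have h1 : |truncPow e a t| ≤ |t| * (1 + (n : ℝ) ^ 2) ^ a := by
      rw [abs_truncPow he]
      refine (truncPow_le he he1 ha (abs_nonneg t)).trans ?_
      refine mul_le_mul_of_nonneg_left ?_ (abs_nonneg t)
      refine Real.rpow_le_rpow (truncSq_pos he _).le ((truncSq_le he _).trans ?_) ha
      have := not_lt.1 htn
      gcongr
    have h2 : ‖truncPow e a t‖ₑ ≤ ‖t‖ₑ * ENNReal.ofReal ((1 + (n : ℝ) ^ 2) ^ a) := by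
      rw [← ofReal_norm, ← ofReal_norm, ← ENNReal.ofReal_mul (norm_nonneg _)]
      exact ENNReal.ofReal_le_ofReal h1
    calc ‖t‖ₑ ^ (q - p) * ‖truncPow e a t‖ₑ ^ p
        ≤ ‖t‖ₑ ^ (q - p) * (‖t‖ₑ * ENNReal.ofReal ((1 + (n : ℝ) ^ 2) ^ a)) ^ p := by gcongr
      _ = ENNReal.ofReal ((1 + (n : ℝ) ^ 2) ^ (a * p)) * (‖t‖ₑ ^ (q - p) * ‖t‖ₑ ^ p) := by
          rw [ENNReal.mul_rpow_of_nonneg _ _ hp.le,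
            ENNReal.ofReal_rpow_of_nonneg (by positivity) hp.le,
            ← Real.rpow_mul (by positivity)]
          ring
      _ = _ := by
          rw [← ENNReal.rpow_add_of_nonneg _ _ (by linarith) hp.le, sub_add_cancel]

/-- Truncated powers of a weak solution are bounded in `L^{p^*}`, uniformly in the truncation. -/
theorem IsWeakSolution.exists_truncPow_bound {s p : ℝ} (hp : 1 < p) (hN : p < (N : ℝ))
    {u : Space N → ℝ} {G : Space N → Space N} {φ : ℕ → Space N → ℝ}
    (hu : IsWeakSolution s p u) (h : WApprox s p u G φ) {a : ℝ} (ha : 0 ≤ a) :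
    ∃ Y : ℝ≥0∞, Y < ⊤ ∧ ∀ e : ℝ, 0 < e → e ≤ 1 →
      eLpNorm (truncPow e a ∘ u) (ENNReal.ofReal (critExp N p)) volume ≤ Y := by
  have hp0 : 0 < p := by linarith
  have hqp := lt_critExp hp hN
  have hq := one_lt_critExp hp hN
  set q := critExp N p with hq_def
  have hq0 : 0 < q := by linarith
  obtain ⟨S, hS⟩ := exists_sobolev_const (N := N) hp hN
  set c : ℕ → Space N → ℝ≥0∞ :=
    fun n x => {t : ℝ | (n : ℝ) < |t|}.indicator (fun t => ‖t‖ₑ) (u x) with hc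
  have hcm : ∀ n, AEMeasurable (c n) volume := fun n =>
    (measurable_enorm.indicator (measurableSet_lt measurable_const
      (by fun_prop))).comp_aemeasurable h.memLp.1.aemeasurable
  set K : ℝ≥0∞ := (S : ℝ≥0∞) ^ p * ENNReal.ofReal ((2 * 4 ^ a) ^ p) with hK
  have hKt : K ≠ ⊤ := ENNReal.mul_ne_top (ENNReal.rpow_ne_top_of_nonneg hp0.le (by simp))
    ENNReal.ofReal_ne_top
  have htends : Tendsto (fun n => K * (∫⁻ x, c n x ^ q) ^ ((q - p) / q)) atTop (𝓝 0) := by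
    have h1 := (tendsto_lintegral_truncation hq0 h.memLp).ennrpow_const ((q - p) / q)
    rw [ENNReal.zero_rpow_of_pos (div_pos (by linarith) hq0)] at h1
    simpa using ENNReal.Tendsto.const_mul h1 (Or.inr hKt)
  -- The level `n` depends on `u` and `a` but is fixed before `e`, so the resulting bound is uniform
  -- in `e`. The value `1/2` allows the large-value term to be absorbed on the left.
  obtain ⟨n, hn⟩ := ((ENNReal.tendsto_nhds_zero.1 htends) 2⁻¹ (by simp)).exists
  set M : ℝ≥0∞ := ∫⁻ x, ‖u x‖ₑ ^ q with hM
  have hMt : M < ⊤ := lintegral_rpow_lt_top hq0 h.memLp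
  set Z : ℝ≥0∞ := K * (ENNReal.ofReal ((1 + (n : ℝ) ^ 2) ^ (a * p)) * M) with hZ
  have hZt : Z < ⊤ := ENNReal.mul_lt_top hKt.lt_top
    (ENNReal.mul_lt_top ENNReal.ofReal_lt_top hMt)
  refine ⟨(2 * Z) ^ (1 / p), ENNReal.rpow_lt_top_of_nonneg (by positivity)
    (ENNReal.mul_lt_top (by simp) hZt).ne, fun e he he1 => ?_⟩
  have hder : ∀ t, |deriv (truncPow e a) t| ≤ e⁻¹ ^ a := by
    intro t
    rw [deriv_truncPow he, abs_of_pos (Real.rpow_pos_of_pos (truncSq_pos he t) _)]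
    exact Real.rpow_le_rpow (truncSq_pos he t).le (truncSq_le_inv he he1 t) ha
  obtain ⟨χ, hχ⟩ := h.comp hp hN (contDiff_truncPow he a) (truncPow_zero _) hder
  rw [deriv_truncPow he] at hχ
  set X := eLpNorm (truncPow e a ∘ u) (ENNReal.ofReal q) volume with hX
  -- The absorption needs this norm to be finite beforehand. For `e > 0` the truncated power is
  -- Lipschitz, so the chain rule provides it.
  have hXt : X ^ p ≠ ⊤ := ENNReal.rpow_ne_top_of_nonneg hp0.le hχ.memLp.eLpNorm_ne_top
  have h1 : X ^ p ≤ K * ∫⁻ x, ‖u x‖ₑ ^ (q - p) * ‖truncPow e a (u x)‖ₑ ^ p := by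
    calc X ^ p ≤ (S * eLpNorm (fun x => truncSq e (u x) ^ a • G x)
          (ENNReal.ofReal p) volume) ^ p := by gcongr; exact hS _ _ _ _ hχ
      _ = (S : ℝ≥0∞) ^ p * ∫⁻ x, ‖truncSq e (u x) ^ a • G x‖ₑ ^ p := by
          rw [ENNReal.mul_rpow_of_nonneg _ _ hp0.le, eLpNorm_ofReal_rpow hp0]
      _ ≤ _ := by
          rw [hK, mul_assoc]
          gcongr
          exact hu.truncPow_energy_le hp hN h ha he he1
  have hhm : AEMeasurable (fun x => ‖truncPow e a (u x)‖ₑ) volume := hχ.memLp.1.enorm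
  have h2 : ∫⁻ x, ‖u x‖ₑ ^ (q - p) * ‖truncPow e a (u x)‖ₑ ^ p ≤
      ENNReal.ofReal ((1 + (n : ℝ) ^ 2) ^ (a * p)) * M +
        (∫⁻ x, c n x ^ q) ^ ((q - p) / q) * X ^ p := by
    refine (lintegral_mono fun x => truncPow_split_le ha hp0 hqp he he1 n (u x)).trans ?_
    rw [lintegral_add_left' ((h.memLp.1.enorm.pow_const q).const_mul _),
      lintegral_const_mul' _ _ ENNReal.ofReal_ne_top]
    gcongr
    have hconj : (q / (q - p)).HolderConjugate (q / p) := by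
      refine Real.holderConjugate_iff.2 ⟨?_, ?_⟩
      · rw [lt_div_iff₀ (by linarith)]; linarith
      · rw [inv_div, inv_div, ← add_div, sub_add_cancel, div_self hq0.ne']
    have := ENNReal.lintegral_mul_le_Lp_mul_Lq volume hconj ((hcm n).pow_const (q - p))
      (hhm.pow_const p)
    refine this.trans (le_of_eq ?_)
    simp only [← ENNReal.rpow_mul]
    have e1 : (q - p) * (q / (q - p)) = q := by
      field_simp [(by linarith : q - p ≠ 0)]
    have e2 : p * (q / p) = q := by field_simp
    rw [e1, e2, one_div_div, one_div_div, hX, eLpNorm_ofReal_eq hq0, ← ENNReal.rpow_mul]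
    congr 2
    ring
  have h3 : X ^ p ≤ Z + 2⁻¹ * X ^ p := by
    refine h1.trans ((mul_le_mul_right h2 K).trans ?_)
    rw [mul_add, ← mul_assoc K _ (X ^ p)]
    gcongr
  have h4 : X ^ p ≤ 2 * Z := by
    have h5 : 2⁻¹ * X ^ p + 2⁻¹ * X ^ p = X ^ p := by
      rw [← add_mul, ENNReal.inv_two_add_inv_two, one_mul]
    have h6 : 2⁻¹ * X ^ p ≤ Z := by
      refine (ENNReal.add_le_add_iff_right (ENNReal.mul_ne_top (a := 2⁻¹) (by simp) hXt)).1 ?_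
      rwa [h5]
    calc X ^ p = 2 * (2⁻¹ * X ^ p) := by
          rw [← mul_assoc, ENNReal.mul_inv_cancel (by simp) (by simp), one_mul]
      _ ≤ _ := by gcongr
  calc X = (X ^ p) ^ (1 / p) := by
        rw [← ENNReal.rpow_mul, mul_one_div_cancel hp0.ne', ENNReal.rpow_one]
    _ ≤ _ := by gcongr

/-- Higher integrability of weak solutions. -/
theorem IsWeakSolution.memLp_of_critExp_le {s p : ℝ} (hp : 1 < p) (hN : p < (N : ℝ))
    {u : Space N → ℝ} {G : Space N → Space N} {φ : ℕ → Space N → ℝ}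
    (hu : IsWeakSolution s p u) (h : WApprox s p u G φ) {r : ℝ} (hr : critExp N p ≤ r) :
    MemLp u (ENNReal.ofReal r) volume := by
  have hq := one_lt_critExp hp hN
  set q := critExp N p with hq_def
  have hq0 : 0 < q := by linarith
  have hr0 : 0 < r := by linarith
  -- Chosen so that `t (t^2)^a = t^{r/q}` for positive `t`, whose `q`-th power is `t^r`.
  set a : ℝ := (r / q - 1) / 2 with ha_def
  have ha : 0 ≤ a := by
    have : 1 ≤ r / q := by rwa [le_div_iff₀ hq0, one_mul]
    rw [ha_def]; linarith
  have har : 1 + 2 * a = r / q := by rw [ha_def]; ring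
  obtain ⟨Y, hYt, hY⟩ := hu.exists_truncPow_bound hp hN h ha
  set ε : ℕ → ℝ := fun n => 1 / ((n : ℝ) + 1) with hε
  have hε0 : ∀ n, 0 < ε n := fun n => by positivity
  have hε1 : ∀ n, ε n ≤ 1 := fun n => by
    rw [hε]; simp only; rw [div_le_one (by positivity)]; simp
  have hεt : Tendsto ε atTop (𝓝 0) := tendsto_one_div_add_atTop_nhds_zero_nat
  set ℓ : ℕ → Space N → ℝ := fun n x => |u x| / 2 * truncSq (ε n) (|u x| / 2) ^ a with hℓ
  set ℓ₀ : Space N → ℝ := fun x => |u x| / 2 * (1 + (|u x| / 2) ^ 2) ^ a with hℓ₀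
  have hℓm : ∀ n, AEStronglyMeasurable (ℓ n) volume := by
    intro n
    have hc : Continuous fun t : ℝ => |t| / 2 * truncSq (ε n) (|t| / 2) ^ a := by
      have := (contDiff_truncSq_rpow (hε0 n) a).continuous
      have h2 : Continuous fun t : ℝ => |t| / 2 := by fun_prop
      exact h2.mul (this.comp h2)
    exact hc.comp_aestronglyMeasurable h.memLp.1
  have hbound : ∀ n, eLpNorm (ℓ n) (ENNReal.ofReal q) volume ≤ Y := by
    intro n
    refine le_trans (eLpNorm_mono fun x => ?_) (hY (ε n) (hε0 n) (hε1 n))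
    have hm := truncSq_pos (hε0 n) (|u x| / 2)
    rw [Real.norm_of_nonneg (by positivity), Function.comp_apply, Real.norm_eq_abs,
      abs_truncPow (hε0 n)]
    exact le_truncPow (hε0 n) (hε1 n) ha (abs_nonneg _)
  -- As the truncation parameter tends to zero, the lower bounds of the truncated powers converge
  -- pointwise, and Fatou's lemma preserves the uniform bound.
  have hlim : eLpNorm ℓ₀ (ENNReal.ofReal q) volume ≤ Y := by
    refine Lp.eLpNorm_le_of_ae_tendsto (u := atTop) (Eventually.of_forall hbound) hℓm
      (Eventually.of_forall fun x => ?_)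
    have h1 : Tendsto (fun n => truncSq (ε n) (|u x| / 2)) atTop
        (𝓝 (1 + (|u x| / 2) ^ 2)) := by
      unfold truncSq
      have : Tendsto (fun n => 1 + ε n * (|u x| / 2) ^ 2) atTop (𝓝 (1 + 0 * (|u x| / 2) ^ 2)) :=
        (hεt.mul_const _).const_add _
      have h2 := (tendsto_const_nhds (x := 1 + (|u x| / 2) ^ 2) (f := atTop)).div this (by simp)
      rw [zero_mul, add_zero, div_one] at h2
      exact h2
    exact (h1.rpow_const (Or.inr ha)).const_mul _
  refine ⟨h.memLp.1, ?_⟩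
  have hfin : ∫⁻ x, ‖ℓ₀ x‖ₑ ^ q < ⊤ := by
    rw [← eLpNorm_ofReal_rpow hq0]
    exact ENNReal.rpow_lt_top_of_nonneg hq0.le (hlim.trans_lt hYt).ne
  rw [eLpNorm_ofReal_eq hr0]
  refine ENNReal.rpow_lt_top_of_nonneg (by positivity) (ne_of_lt ?_)
  have hpt : ∀ x, ‖u x‖ₑ ^ r ≤ ENNReal.ofReal (2 ^ r) * ‖ℓ₀ x‖ₑ ^ q := by
    intro x
    have hle : (|u x| / 2) ^ (r / q) ≤ ℓ₀ x := by
      rcases eq_or_ne (u x) 0 with h0 | h0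
      · simp [hℓ₀, h0, (by positivity : r / q ≠ 0)]
      · have h0' : 0 < |u x| / 2 := by positivity
        rw [← har, Real.rpow_add h0', Real.rpow_one, Real.rpow_mul h0'.le, hℓ₀]
        simp only
        gcongr
        rw [Real.rpow_two]; linarith
    have h0 : 0 ≤ ℓ₀ x := le_trans (by positivity) hle
    rw [← ofReal_norm, ← ofReal_norm, ENNReal.ofReal_rpow_of_nonneg (norm_nonneg _) hr0.le,
      ENNReal.ofReal_rpow_of_nonneg (norm_nonneg _) hq0.le, ← ENNReal.ofReal_mul (by positivity)]
    refine ENNReal.ofReal_le_ofReal ?_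
    rw [Real.norm_of_nonneg h0, Real.norm_eq_abs]
    calc |u x| ^ r = 2 ^ r * (|u x| / 2) ^ r := by
          rw [← Real.mul_rpow (by norm_num) (by positivity)]; congr 1; ring
      _ = 2 ^ r * ((|u x| / 2) ^ (r / q)) ^ q := by
          rw [← Real.rpow_mul (by positivity), div_mul_cancel₀ _ hq0.ne']
      _ ≤ _ := by gcongr
  refine (lintegral_mono hpt).trans_lt ?_
  rw [lintegral_const_mul' _ _ ENNReal.ofReal_ne_top]
  exact ENNReal.mul_lt_top ENNReal.ofReal_lt_top hfin

end Integrability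

/-! ### Local dilations and their effect on Lebesgue measure and on the kernel measure. -/

section Dilation

variable {N : ℕ}

/-- A diffeomorphism that is `x ↦ (1 + t) x` on a ball and close to the identity everywhere. -/
structure IsLocalDilation (R t L M : ℝ) (T : Space N → Space N) : Prop where
  radius_pos : 0 < R
  nonneg : 0 ≤ t
  const_nonneg : 0 ≤ L
  small : t * L ≤ 1 / 2
  contDiff : ContDiff ℝ ∞ T
  surjective : Function.Surjective T
  close : ∀ x y, ‖(T x - T y) - (x - y)‖ ≤ t * L * ‖x - y‖
  displacement : ∀ x, ‖T x - x‖ ≤ t * M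
  inner_eq : ∀ x, ‖x‖ < R → T x = (1 + t) • x

namespace IsLocalDilation

variable {R t L M : ℝ} {T : Space N → Space N}

theorem upper (h : IsLocalDilation R t L M T) (x y : Space N) :
    ‖T x - T y‖ ≤ (1 + t * L) * ‖x - y‖ := by
  have := h.close x y
  have h2 := norm_add_le ((T x - T y) - (x - y)) (x - y)
  rw [sub_add_cancel] at h2
  linarith

theorem lower (h : IsLocalDilation R t L M T) (x y : Space N) :
    (1 - t * L) * ‖x - y‖ ≤ ‖T x - T y‖ := by
  have := h.close x y
  have h2 := norm_sub_le (T x - T y) ((T x - T y) - (x - y))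
  rw [sub_sub_cancel] at h2
  linarith

theorem injective (h : IsLocalDilation R t L M T) : Function.Injective T := by
  intro x y hxy
  have h1 := h.lower x y
  rw [hxy, sub_self, norm_zero] at h1
  have h2 := h.small
  have : ‖x - y‖ ≤ 0 := by nlinarith [norm_nonneg (x - y)]
  exact sub_eq_zero.1 (norm_le_zero_iff.1 this)

/-- The linear dilation already supplies a preimage of `T x` inside the ball of radius `R`, and by
injectivity it is `x`. -/
theorem preimage_ball (h : IsLocalDilation R t L M T) (x : Space N)
    (hx : T x ∈ Metric.ball (0 : Space N) ((1 + t) * R)) : ‖x‖ < R := by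
  have ht : 0 < 1 + t := by linarith [h.nonneg]
  have hx' : ‖T x‖ < (1 + t) * R := by simpa using hx
  have h1 : ‖(1 + t)⁻¹ • T x‖ < R := by
    rw [norm_smul, Real.norm_of_nonneg (by positivity), inv_mul_lt_iff₀ ht]
    exact hx'
  have h2 := h.inner_eq _ h1
  rw [smul_inv_smul₀ ht.ne'] at h2
  rwa [h.injective h2] at h1

theorem antilipschitz (h : IsLocalDilation R t L M T) :
    AntilipschitzWith ((1 - t * L)⁻¹).toNNReal T := by
  have h0 : 0 < 1 - t * L := by linarith [h.small]
  refine AntilipschitzWith.of_le_mul_dist fun x y => ?_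
  rw [Real.coe_toNNReal _ (by positivity), dist_eq_norm, dist_eq_norm, inv_mul_eq_div,
    le_div_iff₀ h0, mul_comm]
  exact h.lower x y

theorem lipschitz (h : IsLocalDilation R t L M T) : LipschitzWith (1 + t * L).toNNReal T := by
  have h0 : 0 ≤ t * L := mul_nonneg h.nonneg h.const_nonneg
  refine LipschitzWith.of_dist_le_mul fun x y => ?_
  rw [Real.coe_toNNReal _ (by positivity), dist_eq_norm, dist_eq_norm]
  exact h.upper x y

theorem measurable (h : IsLocalDilation R t L M T) : Measurable T :=
  h.contDiff.continuous.measurable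

theorem coe_toNNReal_rpow {a : ℝ} (ha : 0 ≤ a) {r : ℝ} (hr : 0 ≤ r) :
    ((a.toNNReal : ℝ≥0∞)) ^ r = ENNReal.ofReal (a ^ r) :=
  ENNReal.ofReal_rpow_of_nonneg ha hr

/-- Hausdorff measure scales in a known way under Lipschitz and antilipschitz maps, so volume
distortion is controlled by the Lipschitz constants alone, without computing Jacobians. -/
theorem volume_eq_smul_hausdorff (N : ℕ) :
    ∃ c : ℝ≥0, (volume : Measure (Space N)) = c • Measure.hausdorffMeasure (N : ℝ) :=
  ⟨_, (EuclideanSpace.euclideanHausdorffMeasure_eq_volume N).symm.trans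
    (Measure.euclideanHausdorffMeasure_def N)⟩

theorem map_volume_le (h : IsLocalDilation R t L M T) :
    Measure.map T volume ≤ ENNReal.ofReal ((1 - t * L) ^ (-(N : ℝ))) • volume := by
  have h0 : 0 < 1 - t * L := by linarith [h.small]
  obtain ⟨c, hc⟩ := volume_eq_smul_hausdorff N
  refine Measure.le_iff.2 fun E hE => ?_
  rw [Measure.map_apply h.measurable hE, hc]
  have := h.antilipschitz.hausdorffMeasure_preimage_le (d := (N : ℝ)) (by positivity) E
  rw [coe_toNNReal_rpow (by positivity) (by positivity), Real.inv_rpow h0.le,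
    ← Real.rpow_neg h0.le] at this
  simp only [Measure.smul_apply, smul_eq_mul]
  calc c • Measure.hausdorffMeasure (N : ℝ) (T ⁻¹' E)
      ≤ c • (ENNReal.ofReal ((1 - t * L) ^ (-(N : ℝ))) * Measure.hausdorffMeasure (N : ℝ) E) := by
        gcongr
    _ = _ := by simp only [ENNReal.smul_def, smul_eq_mul]; ring

theorem le_map_volume (h : IsLocalDilation R t L M T) :
    ENNReal.ofReal ((1 + t * L) ^ (-(N : ℝ))) • volume ≤ Measure.map T volume := by
  have h0 : 0 < 1 + t * L := by have := mul_nonneg h.nonneg h.const_nonneg; linarith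
  obtain ⟨c, hc⟩ := volume_eq_smul_hausdorff N
  refine Measure.le_iff.2 fun E hE => ?_
  rw [Measure.map_apply h.measurable hE, hc]
  have := h.lipschitz.hausdorffMeasure_image_le (d := (N : ℝ)) (by positivity) (T ⁻¹' E)
  rw [Set.image_preimage_eq _ h.surjective, coe_toNNReal_rpow (by positivity) (by positivity)]
    at this
  simp only [Measure.smul_apply, smul_eq_mul]
  calc ENNReal.ofReal ((1 + t * L) ^ (-(N : ℝ))) * (c • Measure.hausdorffMeasure (N : ℝ) E)
      ≤ ENNReal.ofReal ((1 + t * L) ^ (-(N : ℝ))) * (c • (ENNReal.ofReal ((1 + t * L) ^ (N : ℝ)) *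
          Measure.hausdorffMeasure (N : ℝ) (T ⁻¹' E))) := by gcongr
    _ = (ENNReal.ofReal ((1 + t * L) ^ (-(N : ℝ))) * ENNReal.ofReal ((1 + t * L) ^ (N : ℝ))) *
          (c • Measure.hausdorffMeasure (N : ℝ) (T ⁻¹' E)) := by
        simp only [ENNReal.smul_def, smul_eq_mul]; ring
    _ = _ := by
        rw [← ENNReal.ofReal_mul (by positivity), ← Real.rpow_add h0, neg_add_cancel,
          Real.rpow_zero, ENNReal.ofReal_one, one_mul]

/-- Over this ball `T` is the linear dilation, so the factor is exact. Exactness here produces the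
sharp Pohozaev coefficients; the cruder factors used elsewhere affect only tails. -/
theorem map_volume_restrict_ball (h : IsLocalDilation R t L M T) :
    (Measure.map T volume).restrict (Metric.ball 0 ((1 + t) * R)) =
      ENNReal.ofReal ((1 + t) ^ (-(N : ℝ))) •
        (volume : Measure (Space N)).restrict (Metric.ball 0 ((1 + t) * R)) := by
  have ht : 0 < 1 + t := by linarith [h.nonneg]
  ext E hE
  have hB : MeasurableSet (E ∩ Metric.ball (0 : Space N) ((1 + t) * R)) :=
    hE.inter Metric.isOpen_ball.measurableSet
  rw [Measure.restrict_apply hE, Measure.map_apply h.measurable hB, Measure.smul_apply,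
    Measure.restrict_apply hE]
  have : T ⁻¹' (E ∩ Metric.ball (0 : Space N) ((1 + t) * R)) =
      (fun x => (1 + t) • x) ⁻¹' (E ∩ Metric.ball (0 : Space N) ((1 + t) * R)) := by
    ext x
    constructor
    · intro hx
      have := h.inner_eq x (h.preimage_ball x hx.2)
      simpa only [Set.mem_preimage, this] using hx
    · intro hx
      have hx2 : ‖(1 + t) • x‖ < (1 + t) * R := by simpa using hx.2
      rw [norm_smul, Real.norm_of_nonneg ht.le, mul_lt_mul_iff_right₀ ht] at hx2
      simpa only [Set.mem_preimage, h.inner_eq x hx2] using hx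
  rw [this, Measure.addHaar_preimage_smul _ ht.ne', smul_eq_mul]
  congr 2
  rw [abs_of_pos (by positivity), Real.rpow_neg ht.le, Real.rpow_natCast]
  simp

theorem quasiMeasurePreserving (h : IsLocalDilation R t L M T) :
    Measure.QuasiMeasurePreserving T volume volume :=
  ⟨h.measurable, (Measure.absolutelyContinuous_of_le h.map_volume_le).trans
    Measure.smul_absolutelyContinuous⟩

/-- The product map `(x, y) ↦ (T x, T y)`. -/
def pairMap (T : Space N → Space N) : Space N × Space N → Space N × Space N := Prod.map T T

theorem measurable_pairMap (h : IsLocalDilation R t L M T) : Measurable (pairMap T) :=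
  h.measurable.prodMap h.measurable

theorem map_pair_volume_le (h : IsLocalDilation R t L M T) :
    Measure.map (pairMap T) volume ≤ ENNReal.ofReal ((1 - t * L) ^ (-(N : ℝ)) *
      (1 - t * L) ^ (-(N : ℝ))) • volume := by
  have h0 : 0 < 1 - t * L := by linarith [h.small]
  rw [Measure.volume_eq_prod, pairMap, ← Measure.map_prod_map _ _ h.measurable h.measurable]
  refine (Measure.prod_mono h.map_volume_le h.map_volume_le).trans (le_of_eq ?_)
  rw [Measure.prod_smul_left, Measure.prod_smul_right, smul_smul, ← ENNReal.ofReal_mul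
    (by positivity)]

theorem map_pair_volume_restrict_ball (h : IsLocalDilation R t L M T) :
    (Measure.map (pairMap T) volume).restrict
      (Metric.ball 0 ((1 + t) * R) ×ˢ Metric.ball 0 ((1 + t) * R)) =
      ENNReal.ofReal ((1 + t) ^ (-(N : ℝ)) * (1 + t) ^ (-(N : ℝ))) •
        (volume : Measure (Space N × Space N)).restrict
          (Metric.ball 0 ((1 + t) * R) ×ˢ Metric.ball 0 ((1 + t) * R)) := by
  have ht : 0 < 1 + t := by linarith [h.nonneg]
  rw [Measure.volume_eq_prod, pairMap, ← Measure.map_prod_map _ _ h.measurable h.measurable,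
    ← Measure.prod_restrict, ← Measure.prod_restrict, h.map_volume_restrict_ball,
    Measure.prod_smul_left, Measure.prod_smul_right, smul_smul, ← ENNReal.ofReal_mul
    (by positivity)]

end IsLocalDilation

theorem setLIntegral_comp_eq {α : Type*} [MeasurableSpace α] {μ : Measure α} {T : α → α}
    (hT : Measure.QuasiMeasurePreserving T μ μ) {A : Set α} (hA : MeasurableSet A)
    {g : α → ℝ≥0∞} (hg : AEMeasurable g μ) :
    ∫⁻ x in T ⁻¹' A, g (T x) ∂μ = ∫⁻ x, g x ∂(Measure.map T μ).restrict A := by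
  have hg' : AEMeasurable g (Measure.map T μ) := hg.mono_ac hT.absolutelyContinuous
  rw [Measure.restrict_map hT.measurable hA, lintegral_map' _ hT.measurable.aemeasurable]
  rw [← Measure.restrict_map hT.measurable hA]
  exact hg'.restrict

/-- Pulling back integrals along a map whose push-forward measure is controlled on a set. -/
theorem setLIntegral_comp_le {α : Type*} [MeasurableSpace α] {μ : Measure α} {T : α → α}
    (hT : Measure.QuasiMeasurePreserving T μ μ) {A : Set α} (hA : MeasurableSet A) {c : ℝ≥0∞}
    (h : (Measure.map T μ).restrict A ≤ c • μ.restrict A) {g : α → ℝ≥0∞} (hg : AEMeasurable g μ) :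
    ∫⁻ x in T ⁻¹' A, g (T x) ∂μ ≤ c * ∫⁻ x in A, g x ∂μ := by
  rw [setLIntegral_comp_eq hT hA hg, ← smul_eq_mul, ← lintegral_smul_measure]
  exact lintegral_mono' h le_rfl

theorem le_setLIntegral_comp {α : Type*} [MeasurableSpace α] {μ : Measure α} {T : α → α}
    (hT : Measure.QuasiMeasurePreserving T μ μ) {A : Set α} (hA : MeasurableSet A) {c : ℝ≥0∞}
    (h : c • μ.restrict A ≤ (Measure.map T μ).restrict A) {g : α → ℝ≥0∞} (hg : AEMeasurable g μ) :
    c * ∫⁻ x in A, g x ∂μ ≤ ∫⁻ x in T ⁻¹' A, g (T x) ∂μ := by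
  rw [setLIntegral_comp_eq hT hA hg, ← smul_eq_mul, ← lintegral_smul_measure]
  exact lintegral_mono' h le_rfl

theorem eLpNorm_comp_le {α E : Type*} [MeasurableSpace α] [NormedAddCommGroup E] {μ : Measure α}
    {T : α → α} (hT : Measure.QuasiMeasurePreserving T μ μ) {c : ℝ≥0∞} {q : ℝ} (hq : 0 < q)
    (h : Measure.map T μ ≤ c • μ) {f : α → E} (hf : AEStronglyMeasurable f μ) :
    eLpNorm (f ∘ T) (ENNReal.ofReal q) μ ≤ c ^ (1 / q) * eLpNorm f (ENNReal.ofReal q) μ := by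
  rw [← eLpNorm_map_measure (hf.mono_ac hT.absolutelyContinuous) hT.measurable.aemeasurable]
  refine (eLpNorm_mono_measure _ h).trans ?_
  rw [eLpNorm_smul_measure_of_ne_top (by simp), smul_eq_mul, ENNReal.toReal_div,
    ENNReal.toReal_ofReal hq.le, ENNReal.toReal_one]

theorem memLp_comp {α E : Type*} [MeasurableSpace α] [NormedAddCommGroup E] {μ : Measure α}
    {T : α → α} (hT : Measure.QuasiMeasurePreserving T μ μ) {c : ℝ≥0∞} (hc : c ≠ ⊤) {q : ℝ}
    (hq : 0 < q) (h : Measure.map T μ ≤ c • μ) {f : α → E}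
    (hf : MemLp f (ENNReal.ofReal q) μ) : MemLp (f ∘ T) (ENNReal.ofReal q) μ :=
  ⟨hf.1.comp_quasiMeasurePreserving hT, (eLpNorm_comp_le hT hq h hf.1).trans_lt
    (ENNReal.mul_lt_top (ENNReal.rpow_lt_top_of_nonneg (by positivity) hc) hf.2)⟩

theorem tendsto_eLpNorm_comp {α E : Type*} [MeasurableSpace α] [NormedAddCommGroup E]
    {μ : Measure α} {T : α → α} (hT : Measure.QuasiMeasurePreserving T μ μ) {c : ℝ≥0∞}
    (hc : c ≠ ⊤) {q : ℝ} (hq : 0 < q) (h : Measure.map T μ ≤ c • μ) {f : ℕ → α → E} {g : α → E}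
    (hf : ∀ n, AEStronglyMeasurable (f n) μ) (hg : AEStronglyMeasurable g μ)
    (hfg : Tendsto (fun n => eLpNorm (f n - g) (ENNReal.ofReal q) μ) atTop (𝓝 0)) :
    Tendsto (fun n => eLpNorm (f n ∘ T - g ∘ T) (ENNReal.ofReal q) μ) atTop (𝓝 0) := by
  have h1 := ENNReal.Tendsto.const_mul (a := c ^ (1 / q)) hfg
    (Or.inr (ENNReal.rpow_ne_top_of_nonneg (by positivity) hc))
  rw [mul_zero] at h1
  refine tendsto_of_tendsto_of_tendsto_of_le_of_le tendsto_const_nhds h1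
    (fun _ => zero_le) fun n => ?_
  change eLpNorm ((f n - g) ∘ T) (ENNReal.ofReal q) μ ≤ _
  exact eLpNorm_comp_le hT hq h ((hf n).sub hg)

namespace IsLocalDilation

variable {R t L M : ℝ} {T : Space N → Space N}

theorem quasiMeasurePreserving_pair_volume (h : IsLocalDilation R t L M T) :
    Measure.QuasiMeasurePreserving (pairMap T) volume volume :=
  ⟨h.measurable_pairMap, (Measure.absolutelyContinuous_of_le h.map_pair_volume_le).trans
    Measure.smul_absolutelyContinuous⟩

/-- Off the diagonal this is the upper Lipschitz bound. On the diagonal both sides are zero, because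
`0 ^ a = 0` for `a > 0` and `0⁻¹ = 0`. -/
theorem kernel_le_outer (h : IsLocalDilation R t L M T) {a : ℝ} (ha : 0 < a) (x y : Space N) :
    (‖x - y‖ ^ a)⁻¹ ≤ (1 + t * L) ^ a * (‖T x - T y‖ ^ a)⁻¹ := by
  have h0 : 0 < 1 + t * L := by have := mul_nonneg h.nonneg h.const_nonneg; linarith
  rcases eq_or_ne x y with rfl | hxy
  · simp [Real.zero_rpow ha.ne']
  have h1 : 0 < ‖T x - T y‖ := norm_pos_iff.2 (sub_ne_zero.2 (h.injective.ne hxy))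
  have h2 : 0 < ‖x - y‖ := norm_pos_iff.2 (sub_ne_zero.2 hxy)
  rw [← div_eq_mul_inv, le_div_iff₀ (by positivity), inv_mul_le_iff₀ (by positivity),
    ← Real.mul_rpow h2.le h0.le, mul_comm]
  exact Real.rpow_le_rpow h1.le (h.upper x y) ha.le

theorem kernel_inner (h : IsLocalDilation R t L M T) (a : ℝ) {x y : Space N}
    (hx : ‖x‖ < R) (hy : ‖y‖ < R) :
    (‖x - y‖ ^ a)⁻¹ = (1 + t) ^ a * (‖T x - T y‖ ^ a)⁻¹ := by
  have ht : 0 < 1 + t := by linarith [h.nonneg]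
  rw [h.inner_eq x hx, h.inner_eq y hy, ← smul_sub, norm_smul, Real.norm_of_nonneg ht.le,
    Real.mul_rpow ht.le (norm_nonneg _), mul_inv, mul_inv_cancel_left₀]
  positivity

/-- The kernel factor `b` and the volume factor `c` multiply. This is used on the whole space with
Lipschitz factors, and on the product of balls with the exact factors of a dilation. -/
theorem map_kernelMeasure_restrict_le (h : IsLocalDilation R t L M T) {s p : ℝ}
    {A : Set (Space N × Space N)} (hA : MeasurableSet A) {b c : ℝ} (hb : 0 ≤ b)
    (hk : ∀ z, pairMap T z ∈ A → (‖z.1 - z.2‖ ^ ((N : ℝ) + s * p))⁻¹ ≤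
      b * (‖T z.1 - T z.2‖ ^ ((N : ℝ) + s * p))⁻¹)
    (hvol : (Measure.map (pairMap T) volume).restrict A ≤ ENNReal.ofReal c • volume.restrict A) :
    (Measure.map (pairMap T) (kernelMeasure N s p)).restrict A ≤
      ENNReal.ofReal (b * c) • (kernelMeasure N s p).restrict A := by
  set k : Space N × Space N → ℝ≥0∞ :=
    fun z => ENNReal.ofReal ((‖z.1 - z.2‖ ^ ((N : ℝ) + s * p))⁻¹) with hk_def
  have hkm : Measurable k := measurable_kernel N _
  refine Measure.le_iff.2 fun E hE => ?_
  have hEA := hE.inter hA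
  have hvol' : (Measure.map (pairMap T) volume).restrict (E ∩ A) ≤
      ENNReal.ofReal c • volume.restrict (E ∩ A) := by
    have := Measure.restrict_mono_measure hvol E
    rwa [Measure.restrict_smul, Measure.restrict_restrict hE, Measure.restrict_restrict hE]
      at this
  rw [Measure.restrict_apply hE, Measure.map_apply h.measurable_pairMap hEA, Measure.smul_apply,
    Measure.restrict_apply hE, kernelMeasure, withDensity_apply _ hEA,
    withDensity_apply _ (h.measurable_pairMap hEA), smul_eq_mul]
  calc ∫⁻ z in pairMap T ⁻¹' (E ∩ A), k z
      ≤ ∫⁻ z in pairMap T ⁻¹' (E ∩ A), ENNReal.ofReal b * k (pairMap T z) := by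
        refine setLIntegral_mono' (h.measurable_pairMap hEA) fun z hz => ?_
        rw [hk_def, ← ENNReal.ofReal_mul hb]
        exact ENNReal.ofReal_le_ofReal (hk z hz.2)
    _ = ENNReal.ofReal b * ∫⁻ z in pairMap T ⁻¹' (E ∩ A), k (pairMap T z) :=
        lintegral_const_mul' _ _ ENNReal.ofReal_ne_top
    _ ≤ ENNReal.ofReal b * (ENNReal.ofReal c * ∫⁻ z in E ∩ A, k z) := by
        gcongr
        exact setLIntegral_comp_le h.quasiMeasurePreserving_pair_volume hEA hvol' hkm.aemeasurable
    _ = _ := by rw [← mul_assoc, ← ENNReal.ofReal_mul hb]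

theorem map_kernelMeasure_le (h : IsLocalDilation R t L M T) {s p : ℝ}
    (hN : 0 < (N : ℝ) + s * p) :
    Measure.map (pairMap T) (kernelMeasure N s p) ≤
      ENNReal.ofReal ((1 + t * L) ^ ((N : ℝ) + s * p) *
        ((1 - t * L) ^ (-(N : ℝ)) * (1 - t * L) ^ (-(N : ℝ)))) • kernelMeasure N s p := by
  have h0 : 0 ≤ 1 + t * L := by have := mul_nonneg h.nonneg h.const_nonneg; linarith
  have := h.map_kernelMeasure_restrict_le (s := s) (p := p) MeasurableSet.univ (b := (1 + t * L) ^ ((N : ℝ) + s * p))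
    (c := (1 - t * L) ^ (-(N : ℝ)) * (1 - t * L) ^ (-(N : ℝ))) (by positivity)
    (fun z _ => h.kernel_le_outer hN _ _) (by
      simpa only [Measure.restrict_univ] using h.map_pair_volume_le)
  simpa only [Measure.restrict_univ] using this

theorem map_kernelMeasure_restrict_ball_le (h : IsLocalDilation R t L M T) (s p : ℝ) :
    (Measure.map (pairMap T) (kernelMeasure N s p)).restrict
      (Metric.ball 0 ((1 + t) * R) ×ˢ Metric.ball 0 ((1 + t) * R)) ≤
      ENNReal.ofReal ((1 + t) ^ ((N : ℝ) + s * p) *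
        ((1 + t) ^ (-(N : ℝ)) * (1 + t) ^ (-(N : ℝ)))) • (kernelMeasure N s p).restrict
      (Metric.ball 0 ((1 + t) * R) ×ˢ Metric.ball 0 ((1 + t) * R)) := by
  have ht : 0 < 1 + t := by linarith [h.nonneg]
  exact h.map_kernelMeasure_restrict_le
    (Metric.isOpen_ball.measurableSet.prod Metric.isOpen_ball.measurableSet) (by positivity)
    (fun z hz => (h.kernel_inner _ (h.preimage_ball _ hz.1) (h.preimage_ball _ hz.2)).le)
    h.map_pair_volume_restrict_ball.le

theorem quasiMeasurePreserving_pair (h : IsLocalDilation R t L M T) {s p : ℝ}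
    (hN : 0 < (N : ℝ) + s * p) :
    Measure.QuasiMeasurePreserving (pairMap T) (kernelMeasure N s p) (kernelMeasure N s p) :=
  ⟨h.measurable_pairMap, (Measure.absolutelyContinuous_of_le (h.map_kernelMeasure_le hN)).trans
    Measure.smul_absolutelyContinuous⟩

end IsLocalDilation

end Dilation

/-! ### Existence of local dilations, and their action on the three energies. -/

section DilationSobolev

variable {N : ℕ}

/-- Local dilations exist at every scale, with a Lipschitz constant independent of the scale. -/
theorem exists_isLocalDilation (N : ℕ) : ∃ L : ℝ, 0 ≤ L ∧ ∀ R : ℝ, 0 < R →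
    ∃ (M : ℝ) (V : Space N → Space N), 0 ≤ M ∧ Continuous V ∧ ∀ t : ℝ, 0 ≤ t →
      t * L ≤ 1 / 2 → IsLocalDilation R t L M fun x => x + t • V x := by
  let f : ContDiffBump (0 : Space N) := ⟨1, 2, one_pos, one_lt_two⟩
  set ξ : Space N → Space N := fun x => f x • x with hξ
  have hξc : ContDiff ℝ ∞ ξ := f.contDiff.smul contDiff_id
  have hξs : HasCompactSupport ξ := f.hasCompactSupport.smul_right
  obtain ⟨K, hK⟩ := ContDiff.lipschitzWith_of_hasCompactSupport hξs hξc (by simp)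
  obtain ⟨M₀, hM₀⟩ := hξs.exists_bound_of_continuous hξc.continuous
  have hM₀' : 0 ≤ M₀ := (norm_nonneg _).trans (hM₀ 0)
  refine ⟨K, K.2, fun R hR => ⟨R * M₀, fun x => R • ξ (R⁻¹ • x), by positivity,
    (hξc.continuous.comp (continuous_const_smul R⁻¹)).const_smul R, ?_⟩⟩
  intro t ht htK
  -- The outer factor `R` cancels the inner `R⁻¹`, so the Lipschitz constant is that of `ξ` for
  -- every `R`. Only the bound on the displacement grows with `R`.
  have hV : ∀ x y, ‖R • ξ (R⁻¹ • x) - R • ξ (R⁻¹ • y)‖ ≤ K * ‖x - y‖ := by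
    intro x y
    have h1 := hK.dist_le_mul (R⁻¹ • x) (R⁻¹ • y)
    rw [dist_eq_norm, dist_eq_norm, ← smul_sub, norm_smul, Real.norm_of_nonneg (by positivity)]
      at h1
    rw [← smul_sub, norm_smul, Real.norm_of_nonneg hR.le]
    calc R * ‖ξ (R⁻¹ • x) - ξ (R⁻¹ • y)‖ ≤ R * (K * (R⁻¹ * ‖x - y‖)) := by gcongr
      _ = _ := by field_simp
  have hclose : ∀ x y, ‖t • R • ξ (R⁻¹ • x) - t • R • ξ (R⁻¹ • y)‖ ≤ t * K * ‖x - y‖ := by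
    intro x y
    rw [← smul_sub, norm_smul, Real.norm_of_nonneg ht, mul_assoc]
    gcongr
    exact hV x y
  refine ⟨hR, ht, K.2, htK, ?_, ?_, ?_, ?_, ?_⟩
  · exact contDiff_id.add ((((hξc.comp (contDiff_const_smul R⁻¹)).const_smul R)).const_smul t)
  · intro y
    -- Surjectivity by Banach's fixed point theorem: a fixed point of this map is a preimage of `y`.
    have hcon : ContractingWith (t * K).toNNReal fun x => y - t • R • ξ (R⁻¹ • x) := by
      refine ⟨?_, LipschitzWith.of_dist_le_mul fun x z => ?_⟩
      · rw [Real.toNNReal_lt_one]; linarith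
      · rw [Real.coe_toNNReal _ (by positivity), dist_eq_norm, dist_eq_norm, sub_sub_sub_cancel_left,
          norm_sub_rev]
        exact hclose x z
    refine ⟨hcon.fixedPoint, ?_⟩
    have : y - t • R • ξ (R⁻¹ • hcon.fixedPoint) = hcon.fixedPoint := hcon.fixedPoint_isFixedPt
    simp only
    nth_rewrite 1 [← this]
    abel
  · intro x y
    convert hclose x y using 2
    abel
  · intro x
    rw [add_sub_cancel_left, norm_smul, Real.norm_of_nonneg ht, norm_smul,
      Real.norm_of_nonneg hR.le]
    gcongr
    exact hM₀ _
  · intro x hx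
    have h1 : f (R⁻¹ • x) = 1 := by
      refine f.one_of_mem_closedBall ?_
      rw [mem_closedBall_zero_iff, norm_smul, Real.norm_of_nonneg (by positivity),
        inv_mul_le_iff₀ hR]
      simpa [f] using hx.le
    simp only [hξ, h1, one_smul, smul_inv_smul₀ hR.ne', add_smul]

namespace IsLocalDilation

variable {R t L M : ℝ} {T : Space N → Space N}

theorem differentiable (h : IsLocalDilation R t L M T) : Differentiable ℝ T :=
  h.contDiff.differentiable (by simp)

theorem norm_fderiv_le (h : IsLocalDilation R t L M T) (x : Space N) :
    ‖fderiv ℝ T x‖ ≤ 1 + t * L := by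
  have h0 : 0 ≤ 1 + t * L := by have := mul_nonneg h.nonneg h.const_nonneg; linarith
  have := norm_fderiv_le_of_lipschitz ℝ (x₀ := x) h.lipschitz
  rwa [Real.coe_toNNReal _ h0] at this

theorem norm_fderiv_le_inner (h : IsLocalDilation R t L M T) {x : Space N} (hx : ‖x‖ < R) :
    ‖fderiv ℝ T x‖ ≤ 1 + t := by
  have ht : 0 ≤ 1 + t := by linarith [h.nonneg]
  have he : T =ᶠ[𝓝 x] fun y => (1 + t) • y := by
    have : Metric.ball (0 : Space N) R ∈ 𝓝 x := Metric.isOpen_ball.mem_nhds (by simpa using hx)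
    filter_upwards [this] with y hy
    exact h.inner_eq y (by simpa using hy)
  have h2 : HasFDerivAt (fun y : Space N => (1 + t) • y)
      ((1 + t) • ContinuousLinearMap.id ℝ (Space N)) x := (hasFDerivAt_id x).const_smul (1 + t)
  rw [he.fderiv_eq, h2.fderiv, norm_smul, Real.norm_of_nonneg ht]
  exact mul_le_of_le_one_right ht ContinuousLinearMap.norm_id_le

/-- The gradient of `u ∘ T` when `G` is the gradient of `u`. -/
noncomputable def pullGrad (T : Space N → Space N) (G : Space N → Space N) (x : Space N) :
    Space N := (fderiv ℝ T x).adjoint (G (T x))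

theorem norm_pullGrad_le (h : IsLocalDilation R t L M T) (G : Space N → Space N) (x : Space N) :
    ‖pullGrad T G x‖ ≤ (1 + t * L) * ‖G (T x)‖ := by
  refine (ContinuousLinearMap.le_opNorm _ _).trans ?_
  rw [LinearIsometryEquiv.norm_map]
  exact mul_le_mul_of_nonneg_right (h.norm_fderiv_le x) (norm_nonneg _)

theorem norm_pullGrad_le_inner (h : IsLocalDilation R t L M T) (G : Space N → Space N)
    {x : Space N} (hx : ‖x‖ < R) : ‖pullGrad T G x‖ ≤ (1 + t) * ‖G (T x)‖ := by
  refine (ContinuousLinearMap.le_opNorm _ _).trans ?_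
  rw [LinearIsometryEquiv.norm_map]
  exact mul_le_mul_of_nonneg_right (h.norm_fderiv_le_inner hx) (norm_nonneg _)

theorem gradient_comp_eq (h : IsLocalDilation R t L M T) {φ : Space N → ℝ}
    (hφ : IsTestFunction φ) : gradient (φ ∘ T) = pullGrad T (gradient φ) := by
  ext1 x
  refine ext_inner_right ℝ fun v => ?_
  rw [pullGrad, ContinuousLinearMap.adjoint_inner_left]
  simp only [gradient, InnerProductSpace.toDual_symm_apply]
  rw [fderiv_comp x (hφ.1.differentiable (by simp) _) (h.differentiable x)]
  rfl

theorem isTestFunction_comp (h : IsLocalDilation R t L M T) {φ : Space N → ℝ}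
    (hφ : IsTestFunction φ) : IsTestFunction (φ ∘ T) := by
  refine ⟨hφ.1.comp h.contDiff, ?_⟩
  obtain ⟨r, hr⟩ := hφ.2.isBounded.subset_ball (0 : Space N)
  refine HasCompactSupport.intro (isCompact_closedBall (0 : Space N) (r + t * M)) fun x hx => ?_
  refine image_eq_zero_of_notMem_tsupport (f := φ) (x := T x) fun hx' => hx ?_
  have h1 : ‖T x‖ < r := by simpa using hr hx'
  have h2 := h.displacement x
  have h3 := norm_sub_le (T x) (T x - x)
  rw [sub_sub_cancel] at h3
  rw [mem_closedBall_zero_iff]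
  linarith

theorem aestronglyMeasurable_pullGrad (h : IsLocalDilation R t L M T) {G : Space N → Space N}
    (hG : AEStronglyMeasurable G volume) : AEStronglyMeasurable (pullGrad T G) volume := by
  have h1 : AEStronglyMeasurable (fun x => (fderiv ℝ T x).adjoint) volume :=
    (ContinuousLinearMap.adjoint.continuous.comp
      (h.contDiff.continuous_fderiv (by simp))).aestronglyMeasurable
  exact isBoundedBilinearMap_apply.continuous.comp_aestronglyMeasurable
    (h1.prodMk (hG.comp_quasiMeasurePreserving h.quasiMeasurePreserving))

theorem pullGrad_sub (G H : Space N → Space N) :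
    pullGrad T G - pullGrad T H = pullGrad T (G - H) := by
  ext1 x; simp [pullGrad]

theorem increment_comp (u : Space N → ℝ) : increment (u ∘ T) = increment u ∘ pairMap T := rfl

/-- `W_p` is stable under composition with a local dilation. -/
theorem wApprox_comp (h : IsLocalDilation R t L M T) {s p : ℝ} (hs : s ∈ Set.Ioo (0 : ℝ) 1)
    (hp : 1 < p) (hN : p < (N : ℝ)) {u : Space N → ℝ} {G : Space N → Space N}
    {φ : ℕ → Space N → ℝ} (hu : WApprox s p u G φ) :
    WApprox s p (u ∘ T) (pullGrad T G) (fun n => φ n ∘ T) := by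
  have hp0 : 0 < p := by linarith
  have hq := one_lt_critExp hp hN
  have hNs : 0 < (N : ℝ) + s * p := by have := mul_pos hs.1 hp0; positivity
  have h0 : 0 ≤ 1 + t * L := by have := mul_nonneg h.nonneg h.const_nonneg; linarith
  have hcomp := memLp_comp h.quasiMeasurePreserving ENNReal.ofReal_ne_top hp0 h.map_volume_le
    hu.memLp_grad
  refine ⟨memLp_comp h.quasiMeasurePreserving ENNReal.ofReal_ne_top (by linarith)
    h.map_volume_le hu.memLp, hcomp.of_le_mul (c := 1 + t * L)
      (h.aestronglyMeasurable_pullGrad hu.memLp_grad.1)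
      (Eventually.of_forall (h.norm_pullGrad_le G)), ?_, fun n => h.isTestFunction_comp (hu.test n),
      ?_, ?_, ?_⟩
  · rw [increment_comp]
    exact memLp_comp (h.quasiMeasurePreserving_pair hNs) ENNReal.ofReal_ne_top hp0
      (h.map_kernelMeasure_le hNs) hu.memLp_increment
  · exact tendsto_eLpNorm_comp h.quasiMeasurePreserving ENNReal.ofReal_ne_top (by linarith)
      h.map_volume_le (fun n => (hu.test n).continuous.aestronglyMeasurable) hu.memLp.1 hu.tendsto
  · have h1 := tendsto_eLpNorm_comp h.quasiMeasurePreserving ENNReal.ofReal_ne_top hp0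
      h.map_volume_le (fun n => (hu.test n).continuous_gradient.aestronglyMeasurable)
      hu.memLp_grad.1 hu.tendsto_grad
    have h2 := ENNReal.Tendsto.const_mul (a := ENNReal.ofReal (1 + t * L)) h1
      (Or.inr ENNReal.ofReal_ne_top)
    rw [mul_zero] at h2
    refine tendsto_of_tendsto_of_tendsto_of_le_of_le tendsto_const_nhds h2
      (fun _ => zero_le) fun n => ?_
    change eLpNorm (gradient (φ n ∘ T) - pullGrad T G) _ _ ≤ _
    rw [h.gradient_comp_eq (hu.test n), pullGrad_sub]
    exact eLpNorm_le_mul_eLpNorm_of_ae_le_mul (Eventually.of_forall (h.norm_pullGrad_le _)) _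
  · simp_rw [increment_comp]
    exact tendsto_eLpNorm_comp (h.quasiMeasurePreserving_pair hNs) ENNReal.ofReal_ne_top hp0
      (h.map_kernelMeasure_le hNs)
      (fun n => aestronglyMeasurable_increment s p (hu.test n).continuous.aestronglyMeasurable)
      hu.memLp_increment.1 hu.tendsto_increment

/-- Each factor combines the bound on the derivative of `T` with the change of volume. Over the ball
they give `(1 + t)^{p - N}`, the scaling of the gradient energy; over its complement only the
Lipschitz bounds are available. -/
theorem lintegral_pullGrad_le (h : IsLocalDilation R t L M T) {p : ℝ} (hp : 0 < p)
    {G : Space N → Space N} (hG : AEStronglyMeasurable G volume) :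
    ∫⁻ x, ‖pullGrad T G x‖ₑ ^ p ≤
      ENNReal.ofReal ((1 + t) ^ p * (1 + t) ^ (-(N : ℝ))) *
        (∫⁻ x in Metric.ball 0 ((1 + t) * R), ‖G x‖ₑ ^ p) +
      ENNReal.ofReal ((1 + t * L) ^ p * (1 - t * L) ^ (-(N : ℝ))) *
        (∫⁻ x in (Metric.ball 0 ((1 + t) * R))ᶜ, ‖G x‖ₑ ^ p) := by
  have ht : 0 < 1 + t := by linarith [h.nonneg]
  have h0 : 0 < 1 + t * L := by have := mul_nonneg h.nonneg h.const_nonneg; linarith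
  set B := Metric.ball (0 : Space N) ((1 + t) * R) with hB
  have hBm : MeasurableSet B := Metric.isOpen_ball.measurableSet
  have key : ∀ (A : Set (Space N)) (b c : ℝ), MeasurableSet A → 0 ≤ b →
      (∀ x, T x ∈ A → ‖pullGrad T G x‖ ≤ b * ‖G (T x)‖) →
      (Measure.map T volume).restrict A ≤ ENNReal.ofReal c • volume.restrict A →
      ∫⁻ x in T ⁻¹' A, ‖pullGrad T G x‖ₑ ^ p ≤
        ENNReal.ofReal (b ^ p * c) * ∫⁻ x in A, ‖G x‖ₑ ^ p := by
    intro A b c hA hb hle hmeas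
    calc ∫⁻ x in T ⁻¹' A, ‖pullGrad T G x‖ₑ ^ p
        ≤ ∫⁻ x in T ⁻¹' A, ENNReal.ofReal (b ^ p) * ‖G (T x)‖ₑ ^ p := by
          refine setLIntegral_mono' (h.measurable hA) fun x hx => ?_
          rw [← ENNReal.ofReal_rpow_of_nonneg hb hp.le, ← ENNReal.mul_rpow_of_nonneg _ _ hp.le]
          refine ENNReal.rpow_le_rpow ?_ hp.le
          rw [← ofReal_norm, ← ofReal_norm, ← ENNReal.ofReal_mul hb]
          exact ENNReal.ofReal_le_ofReal (hle x hx)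
      _ = ENNReal.ofReal (b ^ p) * ∫⁻ x in T ⁻¹' A, ‖G (T x)‖ₑ ^ p :=
          lintegral_const_mul' _ _ ENNReal.ofReal_ne_top
      _ ≤ ENNReal.ofReal (b ^ p) * (ENNReal.ofReal c * ∫⁻ x in A, ‖G x‖ₑ ^ p) := by
          gcongr
          exact setLIntegral_comp_le h.quasiMeasurePreserving hA hmeas (hG.enorm.pow_const p)
      _ = _ := by rw [← mul_assoc, ← ENNReal.ofReal_mul (by positivity)]
  rw [← lintegral_add_compl _ (h.measurable hBm), ← Set.preimage_compl]
  refine add_le_add (key B (1 + t) _ hBm ht.le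
    (fun x hx => h.norm_pullGrad_le_inner G (h.preimage_ball x hx)) h.map_volume_restrict_ball.le)
    (key Bᶜ (1 + t * L) _ hBm.compl h0.le (fun x _ => h.norm_pullGrad_le G x) ?_)
  rw [← Measure.restrict_smul]
  exact Measure.restrict_mono_measure h.map_volume_le _

theorem lintegral_increment_comp_le (h : IsLocalDilation R t L M T) {s p : ℝ} (hs : 0 < s)
    (hp : 0 < p) {u : Space N → ℝ} (hu : AEStronglyMeasurable u volume) :
    ∫⁻ z, ‖increment (u ∘ T) z‖ₑ ^ p ∂kernelMeasure N s p ≤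
      ENNReal.ofReal ((1 + t) ^ ((N : ℝ) + s * p) * ((1 + t) ^ (-(N : ℝ)) * (1 + t) ^ (-(N : ℝ)))) *
        (∫⁻ z in Metric.ball 0 ((1 + t) * R) ×ˢ Metric.ball 0 ((1 + t) * R),
          ‖increment u z‖ₑ ^ p ∂kernelMeasure N s p) +
      ENNReal.ofReal ((1 + t * L) ^ ((N : ℝ) + s * p) *
        ((1 - t * L) ^ (-(N : ℝ)) * (1 - t * L) ^ (-(N : ℝ)))) *
        (∫⁻ z in (Metric.ball 0 ((1 + t) * R) ×ˢ Metric.ball 0 ((1 + t) * R))ᶜ,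
          ‖increment u z‖ₑ ^ p ∂kernelMeasure N s p) := by
  have hNs : 0 < (N : ℝ) + s * p := by have := mul_pos hs hp; positivity
  set B := Metric.ball (0 : Space N) ((1 + t) * R) ×ˢ Metric.ball (0 : Space N) ((1 + t) * R)
    with hB
  have hBm : MeasurableSet B :=
    Metric.isOpen_ball.measurableSet.prod Metric.isOpen_ball.measurableSet
  have hm := (aestronglyMeasurable_increment s p hu).enorm.pow_const p
  rw [← lintegral_add_compl _ (h.measurable_pairMap hBm), ← Set.preimage_compl]
  refine add_le_add (setLIntegral_comp_le (h.quasiMeasurePreserving_pair hNs) hBm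
    (h.map_kernelMeasure_restrict_ball_le s p) hm)
    (setLIntegral_comp_le (h.quasiMeasurePreserving_pair hNs) hBm.compl ?_ hm)
  rw [← Measure.restrict_smul]
  exact Measure.restrict_mono_measure (h.map_kernelMeasure_le hNs) _

/-- A lower bound is needed here, unlike for the two energies, because the power term stands on the
other side of the energy inequality. -/
theorem le_lintegral_comp (h : IsLocalDilation R t L M T) {q : ℝ}
    {u : Space N → ℝ} (hu : AEStronglyMeasurable u volume) :
      ENNReal.ofReal ((1 + t) ^ (-(N : ℝ))) *
        (∫⁻ x in Metric.ball 0 ((1 + t) * R), ‖u x‖ₑ ^ q) +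
      ENNReal.ofReal ((1 + t * L) ^ (-(N : ℝ))) *
        (∫⁻ x in (Metric.ball 0 ((1 + t) * R))ᶜ, ‖u x‖ₑ ^ q) ≤
      ∫⁻ x, ‖u (T x)‖ₑ ^ q := by
  set B := Metric.ball (0 : Space N) ((1 + t) * R) with hB
  have hBm : MeasurableSet B := Metric.isOpen_ball.measurableSet
  have hm := hu.enorm.pow_const q
  rw [← lintegral_add_compl (fun x => ‖u (T x)‖ₑ ^ q) (h.measurable hBm), ← Set.preimage_compl]
  refine add_le_add (le_setLIntegral_comp h.quasiMeasurePreserving hBm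
    h.map_volume_restrict_ball.ge hm)
    (le_setLIntegral_comp h.quasiMeasurePreserving hBm.compl ?_ hm)
  rw [← Measure.restrict_smul]
  exact Measure.restrict_mono_measure h.le_map_volume _

end IsLocalDilation

end DilationSobolev

/-! ### Size of `u ∘ T - u` in Lebesgue spaces. -/

section Displacement

variable {N : ℕ} {R L M : ℝ} {V : Space N → Space N}

theorem IsLocalDilation.map_volume_le_two {t : ℝ} {T : Space N → Space N}
    (h : IsLocalDilation R t L M T) :
    Measure.map T volume ≤ ENNReal.ofReal (2 ^ (N : ℝ)) • volume := by
  refine h.map_volume_le.trans ?_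
  gcongr
  rw [← inv_inv ((2 : ℝ) ^ (N : ℝ)), ← Real.inv_rpow (by norm_num), ← Real.rpow_neg (by norm_num)]
  refine Real.rpow_le_rpow_of_nonpos (by norm_num) ?_ (by simp)
  have := h.small
  norm_num at this ⊢
  linarith

theorem lintegral_rpow_le_of_isProbabilityMeasure {α : Type*} [MeasurableSpace α]
    {ν : Measure α} [IsProbabilityMeasure ν] {p : ℝ} (hp : 1 ≤ p) {g : α → ℝ}
    (hg : AEStronglyMeasurable g ν) :
    (∫⁻ x, ‖g x‖ₑ ∂ν) ^ p ≤ ∫⁻ x, ‖g x‖ₑ ^ p ∂ν := by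
  rw [← eLpNorm_ofReal_rpow (by linarith), ← eLpNorm_one_eq_lintegral_enorm]
  exact ENNReal.rpow_le_rpow (eLpNorm_le_eLpNorm_of_exponent_le (by simpa using hp) hg)
    (by linarith)

/-- The fundamental theorem of calculus along the segment from `x` to `x + t • v`. -/
theorem IsTestFunction.enorm_comp_sub_le {φ : Space N → ℝ} (hφ : IsTestFunction φ) {t K : ℝ}
    (x v : Space N) (hv : ‖t • v‖ ≤ K) :
    ‖φ (x + t • v) - φ x‖ₑ ≤
      ENNReal.ofReal K * ∫⁻ τ in Set.Ioc (0 : ℝ) 1, ‖gradient φ (x + (τ * t) • v)‖ₑ := by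
  have hK : 0 ≤ K := (norm_nonneg _).trans hv
  have hline : ∀ τ : ℝ, HasDerivAt (fun τ : ℝ => x + (τ * t) • v) (t • v) τ := by
    intro τ
    have := (((hasDerivAt_id τ).mul_const t).smul_const v).const_add x
    simpa using this
  have hd : ∀ τ : ℝ, HasDerivAt (fun τ : ℝ => φ (x + (τ * t) • v))
      (fderiv ℝ φ (x + (τ * t) • v) (t • v)) τ := fun τ =>
    (hφ.1.differentiable (by simp) _).hasFDerivAt.comp_hasDerivAt τ (hline τ)
  have hc : Continuous fun τ : ℝ => fderiv ℝ φ (x + (τ * t) • v) (t • v) := by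
    have h1 : Continuous (fderiv ℝ φ) := hφ.1.continuous_fderiv (by simp)
    exact (h1.comp (by fun_prop)).clm_apply continuous_const
  have hftc := intervalIntegral.integral_eq_sub_of_hasDerivAt (a := 0) (b := 1)
    (fun τ _ => hd τ) (hc.intervalIntegrable _ _)
  simp only [one_mul, zero_mul, zero_smul, add_zero] at hftc
  rw [← hftc, intervalIntegral.integral_of_le zero_le_one]
  refine (enorm_integral_le_lintegral_enorm _).trans ?_
  rw [← lintegral_const_mul' _ _ ENNReal.ofReal_ne_top]
  refine lintegral_mono fun τ => ?_
  rw [← ofReal_norm, ← ofReal_norm, ← ENNReal.ofReal_mul hK]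
  refine ENNReal.ofReal_le_ofReal ?_
  rw [norm_gradient, mul_comm K]
  exact (ContinuousLinearMap.le_opNorm _ _).trans (by gcongr)

/-- Test functions move by `O(t)` in `L^p` under local dilations. -/
theorem IsTestFunction.eLpNorm_comp_sub_le {p : ℝ} (hp : 1 ≤ p)
    (hVc : Continuous V)
    (hV : ∀ t : ℝ, 0 ≤ t → t * L ≤ 1 / 2 → IsLocalDilation R t L M fun x => x + t • V x)
    {t : ℝ} (ht : 0 ≤ t) (htL : t * L ≤ 1 / 2) {φ : Space N → ℝ} (hφ : IsTestFunction φ) :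
    eLpNorm (fun x => φ (x + t • V x) - φ x) (ENNReal.ofReal p) volume ≤
      ENNReal.ofReal (t * M) * (ENNReal.ofReal (2 ^ (N : ℝ))) ^ (1 / p) *
        eLpNorm (gradient φ) (ENNReal.ofReal p) volume := by
  have hp0 : 0 < p := by linarith
  set g : ℝ → Space N → ℝ := fun τ x => ‖gradient φ (x + (τ * t) • V x)‖ with hg
  have hgc : Continuous fun z : Space N × ℝ => g z.2 z.1 := by
    have h1 := hφ.continuous_gradient
    have h2 : Continuous fun z : Space N × ℝ => z.1 + (z.2 * t) • V z.1 := by fun_prop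
    exact (h1.comp h2).norm
  have : IsProbabilityMeasure ((volume : Measure ℝ).restrict (Set.Ioc 0 1)) := ⟨by simp⟩
  rw [eLpNorm_ofReal_eq hp0, eLpNorm_ofReal_eq hp0, mul_assoc,
    ← ENNReal.mul_rpow_of_nonneg _ _ (by positivity)]
  have hmain : ∫⁻ x, ‖φ (x + t • V x) - φ x‖ₑ ^ p ≤ ENNReal.ofReal (t * M) ^ p *
      (ENNReal.ofReal (2 ^ (N : ℝ)) * ∫⁻ x, ‖gradient φ x‖ₑ ^ p) := by
    calc ∫⁻ x, ‖φ (x + t • V x) - φ x‖ₑ ^ p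
        ≤ ∫⁻ x, ENNReal.ofReal (t * M) ^ p *
            ∫⁻ τ in Set.Ioc (0 : ℝ) 1, ‖g τ x‖ₑ ^ p := by
          refine lintegral_mono fun x => ?_
          have hdis := (hV t ht htL).displacement x
          rw [add_sub_cancel_left] at hdis
          refine (ENNReal.rpow_le_rpow (hφ.enorm_comp_sub_le x (V x) hdis) hp0.le).trans ?_
          rw [ENNReal.mul_rpow_of_nonneg _ _ hp0.le]
          gcongr
          have := lintegral_rpow_le_of_isProbabilityMeasure hp (g := fun τ => g τ x)
            (ν := (volume : Measure ℝ).restrict (Set.Ioc 0 1))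
            (hgc.comp (by fun_prop : Continuous fun τ : ℝ => (x, τ))).aestronglyMeasurable
          simpa only [hg, enorm_norm] using this
      _ = ENNReal.ofReal (t * M) ^ p *
            ∫⁻ τ in Set.Ioc (0 : ℝ) 1, ∫⁻ x, ‖g τ x‖ₑ ^ p := by
          rw [lintegral_const_mul' _ _ (ENNReal.rpow_ne_top_of_nonneg hp0.le ENNReal.ofReal_ne_top),
            lintegral_lintegral_swap]
          exact (hgc.enorm.measurable.pow_const p).aemeasurable
      _ ≤ ENNReal.ofReal (t * M) ^ p * ∫⁻ _ in Set.Ioc (0 : ℝ) 1,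
            ENNReal.ofReal (2 ^ (N : ℝ)) * ∫⁻ x, ‖gradient φ x‖ₑ ^ p := by
          gcongr 1
          refine setLIntegral_mono' measurableSet_Ioc fun τ hτ => ?_
          -- For `τ ∈ (0, 1]` the intermediate map, with parameter `τ * t`, is again a local
          -- dilation, so its volume distortion is bounded by the same `2^N`.
          have hL : 0 ≤ L := (hV t ht htL).const_nonneg
          have hτt : τ * t * L ≤ 1 / 2 := by
            have : τ * (t * L) ≤ 1 * (t * L) := by
              have := mul_nonneg ht hL
              gcongr
              exact hτ.2
            linarith
          have hd := hV (τ * t) (mul_nonneg hτ.1.le ht) hτt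
          have := setLIntegral_comp_le hd.quasiMeasurePreserving MeasurableSet.univ
            (c := ENNReal.ofReal (2 ^ (N : ℝ)))
            (by simpa only [Measure.restrict_univ] using hd.map_volume_le_two)
            (g := fun x => ‖gradient φ x‖ₑ ^ p)
            (hφ.continuous_gradient.enorm.measurable.pow_const p).aemeasurable
          simpa only [Set.preimage_univ, Measure.restrict_univ, hg, enorm_norm] using this
      _ = _ := by simp
  calc (∫⁻ x, ‖φ (x + t • V x) - φ x‖ₑ ^ p) ^ (1 / p)
      ≤ (ENNReal.ofReal (t * M) ^ p *
        (ENNReal.ofReal (2 ^ (N : ℝ)) * ∫⁻ x, ‖gradient φ x‖ₑ ^ p)) ^ (1 / p) := by gcongr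
    _ = _ := by
      rw [ENNReal.mul_rpow_of_nonneg _ _ (by positivity), ← ENNReal.rpow_mul,
        mul_one_div_cancel hp0.ne', ENNReal.rpow_one]

/-- Functions of `W_p` move by `O(t)` in `L^p` under local dilations. -/
theorem WApprox.eLpNorm_comp_sub_le {s p : ℝ} (hp : 1 < p) (hN : p < (N : ℝ))
    (hVc : Continuous V)
    (hV : ∀ t : ℝ, 0 ≤ t → t * L ≤ 1 / 2 → IsLocalDilation R t L M fun x => x + t • V x)
    {t : ℝ} (ht : 0 ≤ t) (htL : t * L ≤ 1 / 2) {u : Space N → ℝ} {G : Space N → Space N}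
    {φ : ℕ → Space N → ℝ} (hu : WApprox s p u G φ) :
    eLpNorm (fun x => u (x + t • V x) - u x) (ENNReal.ofReal p) volume ≤
      ENNReal.ofReal (t * M) * (ENNReal.ofReal (2 ^ (N : ℝ))) ^ (1 / p) *
        eLpNorm G (ENNReal.ofReal p) volume := by
  have hp0 : 0 < p := by linarith
  set K := ENNReal.ofReal (t * M) * (ENNReal.ofReal (2 ^ (N : ℝ))) ^ (1 / p) with hK
  have hKt : K ≠ ⊤ := ENNReal.mul_ne_top ENNReal.ofReal_ne_top
    (ENNReal.rpow_ne_top_of_nonneg (by positivity) ENNReal.ofReal_ne_top)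
  obtain ⟨ns, hns, hae⟩ := exists_subseq_ae_tendsto (one_lt_critExp hp hN).le
    (fun n => (hu.test n).continuous.aestronglyMeasurable) hu.memLp.1 hu.tendsto
  have hu' := hu.subseq hns
  have hd := hV t ht htL
  have hae2 : ∀ᵐ x, Tendsto (fun n => φ (ns n) (x + t • V x)) atTop (𝓝 (u (x + t • V x))) :=
    hd.quasiMeasurePreserving.ae hae
  have hb : ∀ n, eLpNorm (fun x => φ (ns n) (x + t • V x) - φ (ns n) x) (ENNReal.ofReal p) volume ≤
      K * (eLpNorm (gradient (φ (ns n)) - G) (ENNReal.ofReal p) volume +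
        eLpNorm G (ENNReal.ofReal p) volume) := by
    intro n
    refine ((hu.test (ns n)).eLpNorm_comp_sub_le hp.le hVc hV ht htL).trans ?_
    gcongr
    calc eLpNorm (gradient (φ (ns n))) (ENNReal.ofReal p) volume
        = eLpNorm ((gradient (φ (ns n)) - G) + G) (ENNReal.ofReal p) volume := by
          rw [sub_add_cancel]
      _ ≤ _ := eLpNorm_add_le ((hu.test _).continuous_gradient.aestronglyMeasurable.sub
          hu.memLp_grad.1) hu.memLp_grad.1 (by simpa using hp.le)
  have hlim : Tendsto (fun n => K * (eLpNorm (gradient (φ (ns n)) - G) (ENNReal.ofReal p) volume +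
        eLpNorm G (ENNReal.ofReal p) volume)) atTop
        (𝓝 (K * (0 + eLpNorm G (ENNReal.ofReal p) volume))) :=
    ENNReal.Tendsto.const_mul (hu'.tendsto_grad.add_const _) (Or.inr hKt)
  rw [zero_add] at hlim
  -- Membership of `u` in `L^p` is not known, so the estimate passes from test functions to `u` by
  -- lower semicontinuity along an almost everywhere convergent sequence.
  refine (Lp.eLpNorm_lim_le_liminf_eLpNorm (fun n => ?_) _ ?_).trans
    ((liminf_le_liminf (Eventually.of_forall hb)).trans hlim.liminf_eq.le)
  · have hc := (hu.test (ns n)).continuous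
    exact (by fun_prop : Continuous fun x => φ (ns n) (x + t • V x) - φ (ns n) x).aestronglyMeasurable
  · filter_upwards [hae, hae2] with x e1 e2
    exact e2.sub e1

theorem eventually_small (L : ℝ) : ∀ᶠ t : ℝ in 𝓝[>] 0, 0 < t ∧ t ≤ 1 ∧ t * L ≤ 1 / 2 := by
  have h1 : ∀ᶠ t : ℝ in 𝓝[>] 0, 0 < t := self_mem_nhdsWithin
  have h2 : ∀ᶠ t : ℝ in 𝓝 0, t < 1 := gt_mem_nhds one_pos
  have h3 : ∀ᶠ t : ℝ in 𝓝 0, t * L < 1 / 2 :=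
    (continuous_mul_const L).tendsto' 0 0 (by simp) |>.eventually_lt_const (by norm_num)
  filter_upwards [h1, h2.filter_mono nhdsWithin_le_nhds, h3.filter_mono nhdsWithin_le_nhds]
    with t a b c using ⟨a, b.le, c.le⟩

theorem tendsto_eLpNorm_comp_sub_of_continuous {r : ℝ} (hr : 0 < r) (hVc : Continuous V)
    (hM : 0 ≤ M)
    (hV : ∀ t : ℝ, 0 ≤ t → t * L ≤ 1 / 2 → IsLocalDilation R t L M fun x => x + t • V x)
    {h : Space N → ℝ} (hc : Continuous h) (hs : HasCompactSupport h) :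
    Tendsto (fun t : ℝ => eLpNorm (fun x => h (x + t • V x) - h x) (ENNReal.ofReal r) volume)
      (𝓝[>] 0) (𝓝 0) := by
  obtain ⟨K, hK⟩ := hs.exists_bound_of_continuous hc
  have hK0 : 0 ≤ K := (norm_nonneg _).trans (hK 0)
  obtain ⟨ρ, hρ⟩ := hs.isBounded.subset_ball (0 : Space N)
  have hzero : ∀ x, ρ ≤ ‖x‖ → h x = 0 := fun x hx =>
    image_eq_zero_of_notMem_tsupport fun hx' => by
      have : ‖x‖ < ρ := by simpa using hρ hx'
      linarith
  have hlim : Tendsto (fun t : ℝ => ∫⁻ x, ‖h (x + t • V x) - h x‖ₑ ^ r) (𝓝[>] 0)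
      (𝓝 (∫⁻ _ : Space N, 0)) := by
    refine tendsto_lintegral_filter_of_dominated_convergence
      ((Metric.ball (0 : Space N) (ρ + M)).indicator fun _ => ENNReal.ofReal (2 * K) ^ r)
      (Eventually.of_forall fun t => ?_) ?_ ?_ (Eventually.of_forall fun x => ?_)
    · exact ((by fun_prop : Continuous fun x => h (x + t • V x) - h x).enorm.measurable.pow_const r)
    · filter_upwards [eventually_small L] with t ht
      refine Eventually.of_forall fun x => ?_
      by_cases hx : x ∈ Metric.ball (0 : Space N) (ρ + M)
      · rw [Set.indicator_of_mem hx]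
        refine ENNReal.rpow_le_rpow ?_ hr.le
        rw [← ofReal_norm]
        refine ENNReal.ofReal_le_ofReal ?_
        have := norm_sub_le (h (x + t • V x)) (h x)
        linarith [hK (x + t • V x), hK x]
      · have hx' : ρ + M ≤ ‖x‖ := by simpa using hx
        have h1 := (hV t ht.1.le ht.2.2).displacement x
        simp only [add_sub_cancel_left] at h1
        have h2 := norm_sub_le (x + t • V x) (t • V x)
        rw [add_sub_cancel_right] at h2
        have h3 : t * M ≤ M := mul_le_of_le_one_left hM ht.2.1
        rw [hzero x (by linarith), hzero _ (by linarith)]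
        simp [hr]
    · rw [lintegral_indicator_const Metric.isOpen_ball.measurableSet]
      exact ENNReal.mul_ne_top (ENNReal.rpow_ne_top_of_nonneg hr.le ENNReal.ofReal_ne_top)
        measure_ball_lt_top.ne
    · have h1 : Continuous fun t : ℝ => ‖h (x + t • V x) - h x‖ₑ ^ r :=
        ENNReal.continuous_rpow_const.comp
          (by fun_prop : Continuous fun t : ℝ => h (x + t • V x) - h x).enorm
      exact (h1.tendsto' 0 0 (by simp [hr])).mono_left nhdsWithin_le_nhds
  rw [lintegral_zero] at hlim
  have h2 := hlim.ennrpow_const (1 / r)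
  rw [ENNReal.zero_rpow_of_pos (by positivity)] at h2
  exact h2.congr fun t => (eLpNorm_ofReal_eq hr _).symm

/-- Continuity in `L^r` of composition with local dilations. -/
theorem tendsto_eLpNorm_comp_sub {r : ℝ} (hr : 1 ≤ r) (hVc : Continuous V) (hM : 0 ≤ M)
    (hV : ∀ t : ℝ, 0 ≤ t → t * L ≤ 1 / 2 → IsLocalDilation R t L M fun x => x + t • V x)
    {g : Space N → ℝ} (hg : MemLp g (ENNReal.ofReal r) volume) :
    Tendsto (fun t : ℝ => eLpNorm (fun x => g (x + t • V x) - g x) (ENNReal.ofReal r) volume)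
      (𝓝[>] 0) (𝓝 0) := by
  have hr0 : 0 < r := by linarith
  rw [ENNReal.tendsto_nhds_zero]
  intro ε hε
  set K : ℝ≥0∞ := (ENNReal.ofReal (2 ^ (N : ℝ))) ^ (1 / r) + 1 with hK
  have hKt : K ≠ ⊤ := ENNReal.add_ne_top.2
    ⟨ENNReal.rpow_ne_top_of_nonneg (by positivity) ENNReal.ofReal_ne_top, by simp⟩
  -- Replacing `g` by a compactly supported continuous `h` costs `‖g - h‖` once composed with the
  -- dilation and once not. The constant `K` collects both contributions and does not depend on `t`.
  obtain ⟨δ, hδ, hδε⟩ := ENNReal.exists_nnreal_pos_mul_lt hKt (ENNReal.half_pos hε.ne').ne'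
  obtain ⟨h, hs, hgh, hc, -⟩ := hg.exists_hasCompactSupport_eLpNorm_sub_le (by simp)
    (ε := δ) (by exact_mod_cast hδ.ne')
  have h1 := (ENNReal.tendsto_nhds_zero.1
    (tendsto_eLpNorm_comp_sub_of_continuous hr0 hVc hM hV hc hs)) (ε / 2) (ENNReal.half_pos hε.ne')
  filter_upwards [h1, eventually_small L] with t ht hsmall
  have hd := hV t hsmall.1.le hsmall.2.2
  set T : Space N → Space N := fun x => x + t • V x with hT
  have hm : AEStronglyMeasurable (g - h) volume := hg.1.sub hc.aestronglyMeasurable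
  have hm1 : AEStronglyMeasurable ((g - h) ∘ T) volume :=
    hm.comp_quasiMeasurePreserving hd.quasiMeasurePreserving
  have hm2 : AEStronglyMeasurable (fun x => h (x + t • V x) - h x) volume :=
    (by fun_prop : Continuous fun x => h (x + t • V x) - h x).aestronglyMeasurable
  have he : (fun x => g (x + t • V x) - g x) =
      ((g - h) ∘ T - (g - h)) + fun x => h (x + t • V x) - h x := by
    ext x; simp [hT]; ring
  have hr1 : 1 ≤ ENNReal.ofReal r := by simpa using hr
  have h3 : eLpNorm ((g - h) ∘ T) (ENNReal.ofReal r) volume + eLpNorm (g - h) (ENNReal.ofReal r) volume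
      ≤ δ * K := by
    calc eLpNorm ((g - h) ∘ T) (ENNReal.ofReal r) volume + eLpNorm (g - h) (ENNReal.ofReal r) volume
        ≤ (ENNReal.ofReal (2 ^ (N : ℝ))) ^ (1 / r) * eLpNorm (g - h) (ENNReal.ofReal r) volume +
          eLpNorm (g - h) (ENNReal.ofReal r) volume := by
          gcongr
          exact eLpNorm_comp_le hd.quasiMeasurePreserving hr0 hd.map_volume_le_two hm
      _ = K * eLpNorm (g - h) (ENNReal.ofReal r) volume := by rw [hK]; ring
      _ ≤ K * δ := by gcongr
      _ = _ := mul_comm _ _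
  rw [he]
  calc _ ≤ eLpNorm ((g - h) ∘ T - (g - h)) (ENNReal.ofReal r) volume +
        eLpNorm (fun x => h (x + t • V x) - h x) (ENNReal.ofReal r) volume :=
        eLpNorm_add_le (hm1.sub hm) hm2 hr1
    _ ≤ (eLpNorm ((g - h) ∘ T) (ENNReal.ofReal r) volume +
        eLpNorm (g - h) (ENNReal.ofReal r) volume) + ε / 2 :=
        add_le_add (eLpNorm_sub_le hm1 hm hr1) ht
    _ ≤ ε / 2 + ε / 2 := by gcongr; exact h3.trans hδε.le
    _ = ε := ENNReal.add_halves ε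

end Displacement

/-! ### The Pohozaev inequality and the vanishing of weak solutions. -/

section Pohozaev

variable {N : ℕ}

/-- The nonlinearity `t ↦ |t|^{q-2} t`. -/
noncomputable def powFun (q t : ℝ) : ℝ := ‖t‖ ^ (q - 2) * t

theorem measurable_powFun (q : ℝ) : Measurable (powFun q) := by unfold powFun; fun_prop

theorem norm_powFun {q : ℝ} (hq : 1 < q) (t : ℝ) : ‖powFun q t‖ = ‖t‖ ^ (q - 1) := by
  rcases eq_or_ne t 0 with rfl | ht
  · simp [powFun, Real.zero_rpow (by linarith : q - 1 ≠ 0)]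
  · rw [powFun, norm_mul, Real.norm_of_nonneg (by positivity : 0 ≤ ‖t‖ ^ (q - 2)),
      ← Real.rpow_add_one (norm_ne_zero_iff.2 ht)]
    congr 1; ring

/-- The exponent required of `u` is `(q - 1) p / (p - 1)`, which is at least `q` because `q ≥ p`;
higher integrability therefore covers it. -/
theorem IsWeakSolution.memLp_powFun {s p : ℝ} (hp : 1 < p) (hN : p < (N : ℝ))
    {u : Space N → ℝ} {G : Space N → Space N} {φ : ℕ → Space N → ℝ}
    (hu : IsWeakSolution s p u) (h : WApprox s p u G φ) :
    MemLp (powFun (critExp N p) ∘ u) (ENNReal.ofReal (p / (p - 1))) volume := by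
  have hqp := lt_critExp hp hN
  have hq := one_lt_critExp hp hN
  set q := critExp N p with hq_def
  have hp1 : 0 < p - 1 := by linarith
  have hr0 : 0 < p / (p - 1) := by positivity
  have hr : q ≤ (q - 1) * (p / (p - 1)) := by
    rw [← mul_div_assoc, le_div_iff₀ hp1]; nlinarith
  have hmem := hu.memLp_of_critExp_le hp hN h hr
  have hm : AEStronglyMeasurable (powFun q ∘ u) volume :=
    ((measurable_powFun q).comp_aemeasurable h.memLp.1.aemeasurable).aestronglyMeasurable
  refine ⟨hm, ?_⟩
  rw [eLpNorm_ofReal_eq hr0]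
  refine ENNReal.rpow_lt_top_of_nonneg (by positivity) (ne_of_lt ?_)
  have h2 := lintegral_rpow_lt_top (by linarith) hmem
  refine lt_of_eq_of_lt (lintegral_congr fun x => ?_) h2
  rw [ENNReal.rpow_mul, ← ofReal_norm, Function.comp_apply, norm_powFun hq,
    ← ENNReal.ofReal_rpow_of_nonneg (norm_nonneg _) (by linarith), ofReal_norm]

/-- Energy inequality obtained by testing the equation with `w - u`. -/
theorem IsWeakSolution.energy_inequality {s p : ℝ} (hp : 1 < p) (hN : p < (N : ℝ))
    {u w : Space N → ℝ} {G H : Space N → Space N} {φ ψ : ℕ → Space N → ℝ}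
    (hu : IsWeakSolution s p u) (h : WApprox s p u G φ) (h' : WApprox s p w H ψ)
    (hg : MemLp (powFun (critExp N p) ∘ u) (ENNReal.ofReal (p / (p - 1))) volume)
    (hg' : MemLp (powFun (critExp N p) ∘ w) (ENNReal.ofReal (p / (p - 1))) volume)
    (hd : MemLp (w - u) (ENNReal.ofReal p) volume) :
    ((∫⁻ x, ‖w x‖ₑ ^ critExp N p).toReal - (∫⁻ x, ‖u x‖ₑ ^ critExp N p).toReal) / critExp N p -
      (eLpNorm (powFun (critExp N p) ∘ w - powFun (critExp N p) ∘ u)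
        (ENNReal.ofReal (p / (p - 1))) volume *
        eLpNorm (w - u) (ENNReal.ofReal p) volume).toReal ≤
    ((∫⁻ x, ‖H x‖ₑ ^ p).toReal - (∫⁻ x, ‖G x‖ₑ ^ p).toReal) / p +
    ((∫⁻ z, ‖increment w z‖ₑ ^ p ∂kernelMeasure N s p).toReal -
      (∫⁻ z, ‖increment u z‖ₑ ^ p ∂kernelMeasure N s p).toReal) / p := by
  have hp0 : 0 < p := by linarith
  have hq := one_lt_critExp hp hN
  set q := critExp N p with hq_def
  have hq0 : 0 < q := by linarith
  have htest := hu.test hp hN h (h'.sub hp hN h)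
  have h1 := integral_rpow_sub_two_mul_inner_sub_le hp h.memLp_grad h'.memLp_grad
  have h2 := integral_rpow_sub_two_mul_inner_sub_le hp h.memLp_increment h'.memLp_increment
  rw [increment_sub] at htest
  simp only [Pi.sub_apply] at htest
  rw [toReal_lintegral_enorm_rpow hq0 h.memLp.1, toReal_lintegral_enorm_rpow hq0 h'.memLp.1,
    toReal_lintegral_enorm_rpow hp0 h.memLp_grad.1, toReal_lintegral_enorm_rpow hp0 h'.memLp_grad.1,
    toReal_lintegral_enorm_rpow hp0 h.memLp_increment.1,
    toReal_lintegral_enorm_rpow hp0 h'.memLp_increment.1]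
  have hconj : (ENNReal.ofReal (p / (p - 1))).HolderConjugate (ENNReal.ofReal p) :=
    (Real.HolderConjugate.conjExponent hp).symm.ennrealOfReal
  have hE : MemLp ((powFun q ∘ w - powFun q ∘ u) • (w - u)) 1 volume := hd.smul (hg'.sub hg)
  have hEi : Integrable ((powFun q ∘ w - powFun q ∘ u) • (w - u)) volume :=
    memLp_one_iff_integrable.1 hE
  have hEb : ∫ x, ((powFun q ∘ w - powFun q ∘ u) • (w - u)) x ≤
      (eLpNorm (powFun q ∘ w - powFun q ∘ u) (ENNReal.ofReal (p / (p - 1))) volume *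
        eLpNorm (w - u) (ENNReal.ofReal p) volume).toReal := by
    refine (le_abs_self _).trans ?_
    rw [← Real.norm_eq_abs]
    refine (norm_integral_le_lintegral_norm _).trans ?_
    refine ENNReal.toReal_mono (ENNReal.mul_ne_top (hg'.sub hg).eLpNorm_ne_top hd.eLpNorm_ne_top) ?_
    simp_rw [ofReal_norm]
    rw [← eLpNorm_one_eq_lintegral_enorm]
    exact eLpNorm_smul_le_mul_eLpNorm hd.1 (hg'.sub hg).1
  have iu := integrable_norm_rpow_of_memLp hq0 h.memLp
  have iw := integrable_norm_rpow_of_memLp hq0 h'.memLp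
  -- Convexity at `u` would bound the right-hand side of the equation from the wrong side. The
  -- tangent inequality is taken at `w` instead, and replacing `powFun q ∘ w` by `powFun q ∘ u`
  -- costs the product of two differences.
  have hlow : ((∫ x, ‖w x‖ ^ q) - ∫ x, ‖u x‖ ^ q) / q -
      ∫ x, ((powFun q ∘ w - powFun q ∘ u) • (w - u)) x ≤
      ∫ x, ‖u x‖ ^ (q - 2) * inner ℝ (u x) (w x - u x) := by
    have iq : Integrable (fun x => (‖w x‖ ^ q - ‖u x‖ ^ q) / q) volume := (iw.sub iu).div_const q
    rw [← integral_sub iw iu, ← integral_div, ← integral_sub iq hEi]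
    refine integral_mono (iq.sub hEi)
      (integrable_rpow_sub_two_mul_inner hq h.memLp (h'.memLp.sub h.memLp)) fun x => ?_
    have hx := rpow_sub_two_mul_inner_sub_le hq (w x) (u x)
    have e1 : (‖w x‖ ^ q - ‖u x‖ ^ q) / q = -((‖u x‖ ^ q - ‖w x‖ ^ q) / q) := by ring
    simp only [RCLike.inner_apply, conj_trivial, Pi.smul_apply', Pi.sub_apply, Function.comp_apply,
      smul_eq_mul, powFun] at hx ⊢
    rw [e1]
    linarith
  linarith

/-- From `a Y₁ + b Y₂ = a (Y₁ + Y₂) + (b - a) Y₂`: the exact factor acts on the total energy, and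
the mismatch meets only the tail. In the application `Y₂` depends on `t`, whereas its majorant `Z`
does not. -/
theorem toReal_le_of_split {X Y₁ Y₂ Z : ℝ≥0∞} {a b : ℝ} (ha : 0 ≤ a) (hb : 0 ≤ b)
    (hY : Y₁ + Y₂ < ⊤) (hZ : Y₂ ≤ Z) (hZt : Z < ⊤)
    (hX : X ≤ ENNReal.ofReal a * Y₁ + ENNReal.ofReal b * Y₂) :
    X.toReal ≤ a * (Y₁ + Y₂).toReal + |b - a| * Z.toReal := by
  obtain ⟨h1, h2⟩ := ENNReal.add_lt_top.1 hY
  have e := ENNReal.toReal_mono (ENNReal.add_ne_top.2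
    ⟨ENNReal.mul_ne_top ENNReal.ofReal_ne_top h1.ne,
      ENNReal.mul_ne_top ENNReal.ofReal_ne_top h2.ne⟩) hX
  rw [ENNReal.toReal_add (ENNReal.mul_ne_top ENNReal.ofReal_ne_top h1.ne)
    (ENNReal.mul_ne_top ENNReal.ofReal_ne_top h2.ne), ENNReal.toReal_mul, ENNReal.toReal_mul,
    ENNReal.toReal_ofReal ha, ENNReal.toReal_ofReal hb] at e
  rw [ENNReal.toReal_add h1.ne h2.ne]
  have e2 := ENNReal.toReal_mono hZt.ne hZ
  have e3 : (b - a) * Y₂.toReal ≤ |b - a| * Z.toReal :=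
    mul_le_mul (le_abs_self _) e2 ENNReal.toReal_nonneg (abs_nonneg _)
  linarith

theorem le_toReal_of_split {X Y₁ Y₂ Z : ℝ≥0∞} {a b : ℝ} (ha : 0 ≤ a) (hb : 0 ≤ b)
    (hY : Y₁ + Y₂ < ⊤) (hZ : Y₂ ≤ Z) (hZt : Z < ⊤) (hXt : X < ⊤)
    (hX : ENNReal.ofReal a * Y₁ + ENNReal.ofReal b * Y₂ ≤ X) :
    a * (Y₁ + Y₂).toReal - |b - a| * Z.toReal ≤ X.toReal := by
  obtain ⟨h1, h2⟩ := ENNReal.add_lt_top.1 hY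
  have e := ENNReal.toReal_mono hXt.ne hX
  rw [ENNReal.toReal_add (ENNReal.mul_ne_top ENNReal.ofReal_ne_top h1.ne)
    (ENNReal.mul_ne_top ENNReal.ofReal_ne_top h2.ne), ENNReal.toReal_mul, ENNReal.toReal_mul,
    ENNReal.toReal_ofReal ha, ENNReal.toReal_ofReal hb] at e
  rw [ENNReal.toReal_add h1.ne h2.ne]
  have e2 := ENNReal.toReal_mono hZt.ne hZ
  have e3 : -(b - a) * Y₂.toReal ≤ |b - a| * Z.toReal :=
    mul_le_mul (neg_le_abs _) e2 ENNReal.toReal_nonneg (abs_nonneg _)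
  linarith

theorem hasDerivAt_one_add_mul_rpow (c r : ℝ) :
    HasDerivAt (fun t : ℝ => (1 + t * c) ^ r) (r * c) 0 := by
  have h1 : HasDerivAt (fun t : ℝ => 1 + t * c) c 0 := by
    simpa using ((hasDerivAt_id (0 : ℝ)).mul_const c).const_add 1
  have := h1.rpow_const (p := r) (Or.inl (by simp))
  simpa [mul_comm] using this

theorem hasDerivAt_mul_of_eq_one {f g : ℝ → ℝ} {a b : ℝ} (hf : HasDerivAt f a 0)
    (hg : HasDerivAt g b 0) (hf1 : f 0 = 1) (hg1 : g 0 = 1) :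
    HasDerivAt (fun t => f t * g t) (a + b) 0 := by
  have := hf.mul hg
  rw [hf1, hg1, mul_one, one_mul] at this
  exact this

theorem tendsto_slope {f : ℝ → ℝ} {a : ℝ} (hf : HasDerivAt f a 0) (hf1 : f 0 = 1) :
    Tendsto (fun t => (f t - 1) / t) (𝓝[>] 0) (𝓝 a) := by
  have := hf.tendsto_slope_zero_right
  simp only [zero_add, hf1, smul_eq_mul] at this
  exact this.congr fun t => by ring

theorem tendsto_setLIntegral_compl {α : Type*} [MeasurableSpace α] {μ : Measure α}
    {f : α → ℝ≥0∞} (hf : AEMeasurable f μ) (hfin : ∫⁻ x, f x ∂μ < ⊤) {S : ℕ → Set α}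
    (hS : ∀ n, MeasurableSet (S n)) (hx : ∀ x, ∀ᶠ n in atTop, x ∈ S n) :
    Tendsto (fun n => (∫⁻ x in (S n)ᶜ, f x ∂μ).toReal) atTop (𝓝 0) := by
  have h1 : Tendsto (fun n => ∫⁻ x, (S n)ᶜ.indicator f x ∂μ) atTop (𝓝 (∫⁻ _, 0 ∂μ)) := by
    refine tendsto_lintegral_of_dominated_convergence' f
      (fun n => hf.indicator (hS n).compl)
      (fun n => Eventually.of_forall fun x => Set.indicator_le_self _ _ _) hfin.ne
      (Eventually.of_forall fun x => ?_)
    refine tendsto_const_nhds.congr' ?_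
    filter_upwards [hx x] with n hn
    simp [hn]
  rw [lintegral_zero] at h1
  simp_rw [lintegral_indicator (hS _).compl] at h1
  have h2 := (ENNReal.tendsto_toReal ENNReal.zero_ne_top).comp h1
  rwa [ENNReal.toReal_zero] at h2

/-- The Pohozaev inequality with errors coming from outside a ball. -/
theorem IsWeakSolution.local_pohozaev {s p : ℝ} (hs : s ∈ Set.Ioo (0 : ℝ) 1) (hp : 1 < p)
    (hN : p < (N : ℝ)) {u : Space N → ℝ} {G : Space N → Space N} {φ : ℕ → Space N → ℝ}
    (hu : IsWeakSolution s p u) (h : WApprox s p u G φ) {L R M : ℝ} {V : Space N → Space N}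
    (hR : 0 < R) (hM : 0 ≤ M) (hVc : Continuous V)
    (hV : ∀ t : ℝ, 0 ≤ t → t * L ≤ 1 / 2 → IsLocalDilation R t L M fun x => x + t • V x) :
    (-(N : ℝ) * (∫⁻ x, ‖u x‖ₑ ^ critExp N p).toReal - |-(N : ℝ) * L - -(N : ℝ)| *
      (∫⁻ x in (Metric.ball 0 R)ᶜ, ‖u x‖ₑ ^ critExp N p).toReal) / critExp N p ≤
    ((p - N) * (∫⁻ x, ‖G x‖ₑ ^ p).toReal + |(p * L + N * L) - (p - N)| *
      (∫⁻ x in (Metric.ball 0 R)ᶜ, ‖G x‖ₑ ^ p).toReal) / p +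
    ((s * p - N) * (∫⁻ z, ‖increment u z‖ₑ ^ p ∂kernelMeasure N s p).toReal +
      |((N + s * p) * L + (N * L + N * L)) - (s * p - N)| *
      (∫⁻ z in (Metric.ball 0 R ×ˢ Metric.ball 0 R)ᶜ, ‖increment u z‖ₑ ^ p
        ∂kernelMeasure N s p).toReal) / p := by
  have hp0 : 0 < p := by linarith
  have hp1 : 0 < p - 1 := by linarith
  have hq := one_lt_critExp hp hN
  have hg := hu.memLp_powFun hp hN h
  set q := critExp N p with hq_def
  have hq0 : 0 < q := by linarith
  set α : ℝ := (N : ℝ) + s * p with hα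
  set g := powFun q ∘ u with hg_def
  set A := ∫⁻ x, ‖G x‖ₑ ^ p with hA
  set B := ∫⁻ z, ‖increment u z‖ₑ ^ p ∂kernelMeasure N s p with hB
  set Q := ∫⁻ x, ‖u x‖ₑ ^ q with hQ
  have hAt : A < ⊤ := lintegral_rpow_lt_top hp0 h.memLp_grad
  have hBt : B < ⊤ := lintegral_rpow_lt_top hp0 h.memLp_increment
  have hQt : Q < ⊤ := lintegral_rpow_lt_top hq0 h.memLp
  set A' := ∫⁻ x in (Metric.ball (0 : Space N) R)ᶜ, ‖G x‖ₑ ^ p with hA'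
  set B' := ∫⁻ z in (Metric.ball (0 : Space N) R ×ˢ Metric.ball (0 : Space N) R)ᶜ,
    ‖increment u z‖ₑ ^ p ∂kernelMeasure N s p with hB'
  set Q' := ∫⁻ x in (Metric.ball (0 : Space N) R)ᶜ, ‖u x‖ₑ ^ q with hQ'
  have hA't : A' < ⊤ := (setLIntegral_le_lintegral _ _).trans_lt hAt
  have hB't : B' < ⊤ := (setLIntegral_le_lintegral _ _).trans_lt hBt
  have hQ't : Q' < ⊤ := (setLIntegral_le_lintegral _ _).trans_lt hQt
  -- the scaling factors inside and outside the ball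
  set ai : ℝ → ℝ := fun t => (1 + t) ^ p * (1 + t) ^ (-(N : ℝ)) with hai
  set ao : ℝ → ℝ := fun t => (1 + t * L) ^ p * (1 - t * L) ^ (-(N : ℝ)) with hao
  set bi : ℝ → ℝ := fun t => (1 + t) ^ α * ((1 + t) ^ (-(N : ℝ)) * (1 + t) ^ (-(N : ℝ))) with hbi
  set bo : ℝ → ℝ := fun t =>
    (1 + t * L) ^ α * ((1 - t * L) ^ (-(N : ℝ)) * (1 - t * L) ^ (-(N : ℝ))) with hbo
  set mi : ℝ → ℝ := fun t => (1 + t) ^ (-(N : ℝ)) with hmi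
  set mo : ℝ → ℝ := fun t => (1 + t * L) ^ (-(N : ℝ)) with hmo
  have d1 : ∀ r : ℝ, HasDerivAt (fun t : ℝ => (1 + t) ^ r) r 0 := fun r => by
    simpa using hasDerivAt_one_add_mul_rpow 1 r
  have d2 : ∀ r : ℝ, HasDerivAt (fun t : ℝ => (1 - t * L) ^ r) (-r * L) 0 := fun r => by
    simpa [sub_eq_add_neg] using hasDerivAt_one_add_mul_rpow (-L) r
  -- The inner slopes `p - N`, `sp - N` and `-N` are the Pohozaev coefficients. Of the outer slopes
  -- it matters only that they are finite and independent of `R`.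
  have sai : Tendsto (fun t => (ai t - 1) / t) (𝓝[>] 0) (𝓝 (p - N)) :=
    tendsto_slope (hasDerivAt_mul_of_eq_one (d1 p) (d1 _) (by simp) (by simp)) (by simp [hai])
  have sao : Tendsto (fun t => (ao t - 1) / t) (𝓝[>] 0) (𝓝 (p * L + N * L)) := by
    have := tendsto_slope (hasDerivAt_mul_of_eq_one (hasDerivAt_one_add_mul_rpow L p)
      (d2 (-(N : ℝ))) (by simp) (by simp)) (by simp)
    rwa [neg_neg] at this
  have sbi : Tendsto (fun t => (bi t - 1) / t) (𝓝[>] 0) (𝓝 (s * p - N)) := by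
    have := tendsto_slope (hasDerivAt_mul_of_eq_one (d1 α) (hasDerivAt_mul_of_eq_one (d1 (-(N : ℝ)))
      (d1 (-(N : ℝ))) (by simp) (by simp)) (by simp) (by simp)) (by simp)
    rwa [show α + (-(N : ℝ) + -(N : ℝ)) = s * p - N by rw [hα]; ring] at this
  have sbo : Tendsto (fun t => (bo t - 1) / t) (𝓝[>] 0) (𝓝 (α * L + (N * L + N * L))) := by
    have := tendsto_slope (hasDerivAt_mul_of_eq_one (hasDerivAt_one_add_mul_rpow L α)
      (hasDerivAt_mul_of_eq_one (d2 (-(N : ℝ))) (d2 (-(N : ℝ))) (by simp) (by simp))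
      (by simp) (by simp)) (by simp)
    rwa [neg_neg] at this
  have smi : Tendsto (fun t => (mi t - 1) / t) (𝓝[>] 0) (𝓝 (-(N : ℝ))) :=
    tendsto_slope (d1 _) (by simp [hmi])
  have smo : Tendsto (fun t => (mo t - 1) / t) (𝓝[>] 0) (𝓝 (-(N : ℝ) * L)) :=
    tendsto_slope (hasDerivAt_one_add_mul_rpow L _) (by simp [hmo])
  -- This factor tends to zero without any rate; the factor `t` needed to make the error `o(t)`
  -- comes entirely from the displacement of `u` in `L^p`.
  set e₁ : ℝ → ℝ≥0∞ := fun t => eLpNorm (fun x => g (x + t • V x) - g x)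
    (ENNReal.ofReal (p / (p - 1))) volume with he₁
  set K : ℝ≥0∞ := (ENNReal.ofReal (2 ^ (N : ℝ))) ^ (1 / p) *
    eLpNorm G (ENNReal.ofReal p) volume with hK
  have hKt : K ≠ ⊤ := ENNReal.mul_ne_top
    (ENNReal.rpow_ne_top_of_nonneg (by positivity) ENNReal.ofReal_ne_top)
    h.memLp_grad.eLpNorm_ne_top
  have hconj : 1 ≤ p / (p - 1) := by rw [le_div_iff₀ hp1]; linarith
  have he₁t : Tendsto (fun t => (e₁ t).toReal) (𝓝[>] 0) (𝓝 0) := by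
    have := (ENNReal.tendsto_toReal ENNReal.zero_ne_top).comp
      (tendsto_eLpNorm_comp_sub hconj hVc hM hV hg)
    rwa [ENNReal.toReal_zero] at this
  have hmain : ∀ᶠ t : ℝ in 𝓝[>] 0,
      ((mi t - 1) / t * Q.toReal - |(mo t - 1) / t - (mi t - 1) / t| * Q'.toReal) / q -
        (e₁ t).toReal * (M * K.toReal) ≤
      ((ai t - 1) / t * A.toReal + |(ao t - 1) / t - (ai t - 1) / t| * A'.toReal) / p +
      ((bi t - 1) / t * B.toReal + |(bo t - 1) / t - (bi t - 1) / t| * B'.toReal) / p := by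
    filter_upwards [eventually_small L] with t ht
    obtain ⟨ht0, ht1, htL⟩ := ht
    have hd := hV t ht0.le htL
    set T : Space N → Space N := fun x => x + t • V x with hT
    have ht' : 0 < 1 + t := by linarith
    have htL' : 0 < 1 - t * L := by linarith
    have htL'' : 0 < 1 + t * L := by have := mul_nonneg ht0.le hd.const_nonneg; linarith
    have hw := hd.wApprox_comp hs hp hN h
    -- Tails outside the expanding ball are dominated by the fixed tails outside radius `R`, so the
    -- error terms have a limit as `t → 0`.
    have hball : Metric.ball (0 : Space N) R ⊆ Metric.ball 0 ((1 + t) * R) :=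
      Metric.ball_subset_ball (by nlinarith)
    have hBm : MeasurableSet (Metric.ball (0 : Space N) ((1 + t) * R)) :=
      Metric.isOpen_ball.measurableSet
    have hBm2 := hBm.prod hBm
    have hgw : MemLp (g ∘ T) (ENNReal.ofReal (p / (p - 1))) volume :=
      memLp_comp hd.quasiMeasurePreserving ENNReal.ofReal_ne_top (by positivity) hd.map_volume_le hg
    have hdis : eLpNorm (u ∘ T - u) (ENNReal.ofReal p) volume ≤ ENNReal.ofReal (t * M) * K := by
      rw [hK, ← mul_assoc]
      exact h.eLpNorm_comp_sub_le hp hN hVc hV ht0.le htL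
    have hdm : MemLp (u ∘ T - u) (ENNReal.ofReal p) volume :=
      ⟨hw.memLp.1.sub h.memLp.1, hdis.trans_lt (ENNReal.mul_lt_top ENNReal.ofReal_lt_top hKt.lt_top)⟩
    have hen := hu.energy_inequality hp hN h hw hg hgw hdm
    have hA1 : (∫⁻ x, ‖IsLocalDilation.pullGrad T G x‖ₑ ^ p).toReal ≤
        ai t * A.toReal + |ao t - ai t| * A'.toReal := by
      have hsum : _ = A := lintegral_add_compl (fun x => ‖G x‖ₑ ^ p) hBm
      have := toReal_le_of_split (by positivity) (by positivity) (hsum ▸ hAt)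
        (lintegral_mono_set (Set.compl_subset_compl.2 hball)) hA't
        (hd.lintegral_pullGrad_le hp0 h.memLp_grad.1)
      rwa [hsum] at this
    have hB1 : (∫⁻ z, ‖increment (u ∘ T) z‖ₑ ^ p ∂kernelMeasure N s p).toReal ≤
        bi t * B.toReal + |bo t - bi t| * B'.toReal := by
      have hsum : _ = B := lintegral_add_compl (fun z => ‖increment u z‖ₑ ^ p) hBm2
      have := toReal_le_of_split (by positivity) (by positivity) (hsum ▸ hBt)
        (lintegral_mono_set (Set.compl_subset_compl.2 (Set.prod_mono hball hball))) hB't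
        (hd.lintegral_increment_comp_le hs.1 hp0 h.memLp.1)
      rwa [hsum] at this
    have hQ1 : mi t * Q.toReal - |mo t - mi t| * Q'.toReal ≤
        (∫⁻ x, ‖(u ∘ T) x‖ₑ ^ q).toReal := by
      have hsum : _ = Q := lintegral_add_compl (fun x => ‖u x‖ₑ ^ q) hBm
      have := le_toReal_of_split (by positivity) (by positivity) (hsum ▸ hQt)
        (lintegral_mono_set (Set.compl_subset_compl.2 hball)) hQ't
        (lintegral_rpow_lt_top hq0 hw.memLp) (hd.le_lintegral_comp h.memLp.1)
      rwa [hsum] at this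
    have hE1 : (eLpNorm (powFun q ∘ (u ∘ T) - powFun q ∘ u)
        (ENNReal.ofReal (p / (p - 1))) volume *
        eLpNorm (u ∘ T - u) (ENNReal.ofReal p) volume).toReal ≤
        t * ((e₁ t).toReal * (M * K.toReal)) := by
      rw [ENNReal.toReal_mul]
      have h1 := ENNReal.toReal_mono (ENNReal.mul_ne_top ENNReal.ofReal_ne_top hKt) hdis
      rw [ENNReal.toReal_mul, ENNReal.toReal_ofReal (by positivity)] at h1
      calc _ ≤ (e₁ t).toReal * (t * M * K.toReal) :=
            mul_le_mul_of_nonneg_left h1 ENNReal.toReal_nonneg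
        _ = _ := by ring
    have habs : ∀ a b : ℝ, |(b - 1) / t - (a - 1) / t| = |b - a| / t := fun a b => by
      rw [← sub_div, abs_div, abs_of_pos ht0]; congr 2; ring
    rw [habs, habs, habs]
    have e1 : ((mi t - 1) / t * Q.toReal - |mo t - mi t| / t * Q'.toReal) / q =
        ((mi t * Q.toReal - |mo t - mi t| * Q'.toReal - Q.toReal) / q) / t := by
      field_simp; ring
    have e2 : ∀ x y a a' : ℝ, ((x - 1) / t * a + |y - x| / t * a') / p =
        ((x * a + |y - x| * a' - a) / p) / t := by
      intro x y a a'
      field_simp; ring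
    rw [e1, e2, e2, ← add_div, sub_le_iff_le_add, div_le_iff₀ ht0, add_mul,
      div_mul_cancel₀ _ ht0.ne']
    have i1 : (mi t * Q.toReal - |mo t - mi t| * Q'.toReal - Q.toReal) / q ≤
      ((∫⁻ x, ‖(u ∘ T) x‖ₑ ^ q).toReal - Q.toReal) / q := by gcongr
    have i2 : ((∫⁻ x, ‖IsLocalDilation.pullGrad T G x‖ₑ ^ p).toReal - A.toReal) / p ≤
      (ai t * A.toReal + |ao t - ai t| * A'.toReal - A.toReal) / p := by gcongr
    have i3 : ((∫⁻ z, ‖increment (u ∘ T) z‖ₑ ^ p ∂kernelMeasure N s p).toReal - B.toReal) / p ≤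
      (bi t * B.toReal + |bo t - bi t| * B'.toReal - B.toReal) / p := by gcongr
    linarith
  have hl : Tendsto (fun t => ((mi t - 1) / t * Q.toReal -
      |(mo t - 1) / t - (mi t - 1) / t| * Q'.toReal) / q - (e₁ t).toReal * (M * K.toReal)) (𝓝[>] 0)
      (𝓝 ((-(N : ℝ) * Q.toReal - |-(N : ℝ) * L - -(N : ℝ)| * Q'.toReal) / q -
        0 * (M * K.toReal))) :=
    (((smi.mul_const _).sub ((smo.sub smi).abs.mul_const _)).div_const q).sub (he₁t.mul_const _)
  have hr := ((((sai.mul_const A.toReal).add ((sao.sub sai).abs.mul_const A'.toReal)).div_const p).add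
    (((sbi.mul_const B.toReal).add ((sbo.sub sbi).abs.mul_const B'.toReal)).div_const p))
  rw [zero_mul, sub_zero] at hl
  exact le_of_tendsto_of_tendsto hl hr hmain

/-- The Nehari identity, from testing the equation with `u` itself. -/
theorem toReal_lintegral_eq_of_test {s p : ℝ} (hp : 1 < p) (hN : p < (N : ℝ))
    {u : Space N → ℝ} {G : Space N → Space N} {φ : ℕ → Space N → ℝ}
    (hu : IsWeakSolution s p u) (h : WApprox s p u G φ) :
    (∫⁻ x, ‖G x‖ₑ ^ p).toReal + (∫⁻ z, ‖increment u z‖ₑ ^ p ∂kernelMeasure N s p).toReal =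
      (∫⁻ x, ‖u x‖ₑ ^ critExp N p).toReal := by
  have hp0 : 0 < p := by linarith
  have hq0 : 0 < critExp N p := by linarith [one_lt_critExp hp hN]
  have := hu.test hp hN h h
  simp_rw [rpow_sub_two_mul_inner_self hp0, rpow_sub_two_mul_inner_self hq0] at this
  rwa [toReal_lintegral_enorm_rpow hp0 h.memLp_grad.1,
    toReal_lintegral_enorm_rpow hp0 h.memLp_increment.1, toReal_lintegral_enorm_rpow hq0 h.memLp.1]

/-- The Gagliardo seminorm of a weak solution vanishes. -/
theorem IsWeakSolution.lintegral_increment_eq_zero {s p : ℝ} (hs : s ∈ Set.Ioo (0 : ℝ) 1)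
    (hp : 1 < p) (hN : p < (N : ℝ)) {u : Space N → ℝ} {G : Space N → Space N}
    {φ : ℕ → Space N → ℝ} (hu : IsWeakSolution s p u) (h : WApprox s p u G φ) :
    ∫⁻ z, ‖increment u z‖ₑ ^ p ∂kernelMeasure N s p = 0 := by
  have hp0 : 0 < p := by linarith
  have hq := one_lt_critExp hp hN
  have hq0 : 0 < critExp N p := by linarith
  have hBt := lintegral_rpow_lt_top hp0 h.memLp_increment
  have hid := toReal_lintegral_eq_of_test hp hN hu h
  obtain ⟨L, -, hL⟩ := exists_isLocalDilation N
  have hR : ∀ n : ℕ, 0 < (n : ℝ) + 1 := fun n => by positivity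
  choose M V hM hVc hV using fun n : ℕ => hL ((n : ℝ) + 1) (hR n)
  have hpoh := fun n => hu.local_pohozaev hs hp hN h (hR n) (hM n) (hVc n) (hV n)
  have hmemS : ∀ x : Space N, ∀ᶠ n : ℕ in atTop, x ∈ Metric.ball (0 : Space N) ((n : ℝ) + 1) := by
    intro x
    obtain ⟨k, hk⟩ := exists_nat_gt ‖x‖
    filter_upwards [eventually_ge_atTop k] with n hn
    have : (k : ℝ) ≤ n := by exact_mod_cast hn
    rw [mem_ball_zero_iff]; linarith
  have hmS : ∀ n : ℕ, MeasurableSet (Metric.ball (0 : Space N) ((n : ℝ) + 1)) :=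
    fun n => Metric.isOpen_ball.measurableSet
  have tQ := tendsto_setLIntegral_compl (h.memLp.1.enorm.pow_const (critExp N p))
    (lintegral_rpow_lt_top hq0 h.memLp) hmS hmemS
  have tA := tendsto_setLIntegral_compl (h.memLp_grad.1.enorm.pow_const p)
    (lintegral_rpow_lt_top hp0 h.memLp_grad) hmS hmemS
  have tB := tendsto_setLIntegral_compl (h.memLp_increment.1.enorm.pow_const p) hBt
    (fun n => (hmS n).prod (hmS n))
    (fun z => ((hmemS z.1).and (hmemS z.2)).mono fun n hn => ⟨hn.1, hn.2⟩)
  -- The coefficients of the tails involve `L` but not the radius, so the tails vanish as the radius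
  -- grows.
  have hlim := le_of_tendsto_of_tendsto'
    ((tendsto_const_nhds.sub (tQ.const_mul _)).div_const _)
    (((tendsto_const_nhds.add (tA.const_mul _)).div_const p).add
      ((tendsto_const_nhds.add (tB.const_mul _)).div_const p)) hpoh
  set A := (∫⁻ x, ‖G x‖ₑ ^ p).toReal
  set B := (∫⁻ z, ‖increment u z‖ₑ ^ p ∂kernelMeasure N s p).toReal with hB
  rw [← hid] at hlim
  simp only [mul_zero, sub_zero, add_zero] at hlim
  have hNp : 0 < (N : ℝ) - p := by linarith
  have hN0 : 0 < (N : ℝ) := by linarith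
  -- Criticality, `N / p^* = (N - p) / p`: the gradient energy then cancels, leaving a positive
  -- multiple of the Gagliardo term.
  have e : -(N : ℝ) * (A + B) / critExp N p = (p - N) * (A + B) / p := by
    rw [critExp]; field_simp; ring
  rw [e, ← add_div, div_le_div_iff_of_pos_right hp0] at hlim
  have hB0 : 0 ≤ B := ENNReal.toReal_nonneg
  have hB1 : p * (1 - s) * B ≤ 0 := by linarith
  have hps : 0 < p * (1 - s) := mul_pos hp0 (by linarith [hs.2])
  have hB2 : B = 0 := by nlinarith
  rcases (ENNReal.toReal_eq_zero_iff _).1 hB2 with h0 | h0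
  · exact h0
  · exact absurd h0 hBt.ne

/-- Every weak solution vanishes almost everywhere. -/
theorem IsWeakSolution.ae_eq_zero {s p : ℝ} (hs : s ∈ Set.Ioo (0 : ℝ) 1) (hp : 1 < p)
    (hN : p < (N : ℝ)) {u : Space N → ℝ} (hu : IsWeakSolution s p u) : u =ᵐ[volume] 0 := by
  have hp0 : 0 < p := by linarith
  have hq := one_lt_critExp hp hN
  have hN0 : 0 < (N : ℝ) := by linarith
  obtain ⟨G, φ, h⟩ := hu.1.exists_wApprox hs hp hN
  have h0 := hu.lintegral_increment_eq_zero hs hp hN h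
  rw [lintegral_eq_zero_iff' (h.memLp_increment.1.enorm.pow_const p), kernelMeasure] at h0
  have h1 : ∀ᵐ z : Space N × Space N, u z.1 = u z.2 := by
    have h2 := (ae_withDensity_iff (measurable_kernel N _)).1 h0
    filter_upwards [h2] with z hz
    -- The density vanishes only on the diagonal, where the two values of `u` agree trivially.
    by_cases hz0 : ENNReal.ofReal ((‖z.1 - z.2‖ ^ ((N : ℝ) + s * p))⁻¹) = 0
    · rw [ENNReal.ofReal_eq_zero, inv_nonpos] at hz0
      by_contra hne
      have : 0 < ‖z.1 - z.2‖ := norm_pos_iff.2 (sub_ne_zero.2 fun e => hne (by rw [e]))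
      exact absurd hz0 (not_le.2 (by positivity))
    · have := hz hz0
      simp only [Pi.zero_apply, ENNReal.rpow_eq_zero_iff_of_pos hp0, enorm_eq_zero] at this
      exact sub_eq_zero.1 this
  obtain ⟨x, hx⟩ := (Measure.ae_ae_of_ae_prod h1).exists
  have hc : u =ᵐ[volume] fun _ => u x := hx.mono fun y hy => hy.symm
  have hmem := h.memLp.ae_eq hc
  have : Nontrivial (Space N) := by
    have : 0 < Module.finrank ℝ (Space N) := by simpa using (by exact_mod_cast hN0 : 0 < N)
    exact Module.nontrivial_of_finrank_pos this
  have : NoncompactSpace (Space N) := NormedSpace.noncompactSpace ℝ _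
  -- A constant in `L^{p^*}` over a space of infinite measure is zero.
  rw [memLp_const_iff (by simpa using (by linarith : 0 < critExp N p)) (by simp),
    measure_univ_of_isAddLeftInvariant] at hmem
  filter_upwards [hc] with y hy
  rw [hy]
  simpa using hmem

end Pohozaev

end MixedPLaplace

/-- Weak solutions are bounded by a constant depending only on `N`, `s` and `p`. The two operators
scale differently, so the Pohozaev identity forces the Gagliardo seminorm of a weak solution to
vanish; hence the bound holds with the constant `0`. -/
theorem mainTheorem6 (N : ℕ) (s p : ℝ) (hs : s ∈ Set.Ioo (0 : ℝ) 1) (hp : 1 < p)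
    (hN : p < (N : ℝ)) :
    ∃ C : ℝ≥0, ∀ u : MixedPLaplace.Space N → ℝ, MixedPLaplace.IsWeakSolution s p u →
      MemLp u ∞ volume ∧ eLpNorm u ∞ volume ≤ (C : ℝ≥0∞) := by
  refine ⟨0, fun u hu => ?_⟩
  have h := hu.ae_eq_zero hs hp hN
  exact ⟨MemLp.zero'.ae_eq h.symm, by rw [eLpNorm_congr_ae h]; simp⟩
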